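/- Let $G\rightrightarrows P$ be a Lie groupoid (finite-dimensional, $C^\infty$) with source and target $\mathsf s,\mathsf t$ (surjective submersions), object inclusion $\epsilon:p\mapsto 1_p$ and multiplication $(g,h)\mapsto g\star h$, defined when $\mathsf s(g)=\mathsf t(h)$. Let $TG\rightrightarrows TP$ be its tangent groupoid, whose structure maps are the tangent maps of those of $G$, and regard $TP$ as a subset of $TG$ by means of $T\epsilon$. Write $T^{\mathsf t}G=\ker T\mathsf t$, $T^{\mathsf s}G=\ker T\mathsf s$ and $AG=T^{\mathsf t}G|_P$. Let $L_g:\mathsf t^{-1}(\mathsf s(g))\to\mathsf t^{-1}(\mathsf t(g))$, $h\mapsto g\star h$, and $R_g:\mathsf s^{-1}(\mathsf t(g))\to\mathsf s^{-1}(\mathsf s(g))$, $h\mapsto h\star g$, be the translations. Let $S\subseteq TG$ be a smooth vector subbundle of constant rank $k$ which is multiplicative, i.e. a set-theoretic subgroupoid of $TG\rightrightarrows TP$. Then: 1. $S\cap TP$ is a smooth vector subbundle of $TP$ (in particular its rank is locally constant). Its rank is constant on $P$ if $P$ is connected or, more generally, if $P$ is not the disjoint union of two nonempty open subsets that are $G$-invariant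 (a set $U\subseteq P$ is $G$-invariant if $\mathsf s(g)\in U\Leftrightarrow \mathsf t(g)\in U$ for all $g\in G$). 2. $S\cap TP$ is the set of units of the subgroupoid $S$ of $TG\rightrightarrows TP$, that is, the only subset of $TP$ over which $S$ is a subgroupoid. If the rank of $S\cap TP$ is constant (hence always in the situation of the second sentence of 1), then $S\rightrightarrows S\cap TP$, with the restricted structure maps, is a Lie groupoid, where $S$ and $S\cap TP$ are smooth embedded submanifolds of $TG$ and $TP$ of dimensions $\dim G+k$ and $\dim P+\operatorname{rk}(S\cap TP)$. 3. $S|_P=(S\cap TP)\oplus(S\cap AG)$, where both summands are smooth vector subbundles of $TG|_P$. 4. With $S^{\mathsf t}:=S\cap T^{\mathsf t}G$ and $S^{\mathsf s}:=S\cap T^{\mathsf s}G$, for all $g\in G$ $$S^{\mathsf t}(g)=0_g\star S^{\mathsf t}(1_{\mathsf s(g)})=T_{1_{\mathsf s(g)}}L_g\bigl(S^{\mathsf t}(1_{\mathsf s(g)})\bigr),\qquad S^{\mathsf s}(g)=S^{\mathsf s}(1_{\mathsf t(g)})\star 0_g=T_{1_{\mathsf t(g)}}R_g\bigl(S^{\mathsf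 s}(1_{\mathsf t(g)})\bigr).$$ 5. $S^{\mathsf t}$ and $S^{\mathsf s}$ are smooth vector subbundles of $TG$ (in particular their ranks are locally constant), and their ranks are constant on $G$ if $P$ satisfies the condition of the second sentence of 1. -/

import Mathlib

open scoped Manifold ContDiff Topology

noncomputable section

universe u v

/-- The structure maps of a groupoid `G ⇉ P`: source, target, object inclusion `p ↦ 1_p` and the
partial multiplication `g ⋆ h`, defined when `s(g) = t(h)`. The groupoid laws are in
`GroupoidOps.IsGroupoid`. -/
structure GroupoidOps (G : Type u) (P : Type v) where
  source : G → P
  target : G → P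
  unit : P → G
  mul : (g h : G) → source g = target h → G

namespace GroupoidOps

section Algebra

variable {G : Type u} {P : Type v} (𝒢 : GroupoidOps G P)

/-- The groupoid laws. -/
structure IsGroupoid : Prop where
  source_mul : ∀ (g h : G) (e : 𝒢.source g = 𝒢.target h), 𝒢.source (𝒢.mul g h e) = 𝒢.source h
  target_mul : ∀ (g h : G) (e : 𝒢.source g = 𝒢.target h), 𝒢.target (𝒢.mul g h e) = 𝒢.target g
  mul_assoc : ∀ (g h l : G) (e₁ : 𝒢.source g = 𝒢.target h) (e₂ : 𝒢.source h = 𝒢.target l)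
    (e₃ : 𝒢.source (𝒢.mul g h e₁) = 𝒢.target l) (e₄ : 𝒢.source g = 𝒢.target (𝒢.mul h l e₂)),
    𝒢.mul (𝒢.mul g h e₁) l e₃ = 𝒢.mul g (𝒢.mul h l e₂) e₄
  source_unit : ∀ p : P, 𝒢.source (𝒢.unit p) = p
  target_unit : ∀ p : P, 𝒢.target (𝒢.unit p) = p
  mul_unit : ∀ (g : G) (e : 𝒢.source g = 𝒢.target (𝒢.unit (𝒢.source g))),
    𝒢.mul g (𝒢.unit (𝒢.source g)) e = g
  unit_mul : ∀ (g : G) (e : 𝒢.source (𝒢.unit (𝒢.target g)) = 𝒢.target g),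
    𝒢.mul (𝒢.unit (𝒢.target g)) g e = g
  exists_inv : ∀ g : G, ∃ (g' : G) (e : 𝒢.source g = 𝒢.target g')
    (e' : 𝒢.source g' = 𝒢.target g),
    𝒢.mul g g' e = 𝒢.unit (𝒢.target g) ∧ 𝒢.mul g' g e' = 𝒢.unit (𝒢.source g)

/-- The set `G ×_P G` of composable pairs. -/
def composable : Set (G × G) := {q | 𝒢.source q.1 = 𝒢.target q.2}

open Classical in
/-- The multiplication as a function on `G × G`. Only its restriction to `composable` has a meaning,
and it is only ever used there (for smoothness on, and derivatives along, that subset). -/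
def mulExt (q : G × G) : G :=
  if e : 𝒢.source q.1 = 𝒢.target q.2 then 𝒢.mul q.1 q.2 e else q.1

/-- The subsets `A ⊆ G` and `B ⊆ P` form a (set) subgroupoid `A ⇉ B` of `G ⇉ P`. -/
structure IsSubgroupoid (A : Set G) (B : Set P) : Prop where
  source_mem : ∀ g ∈ A, 𝒢.source g ∈ B
  target_mem : ∀ g ∈ A, 𝒢.target g ∈ B
  unit_mem : ∀ p ∈ B, 𝒢.unit p ∈ A
  mul_mem : ∀ g ∈ A, ∀ h ∈ A, ∀ e : 𝒢.source g = 𝒢.target h, 𝒢.mul g h e ∈ A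
  exists_inv_mem : ∀ g ∈ A, ∃ g' ∈ A, ∃ (e : 𝒢.source g = 𝒢.target g')
    (e' : 𝒢.source g' = 𝒢.target g),
    𝒢.mul g g' e = 𝒢.unit (𝒢.target g) ∧ 𝒢.mul g' g e' = 𝒢.unit (𝒢.source g)

variable {𝒢} in
/-- The structure maps of a subgroupoid `A ⇉ B`, restricted from those of `G ⇉ P`. -/
def IsSubgroupoid.restrict {A : Set G} {B : Set P} (h : 𝒢.IsSubgroupoid A B) :
    GroupoidOps A B where
  source a := ⟨𝒢.source a, h.source_mem a a.2⟩
  target a := ⟨𝒢.target a, h.target_mem a a.2⟩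
  unit b := ⟨𝒢.unit b, h.unit_mem b b.2⟩
  mul a b e := ⟨𝒢.mul a b (congrArg Subtype.val e), h.mul_mem a a.2 b b.2 _⟩

/-- `P` is not the disjoint union of two nonempty open `G`-invariant subsets. This holds whenever
`P` is connected. -/
def IsOrbitConnected [TopologicalSpace P] : Prop :=
  ∀ U : Set P, IsClopen U → (∀ g, 𝒢.source g ∈ U ↔ 𝒢.target g ∈ U) → U = ∅ ∨ U = Set.univ

end Algebra

section Smooth

variable {EG : Type*} [NormedAddCommGroup EG] [NormedSpace ℝ EG]
  {HG : Type*} [TopologicalSpace HG] (I : ModelWithCorners ℝ EG HG)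
  {EP : Type*} [NormedAddCommGroup EP] [NormedSpace ℝ EP]
  {HP : Type*} [TopologicalSpace HP] (J : ModelWithCorners ℝ EP HP)
  {G : Type u} [TopologicalSpace G] [ChartedSpace HG G]
  {P : Type v} [TopologicalSpace P] [ChartedSpace HP P]
  (𝒢 : GroupoidOps G P)

/-- `G ⇉ P` is a Lie groupoid: the groupoid laws hold, source and target are surjective submersions,
and the object inclusion and the multiplication `G ×_P G → G` are smooth. As `G ×_P G` is an embedded
submanifold of `G × G`, a map on it is smooth if and only if it is smooth on it as a subset, that is,
if and only if it locally extends to smooth maps on open subsets of `G × G`. -/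
structure IsLieGroupoid : Prop extends 𝒢.IsGroupoid where
  source_submersion : Manifold.IsSubmersion I J ∞ 𝒢.source
  source_surjective : Function.Surjective 𝒢.source
  target_submersion : Manifold.IsSubmersion I J ∞ 𝒢.target
  target_surjective : Function.Surjective 𝒢.target
  unit_smooth : ContMDiff J I ∞ 𝒢.unit
  mul_smooth : ContMDiffOn (I.prod I) I ∞ 𝒢.mulExt 𝒢.composable

/-- The tangent prolongation `TG ⇉ TP`: the structure maps are the tangent maps of those of
`G ⇉ P`. If `Ts(v) = Tt(w)`, then `(v, w)` is tangent to `G ×_P G`, and `v ⋆ w = Tm(v, w)`, where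
`Tm` is the tangent map of `m : G ×_P G → G`; this is the derivative within the subset `G ×_P G`
of `G × G` (which is uniquely determined on the vectors tangent to the subset). -/
def tangent : GroupoidOps (TangentBundle I G) (TangentBundle J P) where
  source := tangentMap I J 𝒢.source
  target := tangentMap I J 𝒢.target
  unit := tangentMap J I 𝒢.unit
  mul v w _ := tangentMapWithin (I.prod I) I 𝒢.mulExt 𝒢.composable
    ⟨(v.proj, w.proj), (v.snd, w.snd)⟩

/-- The tangent map of the left translation `L_g : t⁻¹(s(g)) → t⁻¹(t(g))`, `h ↦ g ⋆ h`. -/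
def tangentLeft (g : G) : TangentBundle I G → TangentBundle I G :=
  tangentMapWithin I I (fun h => 𝒢.mulExt (g, h)) {h | 𝒢.target h = 𝒢.source g}

/-- The tangent map of the right translation `R_g : s⁻¹(t(g)) → s⁻¹(s(g))`, `h ↦ h ⋆ g`. -/
def tangentRight (g : G) : TangentBundle I G → TangentBundle I G :=
  tangentMapWithin I I (fun h => 𝒢.mulExt (h, g)) {h | 𝒢.source h = 𝒢.target g}

end Smooth

end GroupoidOps

section Distributions

variable {E : Type*} [NormedAddCommGroup E] [NormedSpace ℝ E]
  {H : Type*} [TopologicalSpace H] (I : ModelWithCorners ℝ E H)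
  {E' : Type*} [NormedAddCommGroup E'] [NormedSpace ℝ E']
  {H' : Type*} [TopologicalSpace H'] (J : ModelWithCorners ℝ E' H')
  {M : Type*} [TopologicalSpace M] [ChartedSpace H M]
  {B : Type*} [TopologicalSpace B] [ChartedSpace H' B]

/-- A distribution: a linear subspace `S(x) ⊆ T_x M` for each `x`. -/
abbrev TangentDistribution (M : Type*) [TopologicalSpace M] [ChartedSpace H M] :=
  (x : M) → Submodule ℝ (TangentSpace I x)

variable {I} in
/-- The union of the `S(x)`, as a subset of `TM`. -/
def TangentDistribution.total (S : TangentDistribution I M) : Set (TangentBundle I M) :=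
  {v | v.snd ∈ S v.proj}

variable {I} in
/-- The fibre `S(x)`, as a subset of `TM`. -/
def TangentDistribution.fiber (S : TangentDistribution I M) (x : M) : Set (TangentBundle I M) :=
  {v | v.proj = x ∧ v.snd ∈ S v.proj}

variable [IsManifold I 1 M]

/-- A family of subspaces `S(b) ⊆ T_{f(b)} M`, `b ∈ B`, is a smooth vector subbundle of the pullback
bundle `f^* TM` over `B`: around each point of `B` it has a smooth frame. Its rank is then locally
constant. -/
def IsSmoothSubbundleAlong (f : B → M) (S : (b : B) → Submodule ℝ (TangentSpace I (f b))) : Prop :=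
  ∀ b₀ : B, ∃ U : Set B, IsOpen U ∧ b₀ ∈ U ∧ ∃ (n : ℕ)
    (X : Fin n → (b : B) → TangentSpace I (f b)),
    (∀ i, ContMDiffOn J I.tangent ∞ (fun b => (⟨f b, X i b⟩ : TangentBundle I M)) U) ∧
    ∀ b ∈ U, LinearIndependent ℝ (fun i => X i b) ∧
      Submodule.span ℝ (Set.range fun i => X i b) = S b

/-- `S` is a smooth vector subbundle of `TM`. -/
def IsSmoothSubbundle (S : TangentDistribution I M) : Prop :=
  IsSmoothSubbundleAlong I I (id : M → M) S

end Distributions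

namespace GroupoidOps

variable {EG : Type*} [NormedAddCommGroup EG] [NormedSpace ℝ EG]
  {HG : Type*} [TopologicalSpace HG] (I : ModelWithCorners ℝ EG HG)
  {EP : Type*} [NormedAddCommGroup EP] [NormedSpace ℝ EP]
  {HP : Type*} [TopologicalSpace HP] (J : ModelWithCorners ℝ EP HP)
  {G : Type u} [TopologicalSpace G] [ChartedSpace HG G]
  {P : Type v} [TopologicalSpace P] [ChartedSpace HP P]
  (𝒢 : GroupoidOps G P)

/-- `S ⊆ TG` is multiplicative: it is a (set) subgroupoid of `TG ⇉ TP`, over some subset of `TP`. -/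
def IsMultiplicative (S : TangentDistribution I G) : Prop :=
  ∃ B : Set (TangentBundle J P), (𝒢.tangent I J).IsSubgroupoid S.total B

/-- `S ∩ TP` as a distribution on `P`, where `TP` is a subset of `TG` by means of `Tε`. -/
def interUnits (S : TangentDistribution I G) : TangentDistribution J P :=
  fun p => (S (𝒢.unit p)).comap (mfderiv J I 𝒢.unit p).toLinearMap

/-- `TP` as a family of subspaces of the `T_{1_p} G`, `p ∈ P`. -/
def tangentUnits (p : P) : Submodule ℝ (TangentSpace I (𝒢.unit p)) :=
  LinearMap.range (mfderiv J I 𝒢.unit p).toLinearMap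

/-- `T^t G = ker Tt`. -/
def kerTarget : TangentDistribution I G := fun g => LinearMap.ker (mfderiv I J 𝒢.target g).toLinearMap

/-- `T^s G = ker Ts`. -/
def kerSource : TangentDistribution I G := fun g => LinearMap.ker (mfderiv I J 𝒢.source g).toLinearMap

/-- The Lie algebroid `AG` as a vector bundle over `P`: the restriction of `T^t G` to the units. -/
def algebroid (p : P) : Submodule ℝ (TangentSpace I (𝒢.unit p)) :=
  𝒢.kerTarget I J (𝒢.unit p)

end GroupoidOps

end

/-!
The tangent groupoid satisfies the groupoid laws because its structure maps act on velocities of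
curves: every pair of composable tangent vectors is the velocity of a pair of composable curves,
as `s` is a submersion (`HasVelocity.exists_lift`), and `Tm` within the composable pairs is computed
by such curves (`HasVelocity.comp_within`). Moving the first factor into the required fibre of `s`
extends the multiplication of `TG` locally to smooth maps on open subsets of `TG × TG`.

Let `S` be multiplicative. Its units are the vectors `x` with `Tε x ∈ S`, and `Ts`, `Tt` map `S`
into them. Over a unit `1_p` the projection `Tε ∘ Tt` therefore preserves `S`, which gives the
splitting `S|_P = (S ∩ TP) ⊕ (S ∩ AG)` and smooth sections of both summands through each of their
vectors. Existence of such sections makes a rank lower semicontinuous; as the two ranks add up to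
`k`, both are locally constant, and both families are subbundles
(`HasSmoothSectionsAlong.isSmoothSubbundleAlong_of_finrank_add`).

Multiplication by `0_g` is a linear isomorphism `S^t(1_{s(g)}) ≅ S^t(g)` with inverse the
multiplication by `0_{g⁻¹}`. Hence `S^t` has smooth sections too and its rank at `g` is
`k - rk (S ∩ TP)(s(g))`. The statements on `S^s` follow by passing to the opposite groupoid. The map
`Ts : S(g) → (S ∩ TP)(s(g))` has the kernel `S^s(g)` of rank `k - rk (S ∩ TP)(t(g))`, so that
`rk (S ∩ TP)(t(g)) ≤ rk (S ∩ TP)(s(g))`; the opposite groupoid gives the reverse inequality. So the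
rank of `S ∩ TP` is constant along orbits, `Ts` maps `S(g)` onto `(S ∩ TP)(s(g))`, and a level set
of the rank is clopen and invariant.

If `S ∩ TP` has constant rank, `S` and `S ∩ TP` are embedded submanifolds of `TG` and `TP`, with
slice charts obtained from local frames. Smoothness of the restricted structure maps can be tested
in `TG` and `TP`. The fibrewise surjectivity of `Ts` allows one to construct smooth local sections
of `Ts : S → S ∩ TP` through all points of `S` (`exists_local_section_tangent_source`), which makes
it a submersion.
-/

noncomputable section

open Set Filter Function

/-! ### Submersions: sliding between the fibres -/

section Slide

variable {E : Type*} [NormedAddCommGroup E] [NormedSpace ℝ E]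
  {E' : Type*} [NormedAddCommGroup E'] [NormedSpace ℝ E']
  {M : Type*} [TopologicalSpace M] [ChartedSpace E M]
  {N : Type*} [TopologicalSpace N] [ChartedSpace E' N]

/-- Near a point, a submersion `f` is a projection `(u, v) ↦ u`; replacing `u` gives a smooth way
`σ` of moving a point `y` into a prescribed fibre `f ⁻¹ {p}`, which does not move `y` if
`p = f y`. -/
theorem Manifold.IsSubmersionAt.exists_slide {f : M → N} {x : M}
    (h : Manifold.IsSubmersionAt 𝓘(ℝ, E) 𝓘(ℝ, E') ∞ f x) :
    ∃ (σ : M × N → M) (O : Set (M × N)), IsOpen O ∧ (x, f x) ∈ O ∧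
      ContMDiffOn (𝓘(ℝ, E).prod 𝓘(ℝ, E')) 𝓘(ℝ, E) ∞ σ O ∧
      (∀ q ∈ O, f (σ q) = q.2) ∧ ∀ y, (y, f y) ∈ O → σ (y, f y) = y := by
  set φ := h.domChart
  set ψ := h.codChart
  set e := h.equiv
  have hφ : φ ∈ IsManifold.maximalAtlas 𝓘(ℝ, E) ∞ M := h.domChart_mem_maximalAtlas
  have hψ : ψ ∈ IsManifold.maximalAtlas 𝓘(ℝ, E') ∞ N := h.codChart_mem_maximalAtlas
  have hw : ∀ z ∈ φ.target, ψ (f (φ.symm z)) = (e z).1 := by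
    intro z hz
    have hz' : z ∈ (φ.extend 𝓘(ℝ, E)).target := by simpa using hz
    have := h.writtenInCharts hz'
    simpa using this
  have hw' : ∀ y ∈ φ.source, ψ (f y) = (e (φ y)).1 := by
    intro y hy
    have := hw (φ y) (φ.map_source hy)
    rwa [φ.left_inv hy] at this
  have hsrc : ∀ y ∈ φ.source, f y ∈ ψ.source := fun y hy => h.source_subset_preimage_source hy
  let c : M × N → E := fun q => e.symm (ψ q.2, (e (φ q.1)).2)
  have hcs : ContMDiffOn (𝓘(ℝ, E).prod 𝓘(ℝ, E')) 𝓘(ℝ, E) ∞ c (φ.source ×ˢ ψ.source) := by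
    have h1 : ContMDiffOn (𝓘(ℝ, E).prod 𝓘(ℝ, E')) 𝓘(ℝ, E) ∞ (fun q : M × N => φ q.1)
        (φ.source ×ˢ ψ.source) :=
      (contMDiffOn_of_mem_maximalAtlas hφ).comp contMDiffOn_fst (fun q hq => hq.1)
    have h2 : ContMDiffOn (𝓘(ℝ, E).prod 𝓘(ℝ, E')) 𝓘(ℝ, E') ∞ (fun q : M × N => ψ q.2)
        (φ.source ×ˢ ψ.source) :=
      (contMDiffOn_of_mem_maximalAtlas hψ).comp contMDiffOn_snd (fun q hq => hq.2)
    have h3 : ContDiff ℝ ∞ (fun p : E' × E => e.symm (p.1, (e p.2).2)) := by fun_prop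
    exact h3.contMDiff.comp_contMDiffOn (h2.prodMk_space h1)
  have hopen : IsOpen (φ.source ×ˢ ψ.source) := φ.open_source.prod ψ.open_source
  have hself : ∀ y ∈ φ.source, c (y, f y) = φ y := by
    intro y hy
    simp only [c, hw' y hy]
    simp
  refine ⟨fun q => φ.symm (c q), (φ.source ×ˢ ψ.source) ∩ c ⁻¹' φ.target,
    hcs.continuousOn.isOpen_inter_preimage hopen φ.open_target, ?_, ?_, ?_, ?_⟩
  · have hx : x ∈ φ.source := h.mem_domChart_source
    refine ⟨⟨hx, hsrc x hx⟩, ?_⟩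
    change c (x, f x) ∈ φ.target
    rw [hself x hx]
    exact φ.map_source hx
  · exact (contMDiffOn_symm_of_mem_maximalAtlas hφ).comp (hcs.mono inter_subset_left)
      (fun q hq => hq.2)
  · rintro q ⟨hq, hq'⟩
    apply ψ.injOn (hsrc _ (φ.map_target hq')) hq.2
    rw [hw _ hq']
    simp [c]
  · rintro y ⟨hy, -⟩
    change φ.symm (c (y, f y)) = y
    rw [hself y hy.1, φ.left_inv hy.1]

end Slide

/-! ### Velocities of germs of curves -/

section Velocity

variable {E : Type*} [NormedAddCommGroup E] [NormedSpace ℝ E]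
  {H : Type*} [TopologicalSpace H] {I : ModelWithCorners ℝ E H}
  {E' : Type*} [NormedAddCommGroup E'] [NormedSpace ℝ E']
  {H' : Type*} [TopologicalSpace H'] {J : ModelWithCorners ℝ E' H'}
  {M : Type*} [TopologicalSpace M] [ChartedSpace H M]
  {N : Type*} [TopologicalSpace N] [ChartedSpace H' N]

/-- The tangent vector `v` is the velocity at time `0` of the curve `γ`, which need only be
differentiable at `0`. -/
structure HasVelocity (I : ModelWithCorners ℝ E H) (γ : ℝ → M) (v : TangentBundle I M) : Prop where
  mdifferentiableAt : MDifferentiableAt 𝓘(ℝ, ℝ) I γ 0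
  velocity_eq : tangentMap 𝓘(ℝ, ℝ) I γ ⟨0, (1 : ℝ)⟩ = v

namespace HasVelocity

variable {γ δ : ℝ → M} {v w : TangentBundle I M}

theorem apply_zero (h : HasVelocity I γ v) : γ 0 = v.proj := by
  rw [← h.velocity_eq]; rfl

theorem continuousAt (h : HasVelocity I γ v) : ContinuousAt γ 0 := h.mdifferentiableAt.continuousAt

theorem unique (h : HasVelocity I γ v) (h' : HasVelocity I γ w) : v = w := by
  rw [← h.velocity_eq, h'.velocity_eq]

theorem congr (h : HasVelocity I γ v) (e : δ =ᶠ[𝓝 0] γ) : HasVelocity I δ v := by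
  refine ⟨h.mdifferentiableAt.congr_of_eventuallyEq e, ?_⟩
  rw [← h.velocity_eq]
  simp only [tangentMap]
  rw [e.mfderiv_eq, e.eq_of_nhds]

theorem unique_of_eventuallyEq (h : HasVelocity I γ v) (h' : HasVelocity I δ w)
    (e : δ =ᶠ[𝓝 0] γ) : v = w :=
  (h.congr e).unique h'

theorem comp (h : HasVelocity I γ v) {f : M → N} (hf : MDifferentiableAt I J f v.proj) :
    HasVelocity J (f ∘ γ) (tangentMap I J f v) := by
  rw [← h.apply_zero] at hf
  refine ⟨hf.comp 0 h.mdifferentiableAt, ?_⟩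
  rw [← h.velocity_eq]
  exact tangentMap_comp_at _ hf h.mdifferentiableAt

/-- The derivative within a subset is determined by curves that stay in the subset, no matter
which of the possible derivatives is chosen by `mfderivWithin`. -/
theorem comp_within (h : HasVelocity I γ v) {f : M → N} {A : Set M}
    (hf : MDifferentiableWithinAt I J f A v.proj) (hA : ∀ᶠ τ in 𝓝 0, γ τ ∈ A) :
    HasVelocity J (f ∘ γ) (tangentMapWithin I J f A v) := by
  have h0 := h.apply_zero
  obtain ⟨hd, rfl⟩ := h
  have h1 : HasMFDerivWithinAt I J f A (γ 0) (mfderivWithin I J f A (γ 0)) := hf.hasMFDerivWithinAt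
  have h2 : HasMFDerivWithinAt 𝓘(ℝ, ℝ) I γ (γ ⁻¹' A) 0 (mfderiv 𝓘(ℝ, ℝ) I γ 0) :=
    hd.hasMFDerivAt.hasMFDerivWithinAt
  have h3 := (h1.comp 0 h2 subset_rfl).hasMFDerivAt hA
  refine ⟨h3.mdifferentiableAt, ?_⟩
  simp only [tangentMap, tangentMapWithin]
  rw [h3.mfderiv]
  rfl

theorem prodMk (h : HasVelocity I γ v) {δ : ℝ → N} {w : TangentBundle J N}
    (h' : HasVelocity J δ w) :
    HasVelocity (I.prod J) (fun τ => (γ τ, δ τ)) ⟨(v.proj, w.proj), (v.snd, w.snd)⟩ := by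
  obtain ⟨hd, rfl⟩ := h
  obtain ⟨hd', rfl⟩ := h'
  refine ⟨hd.prodMk hd', ?_⟩
  simp only [tangentMap]
  rw [MDifferentiableAt.mfderiv_prod hd hd']
  rfl

theorem const (x : M) : HasVelocity I (fun _ : ℝ => x) (⟨x, 0⟩ : TangentBundle I M) := by
  refine ⟨mdifferentiableAt_const, ?_⟩
  simp only [tangentMap]
  rw [mfderiv_const]
  rfl

end HasVelocity

end Velocity

section VelocityExists

variable {E : Type*} [NormedAddCommGroup E] [NormedSpace ℝ E]
  {E' : Type*} [NormedAddCommGroup E'] [NormedSpace ℝ E']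
  {M : Type*} [TopologicalSpace M] [ChartedSpace E M] [IsManifold 𝓘(ℝ, E) ∞ M]
  {N : Type*} [TopologicalSpace N] [ChartedSpace E' N]

theorem exists_hasVelocity (v : TangentBundle 𝓘(ℝ, E) M) :
    ∃ γ : ℝ → M, HasVelocity 𝓘(ℝ, E) γ v := by
  let φ := extChartAt 𝓘(ℝ, E) v.proj
  have hφ : MDifferentiableAt 𝓘(ℝ, E) 𝓘(ℝ, E) φ v.proj :=
    (contMDiffAt_extChartAt (I := 𝓘(ℝ, E)) (n := ∞)).mdifferentiableAt (by simp)
  have hs : MDifferentiableAt 𝓘(ℝ, E) 𝓘(ℝ, E) φ.symm (φ v.proj) :=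
    ((contMDiffOn_extChartAt_symm (I := 𝓘(ℝ, E)) (n := ∞) v.proj).contMDiffAt
      ((isOpen_extChartAt_target v.proj).mem_nhds
        (mem_extChartAt_target v.proj))).mdifferentiableAt (by simp)
  let ξ : E := (tangentMap 𝓘(ℝ, E) 𝓘(ℝ, E) φ v).snd
  let c : ℝ → E := fun τ => φ v.proj + τ • ξ
  have hc0 : c 0 = φ v.proj := by simp [c]
  have hc : HasFDerivAt c (ContinuousLinearMap.toSpanSingleton ℝ ξ) 0 := by
    have : HasDerivAt c ξ 0 := by
      simpa [c] using ((hasDerivAt_id (0 : ℝ)).smul_const ξ).const_add (φ v.proj)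
    exact this.hasFDerivAt
  have hcv : HasVelocity 𝓘(ℝ, E) c (tangentMap 𝓘(ℝ, E) 𝓘(ℝ, E) φ v) := by
    refine ⟨hc.differentiableAt.mdifferentiableAt, ?_⟩
    simp only [tangentMap]
    rw [hc.hasMFDerivAt.mfderiv, hc0]
    congr 1
    exact one_smul ℝ ξ
  refine ⟨φ.symm ∘ c, ?_⟩
  have h1 := hcv.comp (f := φ.symm) hs
  rw [← tangentMap_comp_at v hs hφ] at h1
  have hid : (φ.symm ∘ φ) =ᶠ[𝓝 v.proj] id :=
    (eventually_mem_nhds_iff.2 (extChartAt_source_mem_nhds (I := 𝓘(ℝ, E)) v.proj)).mono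
      fun y hy => φ.left_inv (mem_of_mem_nhds hy)
  have h2 : tangentMap 𝓘(ℝ, E) 𝓘(ℝ, E) (φ.symm ∘ φ) v = v := by
    simp only [tangentMap]
    rw [hid.mfderiv_eq, hid.eq_of_nhds, mfderiv_id]
    rfl
  rwa [h2] at h1

/-- A curve through `f x` in the base of a submersion `f` lifts to the total space, with prescribed
velocity over the given one. -/
theorem HasVelocity.exists_lift {f : M → N}
    (hf : Manifold.IsSubmersion 𝓘(ℝ, E) 𝓘(ℝ, E') ∞ f) (v : TangentBundle 𝓘(ℝ, E) M)
    {c : ℝ → N} (hc : HasVelocity 𝓘(ℝ, E') c (tangentMap 𝓘(ℝ, E) 𝓘(ℝ, E') f v)) :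
    ∃ γ : ℝ → M, HasVelocity 𝓘(ℝ, E) γ v ∧ f ∘ γ =ᶠ[𝓝 0] c := by
  obtain ⟨σ, O, hO, hxO, hσ, h1, h2⟩ := (hf.isSubmersionAt v.proj).exists_slide
  obtain ⟨γ, hγ⟩ := exists_hasVelocity v
  have hfd : MDifferentiableAt 𝓘(ℝ, E) 𝓘(ℝ, E') f v.proj :=
    hf.contMDiff.mdifferentiableAt (by simp)
  have hp := hγ.prodMk hc
  have hσd : MDifferentiableAt (𝓘(ℝ, E).prod 𝓘(ℝ, E')) 𝓘(ℝ, E) σ (v.proj, f v.proj) :=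
    (hσ.contMDiffAt (hO.mem_nhds hxO)).mdifferentiableAt (by simp)
  have hev : ∀ᶠ τ in 𝓝 (0 : ℝ), (γ τ, c τ) ∈ O := by
    have hcont : ContinuousAt (fun τ => (γ τ, c τ)) 0 := hp.continuousAt
    apply hcont
    apply hO.mem_nhds
    change (γ 0, c 0) ∈ O
    rw [hγ.apply_zero, hc.apply_zero]
    exact hxO
  refine ⟨fun τ => σ (γ τ, c τ), ?_, hev.mono fun τ hτ => h1 _ hτ⟩
  have hA := hp.comp (f := σ) hσd
  -- the velocity of `σ (γ, c)` only depends on the velocities of `γ` and `c`, so that `c` may be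
  -- replaced by `f ∘ γ`
  have hp' := hγ.prodMk (hγ.comp hfd)
  have hB := hp'.comp (f := σ) hσd
  have hev' : ∀ᶠ τ in 𝓝 (0 : ℝ), (γ τ, f (γ τ)) ∈ O := by
    have hcont : ContinuousAt (fun τ => (γ τ, (f ∘ γ) τ)) 0 := hp'.continuousAt
    apply hcont
    apply hO.mem_nhds
    change (γ 0, f (γ 0)) ∈ O
    rw [hγ.apply_zero]
    exact hxO
  have := hB.unique_of_eventuallyEq hγ (hev'.mono fun τ hτ => (h2 _ hτ).symm)
  rw [← this]
  exact hA

end VelocityExists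

/-! ### Families of subspaces and smooth sections along a map -/

section Sections

variable {E : Type*} [NormedAddCommGroup E] [NormedSpace ℝ E]
  {E' : Type*} [NormedAddCommGroup E'] [NormedSpace ℝ E']
  {H' : Type*} [TopologicalSpace H'] {J : ModelWithCorners ℝ E' H'}
  {M : Type*} [TopologicalSpace M] [ChartedSpace E M] [IsManifold 𝓘(ℝ, E) ∞ M]
  {B : Type*} [TopologicalSpace B] [ChartedSpace H' B]

instance TangentSpace.finiteDimensional [FiniteDimensional ℝ E] (x : M) :
    FiniteDimensional ℝ (TangentSpace 𝓘(ℝ, E) x) :=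
  inferInstanceAs (FiniteDimensional ℝ E)

/-- The vector field `X` along `f`, as a map into `TM`, is smooth at `b`. -/
def SmoothAlongAt (J : ModelWithCorners ℝ E' H') (f : B → M)
    (X : (b : B) → TangentSpace 𝓘(ℝ, E) (f b)) (b : B) : Prop :=
  ContMDiffAt J 𝓘(ℝ, E).tangent ∞ (fun b => (⟨f b, X b⟩ : TangentBundle 𝓘(ℝ, E) M)) b

variable {f : B → M} {X Y : (b : B) → TangentSpace 𝓘(ℝ, E) (f b)} {b₀ : B}

/-- The fibre coordinate of a tangent vector in the standard trivialization around `x`. -/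
def fiberCoord (x : M) (v : TangentBundle 𝓘(ℝ, E) M) : E :=
  (trivializationAt E (TangentSpace 𝓘(ℝ, E)) x v).2

theorem fiberCoord_isLinearMap {x y : M}
    (hy : y ∈ (trivializationAt E (TangentSpace 𝓘(ℝ, E)) x).baseSet) :
    IsLinearMap ℝ (fun v : TangentSpace 𝓘(ℝ, E) y => fiberCoord x ⟨y, v⟩) :=
  (trivializationAt E (TangentSpace 𝓘(ℝ, E)) x).linear ℝ hy

/-- Smoothness of a vector field along `f`, in terms of any standard trivialization. -/
theorem smoothAlongAt_iff {x : M}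
    (hx : f b₀ ∈ (trivializationAt E (TangentSpace 𝓘(ℝ, E)) x).baseSet) :
    SmoothAlongAt J f X b₀ ↔ ContMDiffAt J 𝓘(ℝ, E) ∞ f b₀ ∧
      ContMDiffAt J 𝓘(ℝ, E) ∞ (fun b => fiberCoord x ⟨f b, X b⟩) b₀ :=
  (trivializationAt E (TangentSpace 𝓘(ℝ, E)) x).contMDiffAt_iff
    (((trivializationAt E (TangentSpace 𝓘(ℝ, E)) x).mem_source).2 hx)

theorem SmoothAlongAt.contMDiffAt_base (h : SmoothAlongAt J f X b₀) :
    ContMDiffAt J 𝓘(ℝ, E) ∞ f b₀ :=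
  ((smoothAlongAt_iff (mem_baseSet_trivializationAt E (TangentSpace 𝓘(ℝ, E)) (f b₀))).1 h).1

theorem eventually_mem_baseSet {x : M} (hf : ContinuousAt f b₀)
    (hx : f b₀ ∈ (trivializationAt E (TangentSpace 𝓘(ℝ, E)) x).baseSet) :
    ∀ᶠ b in 𝓝 b₀, f b ∈ (trivializationAt E (TangentSpace 𝓘(ℝ, E)) x).baseSet :=
  hf ((trivializationAt E (TangentSpace 𝓘(ℝ, E)) x).open_baseSet.mem_nhds hx)

theorem SmoothAlongAt.add (hX : SmoothAlongAt J f X b₀) (hY : SmoothAlongAt J f Y b₀) :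
    SmoothAlongAt J f (fun b => X b + Y b) b₀ := by
  have hm := mem_baseSet_trivializationAt E (TangentSpace 𝓘(ℝ, E)) (f b₀)
  refine (smoothAlongAt_iff hm).2 ⟨hX.contMDiffAt_base, ?_⟩
  refine (((smoothAlongAt_iff hm).1 hX).2.add ((smoothAlongAt_iff hm).1 hY).2).congr_of_eventuallyEq
    ?_
  filter_upwards [eventually_mem_baseSet hX.contMDiffAt_base.continuousAt hm] with b hb
  exact (fiberCoord_isLinearMap hb).map_add _ _

theorem SmoothAlongAt.smul {c : B → ℝ} (hc : ContMDiffAt J 𝓘(ℝ, ℝ) ∞ c b₀)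
    (hX : SmoothAlongAt J f X b₀) : SmoothAlongAt J f (fun b => c b • X b) b₀ := by
  have hm := mem_baseSet_trivializationAt E (TangentSpace 𝓘(ℝ, E)) (f b₀)
  refine (smoothAlongAt_iff hm).2 ⟨hX.contMDiffAt_base, ?_⟩
  refine (hc.smul ((smoothAlongAt_iff hm).1 hX).2).congr_of_eventuallyEq ?_
  filter_upwards [eventually_mem_baseSet hX.contMDiffAt_base.continuousAt hm] with b hb
  exact (fiberCoord_isLinearMap hb).map_smul _ _

theorem SmoothAlongAt.sub (hX : SmoothAlongAt J f X b₀) (hY : SmoothAlongAt J f Y b₀) :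
    SmoothAlongAt J f (fun b => X b - Y b) b₀ := by
  have h := hX.add (hY.smul (c := fun _ => (-1 : ℝ)) contMDiffAt_const)
  have e : (fun b => X b - Y b) = fun b => X b + (-1 : ℝ) • Y b := by
    funext b
    module
  rw [e]
  exact h

theorem smoothAlongAt_zero (hf : ContMDiffAt J 𝓘(ℝ, E) ∞ f b₀) :
    SmoothAlongAt (E := E) J f (fun _ => 0) b₀ := by
  have hm := mem_baseSet_trivializationAt E (TangentSpace 𝓘(ℝ, E)) (f b₀)
  refine (smoothAlongAt_iff hm).2 ⟨hf, ?_⟩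
  refine (contMDiffAt_const (c := (0 : E))).congr_of_eventuallyEq ?_
  filter_upwards [eventually_mem_baseSet hf.continuousAt hm] with b hb
  exact (fiberCoord_isLinearMap hb).map_zero

theorem SmoothAlongAt.sum {ι : Type*} (s : Finset ι) {c : ι → B → ℝ}
    {X : ι → (b : B) → TangentSpace 𝓘(ℝ, E) (f b)} (hf : ContMDiffAt J 𝓘(ℝ, E) ∞ f b₀)
    (hc : ∀ i ∈ s, ContMDiffAt J 𝓘(ℝ, ℝ) ∞ (c i) b₀) (hX : ∀ i ∈ s, SmoothAlongAt J f (X i) b₀) :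
    SmoothAlongAt J f (fun b => ∑ i ∈ s, c i b • X i b) b₀ := by
  classical
  induction s using Finset.induction_on with
  | empty => simpa using smoothAlongAt_zero hf
  | insert i s hi ih =>
    have h := ((hX i (by simp)).smul (hc i (by simp))).add
      (ih (fun j hj => hc j (by simp [hj])) (fun j hj => hX j (by simp [hj])))
    simpa [Finset.sum_insert hi] using h

theorem fiberCoord_injective {x y : M}
    (hy : y ∈ (trivializationAt E (TangentSpace 𝓘(ℝ, E)) x).baseSet) :
    Injective (fun v : TangentSpace 𝓘(ℝ, E) y => fiberCoord x ⟨y, v⟩) := by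
  intro v w hvw
  set e := trivializationAt E (TangentSpace 𝓘(ℝ, E)) x
  have := e.injOn (e.mem_source.2 hy : (⟨y, v⟩ : TangentBundle 𝓘(ℝ, E) M) ∈ e.source)
    (e.mem_source.2 hy : (⟨y, w⟩ : TangentBundle 𝓘(ℝ, E) M) ∈ e.source)
    (Prod.ext ((e.coe_fst' hy).trans (e.coe_fst' hy).symm) hvw)
  simpa using this

theorem linearIndependent_fiberCoord_iff {x y : M} {ι : Type*}
    (hy : y ∈ (trivializationAt E (TangentSpace 𝓘(ℝ, E)) x).baseSet)
    (v : ι → TangentSpace 𝓘(ℝ, E) y) :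
    LinearIndependent ℝ (fun i => fiberCoord x ⟨y, v i⟩) ↔ LinearIndependent ℝ v :=
  ((fiberCoord_isLinearMap hy).mk' _).linearIndependent_iff_of_injOn
    (fiberCoord_injective hy).injOn

/-- Linear independence of finitely many continuous vector fields is an open condition. -/
theorem eventually_linearIndependent {ι : Type*} [Finite ι]
    {X : ι → (b : B) → TangentSpace 𝓘(ℝ, E) (f b)} (hf : ContMDiffAt J 𝓘(ℝ, E) ∞ f b₀)
    (hX : ∀ i, SmoothAlongAt J f (X i) b₀) (hli : LinearIndependent ℝ (fun i => X i b₀)) :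
    ∀ᶠ b in 𝓝 b₀, LinearIndependent ℝ (fun i => X i b) := by
  have hm := mem_baseSet_trivializationAt E (TangentSpace 𝓘(ℝ, E)) (f b₀)
  have hc : ContinuousAt (fun b (i : ι) => fiberCoord (f b₀) ⟨f b, X i b⟩) b₀ :=
    continuousAt_pi.2 fun i => ((smoothAlongAt_iff hm).1 (hX i)).2.continuousAt
  have hopen := isOpen_setOfPred_linearIndependent (𝕜 := ℝ) (ι := ι) (E := E)
  have h0 := (linearIndependent_fiberCoord_iff hm (fun i => X i b₀)).2 hli
  filter_upwards [hc (hopen.mem_nhds h0), eventually_mem_baseSet hf.continuousAt hm] with b hb hb'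
  exact (linearIndependent_fiberCoord_iff hb' (fun i => X i b)).1 hb

/-- Through every vector of the family `S` of subspaces along `f` there is a local smooth section of
`S`. -/
def HasSmoothSectionsAlong (J : ModelWithCorners ℝ E' H') (f : B → M)
    (S : (b : B) → Submodule ℝ (TangentSpace 𝓘(ℝ, E) (f b))) : Prop :=
  ∀ b₀ : B, ∀ v ∈ S b₀, ∃ X : (b : B) → TangentSpace 𝓘(ℝ, E) (f b), X b₀ = v ∧
    ∀ᶠ b in 𝓝 b₀, X b ∈ S b ∧ SmoothAlongAt J f X b

variable {S : (b : B) → Submodule ℝ (TangentSpace 𝓘(ℝ, E) (f b))}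

/-- A basis of `S b₀` extends to smooth sections of `S` which stay linearly independent. -/
theorem HasSmoothSectionsAlong.exists_sections [FiniteDimensional ℝ E]
    (hS : HasSmoothSectionsAlong J f S) (hf : ContMDiff J 𝓘(ℝ, E) ∞ f) (b₀ : B) :
    ∃ X : Fin (Module.finrank ℝ (S b₀)) → (b : B) → TangentSpace 𝓘(ℝ, E) (f b),
      ∀ᶠ b in 𝓝 b₀, (∀ i, X i b ∈ S b ∧ SmoothAlongAt J f (X i) b) ∧
        LinearIndependent ℝ (fun i => X i b) := by
  let bs := Module.finBasis ℝ (S b₀)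
  choose X hX0 hX using fun i => hS b₀ (bs i) (bs i).2
  refine ⟨X, ?_⟩
  have h0 : LinearIndependent ℝ (fun i => X i b₀) := by
    simp_rw [hX0]
    exact bs.linearIndependent.map' (S b₀).subtype (S b₀).ker_subtype
  have h1 : ∀ᶠ b in 𝓝 b₀, ∀ i, X i b ∈ S b ∧ SmoothAlongAt J f (X i) b := eventually_all.2 hX
  exact h1.and (eventually_linearIndependent (hf b₀) (fun i => (h1.self_of_nhds i).2) h0)

theorem HasSmoothSectionsAlong.eventually_finrank_le [FiniteDimensional ℝ E]
    (hS : HasSmoothSectionsAlong J f S) (hf : ContMDiff J 𝓘(ℝ, E) ∞ f) (b₀ : B) :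
    ∀ᶠ b in 𝓝 b₀, Module.finrank ℝ (S b₀) ≤ Module.finrank ℝ (S b) := by
  obtain ⟨X, hX⟩ := hS.exists_sections hf b₀
  filter_upwards [hX] with b hb
  have hli : LinearIndependent ℝ (fun i => (⟨X i b, (hb.1 i).1⟩ : S b)) :=
    LinearIndependent.of_comp (S b).subtype hb.2
  simpa using hli.fintype_card_le_finrank

/-- A family of subspaces with local smooth sections through each of its vectors is a subbundle as
soon as its rank is upper semicontinuous. -/
theorem HasSmoothSectionsAlong.isSmoothSubbundleAlong [FiniteDimensional ℝ E]
    (hS : HasSmoothSectionsAlong J f S) (hf : ContMDiff J 𝓘(ℝ, E) ∞ f)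
    (hr : ∀ b₀, ∀ᶠ b in 𝓝 b₀, Module.finrank ℝ (S b) ≤ Module.finrank ℝ (S b₀)) :
    IsSmoothSubbundleAlong 𝓘(ℝ, E) J f S := by
  intro b₀
  obtain ⟨X, hX⟩ := hS.exists_sections hf b₀
  obtain ⟨U, hU, hUo, hbU⟩ := eventually_nhds_iff.1 (hX.and (hr b₀))
  refine ⟨U, hUo, hbU, _, X, fun i b hb => (((hU b hb).1.1 i).2).contMDiffWithinAt, fun b hb => ?_⟩
  obtain ⟨⟨h1, h2⟩, h3⟩ := hU b hb
  refine ⟨h2, Submodule.eq_of_le_of_finrank_le ?_ ?_⟩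
  · rw [Submodule.span_le]
    rintro _ ⟨i, rfl⟩
    exact (h1 i).1
  · rw [finrank_span_eq_card h2]
    simpa using h3

theorem IsSmoothSubbundleAlong.hasSmoothSectionsAlong (hS : IsSmoothSubbundleAlong 𝓘(ℝ, E) J f S)
    (hf : ContMDiff J 𝓘(ℝ, E) ∞ f) : HasSmoothSectionsAlong J f S := by
  intro b₀ v hv
  obtain ⟨U, hUo, hbU, n, X, hX, hspan⟩ := hS b₀
  rw [← (hspan b₀ hbU).2, Submodule.mem_span_range_iff_exists_fun] at hv
  obtain ⟨c, rfl⟩ := hv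
  refine ⟨fun b => ∑ i, c i • X i b, rfl, ?_⟩
  filter_upwards [hUo.mem_nhds hbU] with b hb
  refine ⟨?_, ?_⟩
  · rw [← (hspan b hb).2]
    exact Submodule.sum_mem _ fun i _ => Submodule.smul_mem _ _ (Submodule.subset_span ⟨i, rfl⟩)
  · exact SmoothAlongAt.sum (c := fun i _ => c i) Finset.univ (hf b) (fun i _ => contMDiffAt_const)
      fun i _ => (hX i).contMDiffAt (hUo.mem_nhds hb)

/-- Two complementary families of subspaces with smooth local sections: the ranks are lower
semicontinuous and have a constant sum, so that they are locally constant. -/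
theorem HasSmoothSectionsAlong.isSmoothSubbundleAlong_of_finrank_add [FiniteDimensional ℝ E]
    {T : (b : B) → Submodule ℝ (TangentSpace 𝓘(ℝ, E) (f b))}
    (hS : HasSmoothSectionsAlong J f S) (hT : HasSmoothSectionsAlong J f T)
    (hf : ContMDiff J 𝓘(ℝ, E) ∞ f) {k : ℕ}
    (hk : ∀ b, Module.finrank ℝ (S b) + Module.finrank ℝ (T b) = k) :
    IsSmoothSubbundleAlong 𝓘(ℝ, E) J f S := by
  refine hS.isSmoothSubbundleAlong hf fun b₀ => ?_
  filter_upwards [hT.eventually_finrank_le hf b₀] with b hb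
  have h1 := hk b
  have h2 := hk b₀
  omega

theorem IsSmoothSubbundleAlong.eventually_finrank_eq (hS : IsSmoothSubbundleAlong 𝓘(ℝ, E) J f S)
    (b₀ : B) : ∀ᶠ b in 𝓝 b₀, Module.finrank ℝ (S b) = Module.finrank ℝ (S b₀) := by
  obtain ⟨U, hUo, hbU, n, X, hX, hspan⟩ := hS b₀
  have : ∀ b ∈ U, Module.finrank ℝ (S b) = n := fun b hb => by
    rw [← (hspan b hb).2, finrank_span_eq_card (hspan b hb).1, Fintype.card_fin]
  filter_upwards [hUo.mem_nhds hbU] with b hb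
  rw [this b hb, this b₀ hbU]

end Sections

/-! ### Trivializations adapted to a frame -/

section Adapted

variable {E : Type*} [NormedAddCommGroup E] [NormedSpace ℝ E] [FiniteDimensional ℝ E]
  {M : Type*} [TopologicalSpace M] [ChartedSpace E M] [IsManifold 𝓘(ℝ, E) ∞ M]

omit [IsManifold 𝓘(ℝ, E) ∞ M] in
/-- Linearly independent vectors of `E` that depend smoothly on a point of `M` become constant
after a smooth change of the basis of `E`. -/
theorem exists_contMDiffOn_straightening {n : ℕ} {Z : Fin n → M → E} {V : Set M} (hV : IsOpen V)
    (hZ : ∀ i, ContMDiffOn 𝓘(ℝ, E) 𝓘(ℝ, E) ∞ (Z i) V) {x₀ : M} (hx₀ : x₀ ∈ V)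
    (hli : LinearIndependent ℝ (fun i => Z i x₀)) :
    ∃ (U : Set M) (A C : M → E →L[ℝ] E), IsOpen U ∧ x₀ ∈ U ∧ U ⊆ V ∧
      ContMDiffOn 𝓘(ℝ, E) 𝓘(ℝ, E →L[ℝ] E) ∞ A U ∧ ContMDiffOn 𝓘(ℝ, E) 𝓘(ℝ, E →L[ℝ] E) ∞ C U ∧
      ∀ x ∈ U, (∀ w, C x (A x w) = w) ∧ (∀ w, A x (C x w) = w) ∧ ∀ i, C x (Z i x) = Z i x₀ := by
  have : CompleteSpace E := FiniteDimensional.complete ℝ E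
  -- `L i` is a family of functionals dual to the vectors `Z i x₀`
  obtain ⟨L', hL'⟩ :=
    (Fintype.linearCombination ℝ (fun i => Z i x₀)).exists_leftInverse_of_injective
      (LinearMap.ker_eq_bot.2 (linearIndependent_iff_injective_fintypeLinearCombination.1 hli))
  let L : Fin n → E →L[ℝ] ℝ := fun i => (LinearMap.proj i ∘ₗ L').toContinuousLinearMap
  have hL : ∀ i j, L i (Z j x₀) = if i = j then 1 else 0 := by
    intro i j
    have := LinearMap.congr_fun hL' (Pi.single j 1)
    simp only [LinearMap.comp_apply, Fintype.linearCombination_apply_single, one_smul,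
      LinearMap.id_apply] at this
    simp [L, this, Pi.single_apply]
  let A : M → E →L[ℝ] E := fun x =>
    ContinuousLinearMap.id ℝ E + ∑ i, (L i).smulRight (Z i x - Z i x₀)
  have hAZ : ∀ x i, A x (Z i x₀) = Z i x := by
    intro x i
    simp [A, hL]
  have hA : ContMDiffOn 𝓘(ℝ, E) 𝓘(ℝ, E →L[ℝ] E) ∞ A V := by
    have h1 : ContDiff ℝ ∞ (fun z : Fin n → E =>
        ContinuousLinearMap.id ℝ E + ∑ i, (L i).smulRight (z i - Z i x₀)) := by
      refine contDiff_const.add (ContDiff.sum fun i _ => ?_)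
      exact (ContinuousLinearMap.smulRightL ℝ E E (L i)).contDiff.comp
        ((contDiff_apply ℝ E i).sub contDiff_const)
    exact h1.contMDiff.comp_contMDiffOn (contMDiffOn_pi_space.2 hZ)
  have hA0 : A x₀ = ((ContinuousLinearEquiv.refl ℝ E : E ≃L[ℝ] E) : E →L[ℝ] E) := by
    ext w
    simp [A]
  let R : Set (E →L[ℝ] E) := range ((↑) : (E ≃L[ℝ] E) → E →L[ℝ] E)
  have hR : IsOpen R := ContinuousLinearEquiv.isOpen
  refine ⟨V ∩ A ⁻¹' R, A, fun x => (A x).inverse, hA.continuousOn.isOpen_inter_preimage hV hR,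
    ⟨hx₀, ⟨_, hA0.symm⟩⟩, inter_subset_left, hA.mono inter_subset_left, ?_, ?_⟩
  · rintro x ⟨hx, ⟨e, he⟩⟩
    have h1 : ContDiffAt ℝ ∞ ContinuousLinearMap.inverse (A x) := he ▸ contDiffAt_map_inverse e
    exact h1.contMDiffAt.comp_contMDiffWithinAt x ((hA x hx).mono inter_subset_left)
  · rintro x ⟨hx, ⟨e, he⟩⟩
    have hinv : (A x).inverse = (e.symm : E →L[ℝ] E) := by
      rw [← he, ContinuousLinearMap.inverse_equiv]
    refine ⟨fun w => ?_, fun w => ?_, fun i => ?_⟩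
    · simp [← he]
    · simp [← he]
    · change (A x).inverse _ = _
      rw [← hAZ x i, hinv, ← he]
      simp

/-- A local frame of a subbundle of `TM` around `x₀` consists of constant vectors in a suitable
local trivialization of `TM`, which is given here as a fibrewise linear diffeomorphism `Ψ` onto
`U × E`. -/
theorem exists_adapted_trivialization {n : ℕ} {X : Fin n → (x : M) → TangentSpace 𝓘(ℝ, E) x}
    {x₀ : M} (hX : ∀ i, ∀ᶠ x in 𝓝 x₀, SmoothAlongAt 𝓘(ℝ, E) (id : M → M) (X i) x)
    (hli : LinearIndependent ℝ (fun i => X i x₀)) :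
    ∃ (U : Set M) (Ψ : OpenPartialHomeomorph (TangentBundle 𝓘(ℝ, E) M) (M × E)) (z : Fin n → E),
      IsOpen U ∧ x₀ ∈ U ∧ Ψ.source = {v | v.proj ∈ U} ∧ Ψ.target = U ×ˢ univ ∧
      ContMDiffOn 𝓘(ℝ, E).tangent (𝓘(ℝ, E).prod 𝓘(ℝ, E)) ∞ Ψ Ψ.source ∧
      ContMDiffOn (𝓘(ℝ, E).prod 𝓘(ℝ, E)) 𝓘(ℝ, E).tangent ∞ Ψ.symm Ψ.target ∧
      (∀ v ∈ Ψ.source, (Ψ v).1 = v.proj) ∧ LinearIndependent ℝ z ∧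
      ∀ x ∈ U, (IsLinearMap ℝ (fun v : TangentSpace 𝓘(ℝ, E) x => (Ψ ⟨x, v⟩).2)) ∧
        ∀ i, (Ψ ⟨x, X i x⟩).2 = z i := by
  set e := trivializationAt E (TangentSpace 𝓘(ℝ, E)) x₀ with he
  have hx₀ : x₀ ∈ e.baseSet := mem_baseSet_trivializationAt E (TangentSpace 𝓘(ℝ, E)) x₀
  obtain ⟨V, hVX, hV, hxV⟩ := eventually_nhds_iff.1
    ((eventually_all.2 hX).and (e.open_baseSet.mem_nhds hx₀))
  have hZ : ∀ i, ContMDiffOn 𝓘(ℝ, E) 𝓘(ℝ, E) ∞ (fun x => fiberCoord x₀ ⟨x, X i x⟩) V := by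
    intro i x hx
    have h1 := (hVX x hx).1 i
    exact ((smoothAlongAt_iff (f := (id : M → M)) (hVX x hx).2).1 h1).2.contMDiffWithinAt
  obtain ⟨U, A, C, hU, hxU, hUV, hA, hC, hAC⟩ := exists_contMDiffOn_straightening hV hZ hxV
    ((linearIndependent_fiberCoord_iff hx₀ _).2 hli)
  have hUb : U ⊆ e.baseSet := fun x hx => (hVX x (hUV hx)).2
  -- the change of basis `C`, as a diffeomorphism of `U × E`
  let T : OpenPartialHomeomorph (M × E) (M × E) :=
    { toFun := fun q => (q.1, C q.1 q.2)
      invFun := fun q => (q.1, A q.1 q.2)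
      source := U ×ˢ univ
      target := U ×ˢ univ
      map_source' := fun q hq => ⟨hq.1, trivial⟩
      map_target' := fun q hq => ⟨hq.1, trivial⟩
      left_inv' := fun q hq => Prod.ext rfl ((hAC q.1 hq.1).2.1 q.2)
      right_inv' := fun q hq => Prod.ext rfl ((hAC q.1 hq.1).1 q.2)
      open_source := hU.prod isOpen_univ
      open_target := hU.prod isOpen_univ
      continuousOn_toFun := continuousOn_fst.prodMk
        ((hC.continuousOn.comp continuousOn_fst fun q hq => hq.1).clm_apply continuousOn_snd)
      continuousOn_invFun := continuousOn_fst.prodMk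
        ((hA.continuousOn.comp continuousOn_fst fun q hq => hq.1).clm_apply continuousOn_snd) }
  have hTs : ContMDiffOn (𝓘(ℝ, E).prod 𝓘(ℝ, E)) (𝓘(ℝ, E).prod 𝓘(ℝ, E)) ∞ T (U ×ˢ univ) :=
    contMDiffOn_fst.prodMk ((hC.comp contMDiffOn_fst fun q hq => hq.1).clm_apply contMDiffOn_snd)
  have hTs' : ContMDiffOn (𝓘(ℝ, E).prod 𝓘(ℝ, E)) (𝓘(ℝ, E).prod 𝓘(ℝ, E)) ∞ T.symm (U ×ˢ univ) :=
    contMDiffOn_fst.prodMk ((hA.comp contMDiffOn_fst fun q hq => hq.1).clm_apply contMDiffOn_snd)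
  let Ψ := e.toOpenPartialHomeomorph.trans T
  have hsrc : Ψ.source = {v | v.proj ∈ U} := by
    ext v
    simp only [Ψ, OpenPartialHomeomorph.trans_source, mem_inter_iff, mem_preimage, mem_ofPred_eq]
    constructor
    · rintro ⟨h1, h2⟩
      have h3 : (e v).1 ∈ U := h2.1
      rwa [e.coe_fst h1] at h3
    · intro h
      have h1 : v ∈ e.source := e.mem_source.2 (hUb h)
      refine ⟨h1, ⟨?_, trivial⟩⟩
      change (e v).1 ∈ U
      rwa [e.coe_fst h1]
  have htgt : Ψ.target = U ×ˢ univ := by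
    ext q
    simp only [Ψ, OpenPartialHomeomorph.trans_target, mem_inter_iff, mem_preimage]
    constructor
    · exact fun h => h.1
    · intro h
      refine ⟨h, ?_⟩
      rw [e.target_eq]
      exact ⟨hUb h.1, trivial⟩
  refine ⟨U, Ψ, fun i => fiberCoord x₀ ⟨x₀, X i x₀⟩, hU, hxU, hsrc, htgt, ?_, ?_, ?_, ?_, ?_⟩
  · exact hTs.comp (e.contMDiffOn.mono inter_subset_left) fun v hv => hv.2
  · exact e.contMDiffOn_symm.comp (hTs'.mono (by rw [htgt])) fun q hq => hq.2
  · intro v hv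
    exact e.coe_fst hv.1
  · exact (linearIndependent_fiberCoord_iff hx₀ _).2 hli
  · intro x hx
    have hb := hUb hx
    have hval : ∀ v : TangentSpace 𝓘(ℝ, E) x, (Ψ ⟨x, v⟩).2 = C x (fiberCoord x₀ ⟨x, v⟩) := by
      intro v
      have h1 : (e ⟨x, v⟩).1 = x := e.coe_fst' hb
      change C (e ⟨x, v⟩).1 (e ⟨x, v⟩).2 = _
      rw [h1]
      rfl
    refine ⟨?_, fun i => ?_⟩
    · have hl := fiberCoord_isLinearMap (E := E) hb
      constructor
      · intro v w
        rw [hval, hval, hval, hl.map_add, map_add]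
      · intro c v
        rw [hval, hval, hl.map_smul, map_smul]
    · rw [hval]
      exact (hAC x hx).2.2 i

end Adapted

/-! ### Embedded submanifolds given by slice charts -/

section Slice

variable {E₁ : Type*} [NormedAddCommGroup E₁] [NormedSpace ℝ E₁]
  {F : Type*} [NormedAddCommGroup F] [NormedSpace ℝ F]
  {E : Type*} [NormedAddCommGroup E] [NormedSpace ℝ E]
  {H : Type*} [TopologicalSpace H] {I : ModelWithCorners ℝ E H}
  {M : Type*} [TopologicalSpace M] [ChartedSpace H M]

open Classical in
/-- The chart of the subset `N` obtained from a chart `Φ` of the ambient manifold in which `N`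
becomes the slice `E₁ × {0}` of `E₁ × F`. -/
def sliceChart (N : Set M) (Φ : OpenPartialHomeomorph M (E₁ × F))
    (hN : ∀ y ∈ Φ.source, y ∈ N ↔ (Φ y).2 = 0) (x : N) : OpenPartialHomeomorph N E₁ where
  toFun y := (Φ y).1
  -- outside of the target, the inverse has the junk value `x`
  invFun u := if h : Φ.symm (u, 0) ∈ N then ⟨Φ.symm (u, 0), h⟩ else x
  source := {y | (y : M) ∈ Φ.source}
  target := {u | (u, (0 : F)) ∈ Φ.target}
  map_source' y hy := by
    have h1 : (Φ y).2 = 0 := (hN y hy).1 y.2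
    have h2 := Φ.map_source hy
    change ((Φ y).1, (0 : F)) ∈ Φ.target
    rwa [← h1]
  map_target' u hu := by
    have h1 : Φ.symm (u, 0) ∈ Φ.source := Φ.map_target hu
    have h2 : Φ.symm (u, 0) ∈ N := (hN _ h1).2 (by rw [Φ.right_inv hu])
    simp only [h2, dite_true]
    exact h1
  left_inv' y hy := by
    have h1 : (Φ y).2 = 0 := (hN y hy).1 y.2
    have h2 : Φ.symm ((Φ y).1, 0) = y := by
      rw [← h1]
      exact Φ.left_inv hy
    simp [h2]
  right_inv' u hu := by
    have h1 : Φ.symm (u, 0) ∈ Φ.source := Φ.map_target hu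
    have h2 : Φ.symm (u, 0) ∈ N := (hN _ h1).2 (by rw [Φ.right_inv hu])
    simp only [h2, dite_true]
    rw [Φ.right_inv hu]
  open_source := Φ.open_source.preimage continuous_subtype_val
  open_target := Φ.open_target.preimage (by fun_prop)
  continuousOn_toFun := continuous_fst.comp_continuousOn
    (Φ.continuousOn.comp continuous_subtype_val.continuousOn fun y hy => hy)
  continuousOn_invFun := by
    rw [Topology.IsInducing.subtypeVal.continuousOn_iff]
    have h : ContinuousOn (fun u : E₁ => Φ.symm (u, (0 : F))) {u | (u, (0 : F)) ∈ Φ.target} :=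
      Φ.continuousOn_symm.comp (by fun_prop) fun u hu => hu
    refine h.congr fun u hu => ?_
    have h1 : Φ.symm (u, 0) ∈ Φ.source := Φ.map_target hu
    have h2 : Φ.symm (u, 0) ∈ N := (hN _ h1).2 (by rw [Φ.right_inv hu])
    simp [h2]

omit [NormedSpace ℝ E₁] [NormedSpace ℝ F] in
open Classical in
theorem sliceChart_symm_coe {N : Set M} {Φ : OpenPartialHomeomorph M (E₁ × F)}
    {hN : ∀ y ∈ Φ.source, y ∈ N ↔ (Φ y).2 = 0} {x : N} {u : E₁} (hu : (u, (0 : F)) ∈ Φ.target) :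
    (((sliceChart N Φ hN x).symm u : N) : M) = Φ.symm (u, 0) := by
  have h1 : Φ.symm (u, 0) ∈ Φ.source := Φ.map_target hu
  have h2 : Φ.symm (u, 0) ∈ N := (hN _ h1).2 (by rw [Φ.right_inv hu])
  change ((if h : Φ.symm (u, 0) ∈ N then (⟨Φ.symm (u, 0), h⟩ : N) else x : N) : M) = _
  simp [h2]

/-- A subset that is a slice in suitable charts around each of its points is an embedded
submanifold. -/
theorem exists_chartedSpace_of_slices [IsManifold I ∞ M] [I.Boundaryless]
    (L : (E₁ × F) ≃L[ℝ] E) (N : Set M)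
    (hN : ∀ x ∈ N, ∃ Φ : OpenPartialHomeomorph M (E₁ × F), x ∈ Φ.source ∧
      ContMDiffOn I 𝓘(ℝ, E₁ × F) ∞ Φ Φ.source ∧ ContMDiffOn 𝓘(ℝ, E₁ × F) I ∞ Φ.symm Φ.target ∧
      ∀ y ∈ Φ.source, y ∈ N ↔ (Φ y).2 = 0) :
    ∃ _ : ChartedSpace E₁ N, IsManifold 𝓘(ℝ, E₁) ∞ N ∧
      Manifold.IsSmoothEmbedding 𝓘(ℝ, E₁) I ∞ (Subtype.val : N → M) := by
  choose Φ hx hΦ hΦ' hs using fun x : N => hN x x.2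
  let cs : ChartedSpace E₁ N :=
    { atlas := range fun x => sliceChart N (Φ x) (hs x) x
      chartAt := fun x => sliceChart N (Φ x) (hs x) x
      mem_chart_source := hx
      chart_mem_atlas := fun x => ⟨x, rfl⟩ }
  have hinc : ContMDiff 𝓘(ℝ, E₁) 𝓘(ℝ, E₁ × F) ∞ (fun u : E₁ => (u, (0 : F))) := by
    have : ContDiff ℝ ∞ (fun u : E₁ => (u, (0 : F))) := by fun_prop
    exact this.contMDiff
  have hman : IsManifold 𝓘(ℝ, E₁) ∞ N := by
    refine isManifold_of_contDiffOn _ _ _ ?_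
    rintro _ _ ⟨x, rfl⟩ ⟨y, rfl⟩
    rw [← contMDiffOn_iff_contDiffOn]
    have h1 : ContMDiffOn 𝓘(ℝ, E₁) 𝓘(ℝ, E₁) ∞ (fun u => (Φ y ((Φ x).symm (u, 0))).1)
        {u : E₁ | (u, (0 : F)) ∈ (Φ x).target ∧ (Φ x).symm (u, 0) ∈ (Φ y).source} := by
      have h2 : ContMDiffOn 𝓘(ℝ, E₁) I ∞ (fun u => (Φ x).symm (u, 0))
          {u : E₁ | (u, (0 : F)) ∈ (Φ x).target ∧ (Φ x).symm (u, 0) ∈ (Φ y).source} :=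
        (hΦ' x).comp hinc.contMDiffOn fun u hu => hu.1
      have h3 := (hΦ y).comp h2 fun u hu => hu.2
      have h4 : ContDiff ℝ ∞ (fun q : E₁ × F => q.1) := contDiff_fst
      exact h4.contMDiff.comp_contMDiffOn h3
    have key : ∀ u ∈ (𝓘(ℝ, E₁).symm ⁻¹' ((sliceChart N (Φ x) (hs x) x).symm.trans
        (sliceChart N (Φ y) (hs y) y)).source ∩ range 𝓘(ℝ, E₁)),
        (u, (0 : F)) ∈ (Φ x).target ∧ (Φ x).symm (u, 0) ∈ (Φ y).source := by
      rintro u ⟨⟨hu, hu'⟩, -⟩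
      refine ⟨hu, ?_⟩
      have h5 : (((sliceChart N (Φ x) (hs x) x).symm u : N) : M) ∈ (Φ y).source := hu'
      have hu₁ : (u, (0 : F)) ∈ (Φ x).target := hu
      rwa [sliceChart_symm_coe hu₁] at h5
    refine (h1.mono key).congr fun u hu => ?_
    change (Φ y (((sliceChart N (Φ x) (hs x) x).symm u : N) : M)).1 = _
    rw [sliceChart_symm_coe (key u hu).1]
  refine ⟨cs, hman, ⟨?_, Topology.IsEmbedding.subtypeVal⟩⟩
  refine Manifold.IsImmersionOfComplement.isImmersion (F := F) fun x => ?_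
  let ψ : OpenPartialHomeomorph M H := ((Φ x).transHomeomorph L.toHomeomorph).transHomeomorph
    I.toHomeomorph.symm
  have hψ : ∀ y, ψ y = I.symm (L (Φ x y)) := fun y => rfl
  have hψ' : ∀ z, ψ.symm z = (Φ x).symm (L.symm (I z)) := fun y => rfl
  have hψs : ψ.source = (Φ x).source := rfl
  have hLs : ContMDiff 𝓘(ℝ, E₁ × F) 𝓘(ℝ, E) ∞ L := L.contDiff.contMDiff
  have hLs' : ContMDiff 𝓘(ℝ, E) 𝓘(ℝ, E₁ × F) ∞ L.symm := L.symm.contDiff.contMDiff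
  have hIs : ContMDiff 𝓘(ℝ, E) I ∞ I.symm := by
    rw [← contMDiffOn_univ, ← I.range_eq_univ]
    exact I.contMDiffOn_symm
  have hψm : ψ ∈ IsManifold.maximalAtlas I ∞ M := by
    apply OpenPartialHomeomorph.mem_maximalAtlas_of_contMDiffOn
    · exact hIs.comp_contMDiffOn (hLs.comp_contMDiffOn (hΦ x))
    · exact (hΦ' x).comp (hLs'.comp I.contMDiff).contMDiffOn fun z hz => hz
  refine Manifold.IsImmersionAtOfComplement.mk_of_charts L (chartAt E₁ x) ψ
    (mem_chart_source E₁ x) (hx x) (IsManifold.chart_mem_maximalAtlas x) hψm (fun y hy => hy) ?_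
  intro u hu
  have hu' : (u, (0 : F)) ∈ (Φ x).target := by
    have : u ∈ (chartAt E₁ x).target := by simpa using hu
    exact this
  have h6 : ((((chartAt E₁ x).symm u : N)) : M) = (Φ x).symm (u, 0) := sliceChart_symm_coe hu'
  simp only [Function.comp_apply, OpenPartialHomeomorph.extend_coe,
    OpenPartialHomeomorph.extend_coe_symm, modelWithCornersSelf_coe_symm, id, hψ]
  rw [h6, (Φ x).right_inv hu', I.right_inv (by simp [I.range_eq_univ])]

/-- A map into the source of a smooth embedding is smooth if its composition with the embedding
is: an immersion has a smooth left inverse locally. -/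
theorem Manifold.IsSmoothEmbedding.contMDiffWithinAt_of_comp {N : Type*} [TopologicalSpace N]
    [ChartedSpace E₁ N] {ι : N → M}
    (hι : Manifold.IsSmoothEmbedding 𝓘(ℝ, E₁) I ∞ ι)
    {E' : Type*} [NormedAddCommGroup E'] [NormedSpace ℝ E']
    {H' : Type*} [TopologicalSpace H'] {K : ModelWithCorners ℝ E' H'}
    {Q : Type*} [TopologicalSpace Q] [ChartedSpace H' Q] {f : Q → N} {s : Set Q} {q : Q}
    (hf : ContMDiffWithinAt K I ∞ (ι ∘ f) s q) : ContMDiffWithinAt K 𝓘(ℝ, E₁) ∞ f s q := by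
  have hc : ContinuousWithinAt f s q :=
    hι.isEmbedding.isInducing.continuousWithinAt_iff.2 hf.continuousWithinAt
  have h := hι.isImmersion.isImmersionAt (f q)
  let p : E → E₁ := fun z => (h.equiv.symm z).1
  let c : M → E₁ := fun y => p (h.codChart.extend I y)
  have hcι : ∀ x ∈ h.domChart.source, c (ι x) = h.domChart x := by
    intro x hx
    have hx' : h.domChart x ∈ (h.domChart.extend 𝓘(ℝ, E₁)).target := by
      simpa using h.domChart.map_source hx
    have h1 := h.writtenInCharts hx'
    simp only [Function.comp_apply, OpenPartialHomeomorph.extend_coe_symm,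
      modelWithCornersSelf_coe_symm, id, h.domChart.left_inv hx] at h1
    simp only [c, p, h1]
    simp
  have hp : ContDiff ℝ ∞ p := by fun_prop
  have hcs : ContMDiffAt I 𝓘(ℝ, E₁) ∞ c (ι (f q)) := by
    have h2 := (OpenPartialHomeomorph.contMDiffOn_extend h.codChart_mem_maximalAtlas).contMDiffAt
      (h.codChart.open_source.mem_nhds h.mem_codChart_source)
    exact hp.contMDiff.contMDiffAt.comp _ h2
  have hds : ContMDiffAt 𝓘(ℝ, E₁) 𝓘(ℝ, E₁) ∞ h.domChart.symm (c (ι (f q))) := by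
    rw [hcι _ h.mem_domChart_source]
    exact contMDiffAt_symm_of_mem_maximalAtlas h.domChart_mem_maximalAtlas
      (h.domChart.map_source h.mem_domChart_source)
  have h3 : ContMDiffWithinAt K 𝓘(ℝ, E₁) ∞ (h.domChart.symm ∘ (c ∘ (ι ∘ f))) s q :=
    hds.comp_contMDiffWithinAt q (hcs.comp_contMDiffWithinAt q hf)
  have hev : ∀ᶠ y in 𝓝[s] q, f y ∈ h.domChart.source :=
    hc (h.domChart.open_source.mem_nhds h.mem_domChart_source)
  refine h3.congr_of_eventuallyEq (hev.mono fun y hy => ?_) ?_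
  · simp only [Function.comp_apply, hcι _ hy, h.domChart.left_inv hy]
  · simp only [Function.comp_apply, hcι _ h.mem_domChart_source,
      h.domChart.left_inv h.mem_domChart_source]

theorem Manifold.IsSmoothEmbedding.contMDiff_of_comp {N : Type*} [TopologicalSpace N]
    [ChartedSpace E₁ N] {ι : N → M} (hι : Manifold.IsSmoothEmbedding 𝓘(ℝ, E₁) I ∞ ι)
    {E' : Type*} [NormedAddCommGroup E'] [NormedSpace ℝ E']
    {H' : Type*} [TopologicalSpace H'] {K : ModelWithCorners ℝ E' H'}
    {Q : Type*} [TopologicalSpace Q] [ChartedSpace H' Q] {f : Q → N}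
    (hf : ContMDiff K I ∞ (ι ∘ f)) : ContMDiff K 𝓘(ℝ, E₁) ∞ f := fun q =>
  contMDiffWithinAt_univ.1 (hι.contMDiffWithinAt_of_comp (contMDiffWithinAt_univ.2 (hf q)))

end Slice

/-! ### The total space of a subbundle of the tangent bundle -/

section Total

variable {E : Type*} [NormedAddCommGroup E] [NormedSpace ℝ E] [FiniteDimensional ℝ E]
  {M : Type*} [TopologicalSpace M] [ChartedSpace E M] [IsManifold 𝓘(ℝ, E) ∞ M]

/-- A linear coordinate change that makes the span of `r` independent vectors the first summand of
`ℝ ^ r × ℝ ^ (dim E - r)`. -/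
theorem exists_equiv_span_iff_snd_eq_zero {r : ℕ} {z : Fin r → E} (hz : LinearIndependent ℝ z) :
    ∃ κ : E ≃L[ℝ] (EuclideanSpace ℝ (Fin r) × EuclideanSpace ℝ (Fin (Module.finrank ℝ E - r))),
      ∀ w, w ∈ Submodule.span ℝ (range z) ↔ (κ w).2 = 0 := by
  obtain ⟨q, hq⟩ := (Submodule.span ℝ (range z)).exists_isCompl
  have h1 : Module.finrank ℝ (Submodule.span ℝ (range z)) = r := by
    simpa using finrank_span_eq_card hz
  have h2 : Module.finrank ℝ q = Module.finrank ℝ E - r := by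
    have := Submodule.finrank_add_eq_of_isCompl hq
    omega
  let a : Submodule.span ℝ (range z) ≃ₗ[ℝ] EuclideanSpace ℝ (Fin r) :=
    LinearEquiv.ofFinrankEq _ _ (by simpa using h1)
  let b : q ≃ₗ[ℝ] EuclideanSpace ℝ (Fin (Module.finrank ℝ E - r)) :=
    LinearEquiv.ofFinrankEq _ _ (by simpa using h2)
  refine ⟨((Submodule.prodEquivOfIsCompl _ _ hq).symm.trans
    (a.prodCongr b)).toContinuousLinearEquiv, fun w => ?_⟩
  change _ ↔ b ((Submodule.prodEquivOfIsCompl _ _ hq).symm w).2 = 0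
  rw [b.map_eq_zero_iff, Submodule.prodEquivOfIsCompl_symm_apply_snd_eq_zero]

/-- Slice charts for the total space of a subbundle of `TM`. -/
theorem IsSmoothSubbundle.exists_slice {S : TangentDistribution 𝓘(ℝ, E) M}
    (hS : IsSmoothSubbundle 𝓘(ℝ, E) S) {r : ℕ} (hr : ∀ x, Module.finrank ℝ (S x) = r)
    (v : TangentBundle 𝓘(ℝ, E) M) :
    ∃ Φ : OpenPartialHomeomorph (TangentBundle 𝓘(ℝ, E) M) ((E × EuclideanSpace ℝ (Fin r)) ×
        EuclideanSpace ℝ (Fin (Module.finrank ℝ E - r))), v ∈ Φ.source ∧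
      ContMDiffOn 𝓘(ℝ, E).tangent 𝓘(ℝ, (E × EuclideanSpace ℝ (Fin r)) ×
        EuclideanSpace ℝ (Fin (Module.finrank ℝ E - r))) ∞ Φ Φ.source ∧
      ContMDiffOn 𝓘(ℝ, (E × EuclideanSpace ℝ (Fin r)) ×
        EuclideanSpace ℝ (Fin (Module.finrank ℝ E - r))) 𝓘(ℝ, E).tangent ∞ Φ.symm Φ.target ∧
      ∀ w ∈ Φ.source, w ∈ S.total ↔ (Φ w).2 = 0 := by
  obtain ⟨V, hV, hxV, n, X, hX, hspan⟩ := hS v.proj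
  have hn : Module.finrank ℝ (Submodule.span ℝ (range fun i => X i v.proj)) = n := by
    simpa using finrank_span_eq_card (hspan v.proj hxV).1
  rw [(hspan v.proj hxV).2] at hn
  obtain rfl : r = n := (hr v.proj).symm.trans hn
  obtain ⟨U, Ψ, z, hU, hxU, hsrc, htgt, hΨ, hΨ', hproj, hz, hlin⟩ :=
    exists_adapted_trivialization (X := X) (x₀ := v.proj)
      (fun i => (hV.mem_nhds hxV |> eventually_mem_nhds_iff.2).mono
        fun x hx => (hX i).contMDiffAt hx) (hspan v.proj hxV).1
  obtain ⟨κ, hκ⟩ := exists_equiv_span_iff_snd_eq_zero hz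
  let φ := chartAt E v.proj
  let e₁ : OpenPartialHomeomorph (TangentBundle 𝓘(ℝ, E) M) (E × E) :=
    (Ψ.trans (φ.prod (OpenPartialHomeomorph.refl E)))
  let m : (E × E) ≃L[ℝ] ((E × EuclideanSpace ℝ (Fin r)) ×
      EuclideanSpace ℝ (Fin (Module.finrank ℝ E - r))) :=
    ((ContinuousLinearEquiv.refl ℝ E).prodCongr κ).trans
      (ContinuousLinearEquiv.prodAssoc ℝ E _ _).symm
  let e₂ := (e₁.transHomeomorph m.toHomeomorph).restrOpen {v | v.proj ∈ V}
    (hV.preimage (FiberBundle.continuous_proj E (TangentSpace 𝓘(ℝ, E))))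
  have hval : ∀ w, e₂ w = ((φ (Ψ w).1, (κ (Ψ w).2).1), (κ (Ψ w).2).2) := fun w => rfl
  have hval' : ∀ w, e₂.symm w = Ψ.symm (φ.symm w.1.1, κ.symm (w.1.2, w.2)) := fun w => rfl
  have hmem : ∀ w ∈ e₂.source, w.proj ∈ U ∧ w.proj ∈ V ∧ w ∈ Ψ.source ∧ (Ψ w).1 ∈ φ.source := by
    rintro w ⟨⟨h1, h2⟩, h3⟩
    have h4 : w ∈ Ψ.source := h1
    refine ⟨?_, h3, h1, h2.1⟩
    rwa [hsrc] at h4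
  have hmem' : ∀ w ∈ e₂.target, w.1.1 ∈ φ.target ∧
      (φ.symm w.1.1, κ.symm (w.1.2, w.2)) ∈ Ψ.target := by
    rintro w ⟨⟨h1, h2⟩, h3⟩
    exact ⟨h1.1, h2⟩
  refine ⟨e₂, ?_, ?_, ?_, ?_⟩
  · have h1 : v ∈ Ψ.source := by rw [hsrc]; exact hxU
    refine ⟨⟨h1, ?_, trivial⟩, hxV⟩
    change (Ψ v).1 ∈ φ.source
    rw [hproj v h1]
    exact mem_chart_source E v.proj
  · have h0 : ContMDiffOn 𝓘(ℝ, E).tangent (𝓘(ℝ, E).prod 𝓘(ℝ, E)) ∞ Ψ e₂.source :=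
      hΨ.mono fun w hw => (hmem w hw).2.2.1
    have h1 : ContMDiffOn 𝓘(ℝ, E).tangent 𝓘(ℝ, E) ∞ (fun w => φ (Ψ w).1) e₂.source :=
      (contMDiffOn_chart (I := 𝓘(ℝ, E))).comp (contMDiff_fst.comp_contMDiffOn h0)
        fun w hw => (hmem w hw).2.2.2
    have h2 : ContMDiffOn 𝓘(ℝ, E).tangent 𝓘(ℝ, E) ∞ (fun w => (Ψ w).2) e₂.source :=
      contMDiff_snd.comp_contMDiffOn h0
    exact m.contDiff.contMDiff.comp_contMDiffOn (h1.prodMk_space h2)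
  · have h1 : ContDiff ℝ ∞ (fun w : (E × EuclideanSpace ℝ (Fin r)) ×
        EuclideanSpace ℝ (Fin (Module.finrank ℝ E - r)) => w.1.1) := by fun_prop
    have h2 : ContDiff ℝ ∞ (fun w : (E × EuclideanSpace ℝ (Fin r)) ×
        EuclideanSpace ℝ (Fin (Module.finrank ℝ E - r)) => κ.symm (w.1.2, w.2)) := by fun_prop
    have h3 := (contMDiffOn_chart_symm (I := 𝓘(ℝ, E)) (n := ∞) (x := v.proj)).comp
      (h1.contMDiff.contMDiffOn (s := e₂.target)) fun w hw => (hmem' w hw).1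
    exact hΨ'.comp (h3.prodMk h2.contMDiff.contMDiffOn) fun w hw => (hmem' w hw).2
  · rintro ⟨x, w⟩ hw
    obtain ⟨hwU, hwV, hwΨ, -⟩ := hmem _ hw
    rw [hval]
    change w ∈ S x ↔ (κ (Ψ ⟨x, w⟩).2).2 = 0
    rw [← hκ, ← (hspan x hwV).2]
    obtain ⟨hl, hlz⟩ := hlin x hwU
    let l := hl.mk' _
    have hinj : Injective l := by
      intro a b hab
      have ha : (⟨x, a⟩ : TangentBundle 𝓘(ℝ, E) M) ∈ Ψ.source := by rw [hsrc]; exact hwU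
      have hb : (⟨x, b⟩ : TangentBundle 𝓘(ℝ, E) M) ∈ Ψ.source := by rw [hsrc]; exact hwU
      have := Ψ.injOn ha hb (Prod.ext ((hproj _ ha).trans (hproj _ hb).symm) hab)
      simpa using this
    have hrange : range z = l '' range (fun i => X i x) := by
      rw [← range_comp]
      exact congrArg range (funext fun i => (hlz i).symm)
    rw [hrange, ← Submodule.map_span]
    change w ∈ _ ↔ l w ∈ _
    rw [Submodule.mem_map]
    exact ⟨fun h => ⟨w, h, rfl⟩, fun ⟨w', h, h'⟩ => hinj h' ▸ h⟩

/-- The total space of a subbundle of `TM` of constant rank is an embedded submanifold of `TM`. -/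
theorem IsSmoothSubbundle.exists_chartedSpace_total {S : TangentDistribution 𝓘(ℝ, E) M}
    (hS : IsSmoothSubbundle 𝓘(ℝ, E) S) {r : ℕ} (hr : ∀ x, Module.finrank ℝ (S x) = r) :
    ∃ _ : ChartedSpace (E × EuclideanSpace ℝ (Fin r)) S.total,
      IsManifold 𝓘(ℝ, E × EuclideanSpace ℝ (Fin r)) ∞ S.total ∧
      Manifold.IsSmoothEmbedding 𝓘(ℝ, E × EuclideanSpace ℝ (Fin r)) 𝓘(ℝ, E).tangent ∞
        (Subtype.val : S.total → TangentBundle 𝓘(ℝ, E) M) := by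
  rcases isEmpty_or_nonempty M with hM | ⟨⟨x₁⟩⟩
  · have : IsEmpty S.total := ⟨fun v => hM.false v.1.proj⟩
    let cs : ChartedSpace (E × EuclideanSpace ℝ (Fin r)) S.total := ChartedSpace.empty _ _
    refine ⟨cs, isManifold_of_contDiffOn _ _ _ ?_, ?_, Topology.IsEmbedding.subtypeVal⟩
    · rintro e e' he -
      exact he.elim
    · exact Manifold.IsImmersionOfComplement.isImmersion (F := PUnit.{1}) fun x => isEmptyElim x
  have hrE : r ≤ Module.finrank ℝ E := by
    rw [← hr x₁]
    exact (S x₁).finrank_le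
  let L' : E ≃L[ℝ] (EuclideanSpace ℝ (Fin r) × EuclideanSpace ℝ (Fin (Module.finrank ℝ E - r))) :=
    ContinuousLinearEquiv.ofFinrankEq (by simp; omega)
  let L : ((E × EuclideanSpace ℝ (Fin r)) × EuclideanSpace ℝ (Fin (Module.finrank ℝ E - r))) ≃L[ℝ]
      (E × E) := (ContinuousLinearEquiv.prodAssoc ℝ E _ _).trans
      ((ContinuousLinearEquiv.refl ℝ E).prodCongr L'.symm)
  exact exists_chartedSpace_of_slices (I := 𝓘(ℝ, E).tangent) L S.total
    fun v _ => hS.exists_slice hr v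

end Total

/-! ### Submersions and surjective differentials -/

section SubmersionCriterion

variable {E : Type*} [NormedAddCommGroup E] [NormedSpace ℝ E] [FiniteDimensional ℝ E]
  {E' : Type*} [NormedAddCommGroup E'] [NormedSpace ℝ E'] [FiniteDimensional ℝ E']

/-- A surjective linear map is the first component of a linear isomorphism. -/
theorem exists_equiv_prod_of_surjective {D : E →L[ℝ] E'} (hD : Surjective D) :
    ∃ e : E ≃L[ℝ] (E' × EuclideanSpace ℝ (Fin (Module.finrank ℝ E - Module.finrank ℝ E'))),
      ∀ w, (e w).1 = D w := by
  have hr := LinearMap.finrank_range_add_finrank_ker D.toLinearMap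
  have hrange : LinearMap.range D.toLinearMap = ⊤ := LinearMap.range_eq_top.2 hD
  rw [hrange, finrank_top] at hr
  obtain ⟨p, hp⟩ := (LinearMap.ker D.toLinearMap).subtype.exists_leftInverse_of_injective
    (Submodule.ker_subtype _)
  let a : LinearMap.ker D.toLinearMap ≃ₗ[ℝ]
      EuclideanSpace ℝ (Fin (Module.finrank ℝ E - Module.finrank ℝ E')) :=
    LinearEquiv.ofFinrankEq _ _ (by rw [finrank_euclideanSpace, Fintype.card_fin]; omega)
  let T : E →ₗ[ℝ] E' × EuclideanSpace ℝ (Fin (Module.finrank ℝ E - Module.finrank ℝ E')) :=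
    D.toLinearMap.prod (a.toLinearMap ∘ₗ p)
  have hT : Injective T := by
    rw [← LinearMap.ker_eq_bot, LinearMap.ker_eq_bot']
    intro w hw
    have h1 : D w = 0 := congrArg Prod.fst hw
    have h2 : a (p w) = 0 := congrArg Prod.snd hw
    have h3 := LinearMap.congr_fun hp ⟨w, h1⟩
    rw [a.map_eq_zero_iff] at h2
    simp only [LinearMap.comp_apply, Submodule.subtype_apply, h2, LinearMap.id_apply] at h3
    exact congrArg Subtype.val h3.symm
  refine ⟨(LinearMap.linearEquivOfInjective T hT ?_).toContinuousLinearEquiv, fun w => rfl⟩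
  rw [Module.finrank_prod, finrank_euclideanSpace, Fintype.card_fin]
  omega

variable {M : Type*} [TopologicalSpace M] [ChartedSpace E M] [IsManifold 𝓘(ℝ, E) ∞ M]
  {N : Type*} [TopologicalSpace N] [ChartedSpace E' N] [IsManifold 𝓘(ℝ, E') ∞ N]

/-- A smooth map between finite-dimensional manifolds with surjective differentials is a
submersion. -/
theorem Manifold.isSubmersion_of_surjective_mfderiv {f : M → N}
    (hf : ContMDiff 𝓘(ℝ, E) 𝓘(ℝ, E') ∞ f)
    (hs : ∀ x, Surjective (mfderiv 𝓘(ℝ, E) 𝓘(ℝ, E') f x)) :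
    Manifold.IsSubmersion 𝓘(ℝ, E) 𝓘(ℝ, E') ∞ f := by
  have : CompleteSpace E := FiniteDimensional.complete ℝ E
  refine Manifold.IsSubmersionOfComplement.isSubmersion
    (F := EuclideanSpace ℝ (Fin (Module.finrank ℝ E - Module.finrank ℝ E'))) fun x => ?_
  let φ := chartAt E x
  let ψ := chartAt E' (f x)
  let g : E → E' := ψ ∘ f ∘ φ.symm
  let O : Set E := φ.target ∩ φ.symm ⁻¹' (f ⁻¹' ψ.source)
  have hO : IsOpen O := φ.symm.isOpen_inter_preimage (ψ.open_source.preimage hf.continuous)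
  have hx : φ x ∈ O := by
    refine ⟨mem_chart_target E x, ?_⟩
    change f (φ.symm (φ x)) ∈ ψ.source
    rw [φ.left_inv (mem_chart_source E x)]
    exact mem_chart_source E' (f x)
  have hg : ContDiffOn ℝ ∞ g O := by
    rw [← contMDiffOn_iff_contDiffOn]
    exact (contMDiffOn_chart (I := 𝓘(ℝ, E'))).comp (hf.comp_contMDiffOn
      ((contMDiffOn_chart_symm (I := 𝓘(ℝ, E))).mono inter_subset_left)) fun u hu => hu.2
  let D : E →L[ℝ] E' := mfderiv 𝓘(ℝ, E) 𝓘(ℝ, E') f x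
  have hD : HasFDerivAt g D (φ x) := by
    have h1 : HasFDerivWithinAt g D univ (φ x) := by
      have h0 := ((hf x).mdifferentiableAt (by simp)).hasMFDerivAt.2
      rw [ModelWithCorners.range_eq_univ] at h0
      exact h0
    exact hasFDerivWithinAt_univ.1 h1
  obtain ⟨e, he⟩ := exists_equiv_prod_of_surjective (D := D) (hs x)
  -- straighten `g` by means of the second component of `e`
  let Φ : E → E := fun u => e.symm (g u, (e u).2)
  have hΦ : ContDiffOn ℝ ∞ Φ O := by
    have h1 : ContDiff ℝ ∞ (fun q : E' × E => e.symm (q.1, (e q.2).2)) := by fun_prop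
    exact h1.comp_contDiffOn (hg.prodMk contDiffOn_id)
  have hΦ' : HasFDerivAt Φ ((ContinuousLinearEquiv.refl ℝ E : E ≃L[ℝ] E) : E →L[ℝ] E) (φ x) := by
    let s : E →L[ℝ] EuclideanSpace ℝ (Fin (Module.finrank ℝ E - Module.finrank ℝ E')) :=
      (ContinuousLinearMap.snd ℝ E' _).comp e.toContinuousLinearMap
    have h1 : HasFDerivAt (fun u => (e u).2) s (φ x) := s.hasFDerivAt
    have h2 := e.symm.hasFDerivAt.comp (φ x) (hD.prodMk h1)
    convert! h2 using 1
    ext w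
    apply e.injective
    simp [← he, s]
  have hΦx : ContDiffAt ℝ ∞ Φ (φ x) := hΦ.contDiffAt (hO.mem_nhds hx)
  let R : Set (E →L[ℝ] E) := range ((↑) : (E ≃L[ℝ] E) → E →L[ℝ] E)
  have hcont : ContinuousOn (fderiv ℝ Φ) O := hΦ.continuousOn_fderiv_of_isOpen hO (by simp)
  have hOR : IsOpen (O ∩ fderiv ℝ Φ ⁻¹' R) :=
    hcont.isOpen_inter_preimage hO ContinuousLinearEquiv.isOpen
  let T := (hΦx.toOpenPartialHomeomorph Φ hΦ' (by simp)).restrOpen _ hOR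
  have hT : ∀ u, T u = Φ u := fun u => rfl
  have hTO : ∀ u ∈ T.source, u ∈ O ∧ fderiv ℝ Φ u ∈ R := fun u hu => hu.2
  have hTx : φ x ∈ T.source :=
    ⟨hΦx.mem_toOpenPartialHomeomorph_source hΦ' (by simp), hx,
      ⟨ContinuousLinearEquiv.refl ℝ E, hΦ'.fderiv.symm⟩⟩
  have hTs : ContDiffOn ℝ ∞ T T.source := hΦ.mono fun u hu => (hTO u hu).1
  have hTs' : ContDiffOn ℝ ∞ T.symm T.target := by
    intro w hw
    obtain ⟨hu, e', he'⟩ := hTO _ (T.map_target hw)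
    have h1 : ContDiffAt ℝ ∞ Φ (T.symm w) := hΦ.contDiffAt (hO.mem_nhds hu)
    refine (T.contDiffAt_symm hw (f₀' := e') ?_ h1).contDiffWithinAt
    change HasFDerivAt Φ (e' : E →L[ℝ] E) (T.symm w)
    rw [he']
    exact (h1.differentiableAt (by simp)).hasFDerivAt
  have hm : φ.trans T ∈ IsManifold.maximalAtlas 𝓘(ℝ, E) ∞ M := by
    apply OpenPartialHomeomorph.mem_maximalAtlas_of_contMDiffOn
    · exact hTs.contMDiffOn.comp ((contMDiffOn_chart (I := 𝓘(ℝ, E))).mono inter_subset_left)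
        fun u hu => hu.2
    · exact (contMDiffOn_chart_symm (I := 𝓘(ℝ, E))).comp
        (hTs'.contMDiffOn.mono inter_subset_left) fun u hu => hu.2
  refine Manifold.IsSubmersionAtOfComplement.mk_of_continuousAt hf.continuous.continuousAt e
    (φ.trans T) ψ ⟨mem_chart_source E x, hTx⟩ (mem_chart_source E' (f x)) hm
    (IsManifold.chart_mem_maximalAtlas (f x)) ?_
  intro w hw
  have hw' : w ∈ T.target := by
    have : w ∈ (φ.trans T).target := by simpa using hw
    exact this.1
  have h1 : T (T.symm w) = w := T.right_inv hw'
  rw [hT] at h1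
  change g (T.symm w) = (e w).1
  conv_rhs => rw [← h1]
  simp [Φ]

/-- A smooth map with differentiable local right inverses through every point is a submersion. -/
theorem Manifold.isSubmersion_of_local_sections {f : M → N}
    (hf : ContMDiff 𝓘(ℝ, E) 𝓘(ℝ, E') ∞ f)
    (hs : ∀ x, ∃ σ : N → M, σ (f x) = x ∧ MDifferentiableAt 𝓘(ℝ, E') 𝓘(ℝ, E) σ (f x) ∧
      ∀ᶠ y in 𝓝 (f x), f (σ y) = y) :
    Manifold.IsSubmersion 𝓘(ℝ, E) 𝓘(ℝ, E') ∞ f := by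
  refine Manifold.isSubmersion_of_surjective_mfderiv hf fun x => ?_
  obtain ⟨σ, hσx, hσ, hev⟩ := hs x
  have h1 : HasMFDerivAt 𝓘(ℝ, E) 𝓘(ℝ, E') f (σ (f x)) (mfderiv 𝓘(ℝ, E) 𝓘(ℝ, E') f (σ (f x))) :=
    ((hf _).mdifferentiableAt (by simp)).hasMFDerivAt
  have h2 := h1.comp (f x) hσ.hasMFDerivAt
  have h3 := h2.mfderiv
  have hev' : (f ∘ σ) =ᶠ[𝓝 (f x)] id := hev
  rw [hev'.mfderiv_eq, mfderiv_id] at h3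
  rw [hσx] at h3
  intro w
  exact ⟨mfderiv 𝓘(ℝ, E') 𝓘(ℝ, E) σ (f x) w, (DFunLike.congr_fun h3 w).symm⟩

end SubmersionCriterion

/-! ### The tangent prolongation of a Lie groupoid -/

theorem tangentMap_zero {E : Type*} [NormedAddCommGroup E] [NormedSpace ℝ E]
    {E' : Type*} [NormedAddCommGroup E'] [NormedSpace ℝ E']
    {M : Type*} [TopologicalSpace M] [ChartedSpace E M]
    {N : Type*} [TopologicalSpace N] [ChartedSpace E' N] (f : M → N) (x : M) :
    tangentMap 𝓘(ℝ, E) 𝓘(ℝ, E') f ⟨x, 0⟩ = ⟨f x, 0⟩ := by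
  simp only [tangentMap, map_zero]

namespace GroupoidOps

theorem mulExt_apply {G P : Type*} (𝒢 : GroupoidOps G P) {g h : G}
    (e : 𝒢.source g = 𝒢.target h) : 𝒢.mulExt (g, h) = 𝒢.mul g h e :=
  dif_pos e

variable {EG : Type*} [NormedAddCommGroup EG] [NormedSpace ℝ EG]
  {EP : Type*} [NormedAddCommGroup EP] [NormedSpace ℝ EP]
  {G : Type*} [TopologicalSpace G] [ChartedSpace EG G]
  {P : Type*} [TopologicalSpace P] [ChartedSpace EP P]
  {𝒢 : GroupoidOps G P}

namespace IsLieGroupoid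

section Maps

variable (h𝒢 : 𝒢.IsLieGroupoid 𝓘(ℝ, EG) 𝓘(ℝ, EP))
include h𝒢

theorem mdifferentiable_source : MDifferentiable 𝓘(ℝ, EG) 𝓘(ℝ, EP) 𝒢.source :=
  h𝒢.source_submersion.contMDiff.mdifferentiable (by simp)

theorem mdifferentiable_target : MDifferentiable 𝓘(ℝ, EG) 𝓘(ℝ, EP) 𝒢.target :=
  h𝒢.target_submersion.contMDiff.mdifferentiable (by simp)

theorem mdifferentiable_unit : MDifferentiable 𝓘(ℝ, EP) 𝓘(ℝ, EG) 𝒢.unit :=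
  h𝒢.unit_smooth.mdifferentiable (by simp)

theorem hasVelocity_source {γ : ℝ → G} {v : TangentBundle 𝓘(ℝ, EG) G}
    (hγ : HasVelocity 𝓘(ℝ, EG) γ v) :
    HasVelocity 𝓘(ℝ, EP) (𝒢.source ∘ γ) ((𝒢.tangent 𝓘(ℝ, EG) 𝓘(ℝ, EP)).source v) :=
  hγ.comp (h𝒢.mdifferentiable_source _)

theorem hasVelocity_target {γ : ℝ → G} {v : TangentBundle 𝓘(ℝ, EG) G}
    (hγ : HasVelocity 𝓘(ℝ, EG) γ v) :
    HasVelocity 𝓘(ℝ, EP) (𝒢.target ∘ γ) ((𝒢.tangent 𝓘(ℝ, EG) 𝓘(ℝ, EP)).target v) :=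
  hγ.comp (h𝒢.mdifferentiable_target _)

theorem hasVelocity_unit {γ : ℝ → P} {x : TangentBundle 𝓘(ℝ, EP) P}
    (hγ : HasVelocity 𝓘(ℝ, EP) γ x) :
    HasVelocity 𝓘(ℝ, EG) (𝒢.unit ∘ γ) ((𝒢.tangent 𝓘(ℝ, EG) 𝓘(ℝ, EP)).unit x) :=
  hγ.comp (h𝒢.mdifferentiable_unit _)

/-- The product of composable curves has the product of their velocities as its velocity. -/
theorem hasVelocity_mul {γ δ : ℝ → G} {v w : TangentBundle 𝓘(ℝ, EG) G}
    (hγ : HasVelocity 𝓘(ℝ, EG) γ v) (hδ : HasVelocity 𝓘(ℝ, EG) δ w)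
    (hγδ : ∀ᶠ τ in 𝓝 0, 𝒢.source (γ τ) = 𝒢.target (δ τ))
    (e : (𝒢.tangent 𝓘(ℝ, EG) 𝓘(ℝ, EP)).source v = (𝒢.tangent 𝓘(ℝ, EG) 𝓘(ℝ, EP)).target w) :
    HasVelocity 𝓘(ℝ, EG) (fun τ => 𝒢.mulExt (γ τ, δ τ))
      ((𝒢.tangent 𝓘(ℝ, EG) 𝓘(ℝ, EP)).mul v w e) := by
  have h0 : (v.proj, w.proj) ∈ 𝒢.composable := by
    have := hγδ.self_of_nhds
    rwa [hγ.apply_zero, hδ.apply_zero] at this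
  exact (hγ.prodMk hδ).comp_within (f := 𝒢.mulExt) (A := 𝒢.composable)
    ((h𝒢.mul_smooth _ h0).mdifferentiableWithinAt (by simp)) hγδ

variable [IsManifold 𝓘(ℝ, EG) ∞ G]

/-- A curve can be prolonged to the left to a composable pair, with any matching velocity. -/
theorem exists_curve_composable {v w : TangentBundle 𝓘(ℝ, EG) G}
    (e : (𝒢.tangent 𝓘(ℝ, EG) 𝓘(ℝ, EP)).source v = (𝒢.tangent 𝓘(ℝ, EG) 𝓘(ℝ, EP)).target w)
    {δ : ℝ → G} (hδ : HasVelocity 𝓘(ℝ, EG) δ w) :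
    ∃ γ : ℝ → G, HasVelocity 𝓘(ℝ, EG) γ v ∧ ∀ᶠ τ in 𝓝 0, 𝒢.source (γ τ) = 𝒢.target (δ τ) := by
  have h1 := h𝒢.hasVelocity_target hδ
  rw [← e] at h1
  exact h1.exists_lift h𝒢.source_submersion v

theorem exists_curves_composable {v w : TangentBundle 𝓘(ℝ, EG) G}
    (e : (𝒢.tangent 𝓘(ℝ, EG) 𝓘(ℝ, EP)).source v = (𝒢.tangent 𝓘(ℝ, EG) 𝓘(ℝ, EP)).target w) :
    ∃ γ δ : ℝ → G, HasVelocity 𝓘(ℝ, EG) γ v ∧ HasVelocity 𝓘(ℝ, EG) δ w ∧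
      ∀ᶠ τ in 𝓝 0, 𝒢.source (γ τ) = 𝒢.target (δ τ) := by
  obtain ⟨δ, hδ⟩ := exists_hasVelocity w
  obtain ⟨γ, hγ, hγδ⟩ := h𝒢.exists_curve_composable e hδ
  exact ⟨γ, δ, hγ, hδ, hγδ⟩

theorem tangent_source_mul (v w : TangentBundle 𝓘(ℝ, EG) G)
    (e : (𝒢.tangent 𝓘(ℝ, EG) 𝓘(ℝ, EP)).source v = (𝒢.tangent 𝓘(ℝ, EG) 𝓘(ℝ, EP)).target w) :
    (𝒢.tangent 𝓘(ℝ, EG) 𝓘(ℝ, EP)).source ((𝒢.tangent 𝓘(ℝ, EG) 𝓘(ℝ, EP)).mul v w e) =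
      (𝒢.tangent 𝓘(ℝ, EG) 𝓘(ℝ, EP)).source w := by
  obtain ⟨γ, δ, hγ, hδ, hγδ⟩ := h𝒢.exists_curves_composable e
  refine ((h𝒢.hasVelocity_source hδ).unique_of_eventuallyEq
    (h𝒢.hasVelocity_source (h𝒢.hasVelocity_mul hγ hδ hγδ e)) ?_).symm
  filter_upwards [hγδ] with τ hτ
  simp only [Function.comp_apply, 𝒢.mulExt_apply hτ, h𝒢.source_mul]

theorem tangent_target_mul (v w : TangentBundle 𝓘(ℝ, EG) G)
    (e : (𝒢.tangent 𝓘(ℝ, EG) 𝓘(ℝ, EP)).source v = (𝒢.tangent 𝓘(ℝ, EG) 𝓘(ℝ, EP)).target w) :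
    (𝒢.tangent 𝓘(ℝ, EG) 𝓘(ℝ, EP)).target ((𝒢.tangent 𝓘(ℝ, EG) 𝓘(ℝ, EP)).mul v w e) =
      (𝒢.tangent 𝓘(ℝ, EG) 𝓘(ℝ, EP)).target v := by
  obtain ⟨γ, δ, hγ, hδ, hγδ⟩ := h𝒢.exists_curves_composable e
  refine ((h𝒢.hasVelocity_target hγ).unique_of_eventuallyEq
    (h𝒢.hasVelocity_target (h𝒢.hasVelocity_mul hγ hδ hγδ e)) ?_).symm
  filter_upwards [hγδ] with τ hτ
  simp only [Function.comp_apply, 𝒢.mulExt_apply hτ, h𝒢.target_mul]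

theorem tangent_mul_assoc (u v w : TangentBundle 𝓘(ℝ, EG) G)
    (e₁ : (𝒢.tangent 𝓘(ℝ, EG) 𝓘(ℝ, EP)).source u = (𝒢.tangent 𝓘(ℝ, EG) 𝓘(ℝ, EP)).target v)
    (e₂ : (𝒢.tangent 𝓘(ℝ, EG) 𝓘(ℝ, EP)).source v = (𝒢.tangent 𝓘(ℝ, EG) 𝓘(ℝ, EP)).target w)
    (e₃ : (𝒢.tangent 𝓘(ℝ, EG) 𝓘(ℝ, EP)).source ((𝒢.tangent 𝓘(ℝ, EG) 𝓘(ℝ, EP)).mul u v e₁) =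
      (𝒢.tangent 𝓘(ℝ, EG) 𝓘(ℝ, EP)).target w)
    (e₄ : (𝒢.tangent 𝓘(ℝ, EG) 𝓘(ℝ, EP)).source u =
      (𝒢.tangent 𝓘(ℝ, EG) 𝓘(ℝ, EP)).target ((𝒢.tangent 𝓘(ℝ, EG) 𝓘(ℝ, EP)).mul v w e₂)) :
    (𝒢.tangent 𝓘(ℝ, EG) 𝓘(ℝ, EP)).mul ((𝒢.tangent 𝓘(ℝ, EG) 𝓘(ℝ, EP)).mul u v e₁) w e₃ =
      (𝒢.tangent 𝓘(ℝ, EG) 𝓘(ℝ, EP)).mul u ((𝒢.tangent 𝓘(ℝ, EG) 𝓘(ℝ, EP)).mul v w e₂) e₄ := by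
  obtain ⟨b, c, hb, hc, hbc⟩ := h𝒢.exists_curves_composable e₂
  obtain ⟨a, ha, hab⟩ := h𝒢.exists_curve_composable e₁ hb
  have hab_c : ∀ᶠ τ in 𝓝 0, 𝒢.source (𝒢.mulExt (a τ, b τ)) = 𝒢.target (c τ) := by
    filter_upwards [hab, hbc] with τ h1 h2
    rw [𝒢.mulExt_apply h1, h𝒢.source_mul, h2]
  have ha_bc : ∀ᶠ τ in 𝓝 0, 𝒢.source (a τ) = 𝒢.target (𝒢.mulExt (b τ, c τ)) := by
    filter_upwards [hab, hbc] with τ h1 h2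
    rw [𝒢.mulExt_apply h2, h𝒢.target_mul, h1]
  refine (h𝒢.hasVelocity_mul (h𝒢.hasVelocity_mul ha hb hab e₁) hc hab_c e₃).unique_of_eventuallyEq
    (h𝒢.hasVelocity_mul ha (h𝒢.hasVelocity_mul hb hc hbc e₂) ha_bc e₄) ?_
  filter_upwards [hab, hbc, hab_c, ha_bc] with τ h1 h2 h3 h4
  rw [𝒢.mulExt_apply h3, 𝒢.mulExt_apply h4]
  simp only [𝒢.mulExt_apply h1, 𝒢.mulExt_apply h2]
  exact (h𝒢.mul_assoc _ _ _ _ _ _ _).symm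

theorem tangent_mul_unit (v : TangentBundle 𝓘(ℝ, EG) G)
    (e : (𝒢.tangent 𝓘(ℝ, EG) 𝓘(ℝ, EP)).source v = (𝒢.tangent 𝓘(ℝ, EG) 𝓘(ℝ, EP)).target
      ((𝒢.tangent 𝓘(ℝ, EG) 𝓘(ℝ, EP)).unit ((𝒢.tangent 𝓘(ℝ, EG) 𝓘(ℝ, EP)).source v))) :
    (𝒢.tangent 𝓘(ℝ, EG) 𝓘(ℝ, EP)).mul v
      ((𝒢.tangent 𝓘(ℝ, EG) 𝓘(ℝ, EP)).unit ((𝒢.tangent 𝓘(ℝ, EG) 𝓘(ℝ, EP)).source v)) e = v := by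
  obtain ⟨γ, hγ⟩ := exists_hasVelocity v
  have hc : ∀ τ, 𝒢.source (γ τ) = 𝒢.target ((𝒢.unit ∘ 𝒢.source ∘ γ) τ) := fun τ =>
    (h𝒢.target_unit _).symm
  refine (hγ.unique_of_eventuallyEq (h𝒢.hasVelocity_mul hγ
    (h𝒢.hasVelocity_unit (h𝒢.hasVelocity_source hγ)) (Eventually.of_forall hc) e)
    (Eventually.of_forall fun τ => ?_)).symm
  simp only [𝒢.mulExt_apply (hc τ)]
  exact h𝒢.mul_unit _ _

theorem tangent_unit_mul (v : TangentBundle 𝓘(ℝ, EG) G)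
    (e : (𝒢.tangent 𝓘(ℝ, EG) 𝓘(ℝ, EP)).source ((𝒢.tangent 𝓘(ℝ, EG) 𝓘(ℝ, EP)).unit
      ((𝒢.tangent 𝓘(ℝ, EG) 𝓘(ℝ, EP)).target v)) = (𝒢.tangent 𝓘(ℝ, EG) 𝓘(ℝ, EP)).target v) :
    (𝒢.tangent 𝓘(ℝ, EG) 𝓘(ℝ, EP)).mul
      ((𝒢.tangent 𝓘(ℝ, EG) 𝓘(ℝ, EP)).unit ((𝒢.tangent 𝓘(ℝ, EG) 𝓘(ℝ, EP)).target v)) v e = v := by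
  obtain ⟨γ, hγ⟩ := exists_hasVelocity v
  have hc : ∀ τ, 𝒢.source ((𝒢.unit ∘ 𝒢.target ∘ γ) τ) = 𝒢.target (γ τ) := fun τ =>
    h𝒢.source_unit _
  refine (hγ.unique_of_eventuallyEq (h𝒢.hasVelocity_mul
    (h𝒢.hasVelocity_unit (h𝒢.hasVelocity_target hγ)) hγ (Eventually.of_forall hc) e)
    (Eventually.of_forall fun τ => ?_)).symm
  simp only [𝒢.mulExt_apply (hc τ)]
  exact h𝒢.unit_mul _ _

/-- The multiplication of `TG` extends locally to a smooth map on an open subset of `TG × TG`: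
compose the multiplication of `G` with a smooth retraction of an open subset of `G × G` onto the
composable pairs, which slides the first factor into the source fibre required by the second one,
and take the tangent map. -/
theorem exists_smooth_extension_tangent_mul (v₀ w₀ : TangentBundle 𝓘(ℝ, EG) G)
    (e₀ : (𝒢.tangent 𝓘(ℝ, EG) 𝓘(ℝ, EP)).source v₀ = (𝒢.tangent 𝓘(ℝ, EG) 𝓘(ℝ, EP)).target w₀) :
    ∃ K : TangentBundle 𝓘(ℝ, EG) G × TangentBundle 𝓘(ℝ, EG) G → TangentBundle 𝓘(ℝ, EG) G,
      (∀ᶠ q in 𝓝 (v₀, w₀),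
        ContMDiffAt (𝓘(ℝ, EG).tangent.prod 𝓘(ℝ, EG).tangent) 𝓘(ℝ, EG).tangent ∞ K q) ∧
      ∀ᶠ q in 𝓝 (v₀, w₀), ∀ e, (𝒢.tangent 𝓘(ℝ, EG) 𝓘(ℝ, EP)).mul q.1 q.2 e = K q := by
  obtain ⟨σ, O, hO, hxO, hσ, h1, h2⟩ :=
    (h𝒢.source_submersion.isSubmersionAt v₀.proj).exists_slide
  let j : G × G → G × P := fun q => (q.1, 𝒢.target q.2)
  have hj : ContMDiff (𝓘(ℝ, EG).prod 𝓘(ℝ, EG)) (𝓘(ℝ, EG).prod 𝓘(ℝ, EP)) ∞ j :=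
    contMDiff_fst.prodMk (h𝒢.target_submersion.contMDiff.comp contMDiff_snd)
  let W : Set (G × G) := j ⁻¹' O
  have hW : IsOpen W := hO.preimage hj.continuous
  let ρ : G × G → G × G := fun q => (σ (j q), q.2)
  have hρ : ContMDiffOn (𝓘(ℝ, EG).prod 𝓘(ℝ, EG)) (𝓘(ℝ, EG).prod 𝓘(ℝ, EG)) ∞ ρ W :=
    (hσ.comp hj.contMDiffOn fun q hq => hq).prodMk contMDiffOn_snd
  have hm : ContMDiffOn (𝓘(ℝ, EG).prod 𝓘(ℝ, EG)) 𝓘(ℝ, EG) ∞ (𝒢.mulExt ∘ ρ) W :=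
    h𝒢.mul_smooth.comp hρ fun q hq => h1 _ hq
  have hT := hm.contMDiffOn_tangentMapWithin (m := ∞) (by simp) hW.uniqueMDiffOn
  let W' : Set (TangentBundle 𝓘(ℝ, EG) G × TangentBundle 𝓘(ℝ, EG) G) :=
    {q | (q.1.proj, q.2.proj) ∈ W}
  have hW' : IsOpen W' := by
    have hp := FiberBundle.continuous_proj EG (TangentSpace 𝓘(ℝ, EG) (M := G))
    exact hW.preimage ((hp.comp continuous_fst).prodMk (hp.comp continuous_snd))
  have h0 : (v₀, w₀) ∈ W' := by
    have h3 : 𝒢.source v₀.proj = 𝒢.target w₀.proj := congrArg Bundle.TotalSpace.proj e₀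
    change (v₀.proj, 𝒢.target w₀.proj) ∈ O
    rwa [← h3]
  refine ⟨tangentMapWithin (𝓘(ℝ, EG).prod 𝓘(ℝ, EG)) 𝓘(ℝ, EG) (𝒢.mulExt ∘ ρ) W ∘
    (equivTangentBundleProd 𝓘(ℝ, EG) G 𝓘(ℝ, EG) G).symm, ?_, ?_⟩
  · have hK := hT.comp (contMDiff_equivTangentBundleProd_symm (I := 𝓘(ℝ, EG)) (M := G)
      (I' := 𝓘(ℝ, EG)) (M' := G) (n := ∞)).contMDiffOn (s := W') fun q hq => hq
    filter_upwards [hW'.mem_nhds h0] with q hq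
    exact hK.contMDiffAt (hW'.mem_nhds hq)
  · filter_upwards [hW'.mem_nhds h0]
    rintro ⟨v, w⟩ hq e
    obtain ⟨γ, δ, hγ, hδ, hγδ⟩ := h𝒢.exists_curves_composable e
    have hp := hγ.prodMk hδ
    have hev : ∀ᶠ τ in 𝓝 0, (γ τ, δ τ) ∈ W := by
      apply hp.continuousAt
      apply hW.mem_nhds
      change (γ 0, δ 0) ∈ W
      rw [hγ.apply_zero, hδ.apply_zero]
      exact hq
    have hA := hp.comp_within (f := 𝒢.mulExt ∘ ρ) (A := W)
      ((hm _ hq).mdifferentiableWithinAt (by simp)) hev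
    refine ((h𝒢.hasVelocity_mul hγ hδ hγδ e).unique_of_eventuallyEq hA ?_)
    filter_upwards [hev, hγδ] with τ h3 h4
    have h5 : σ (j (γ τ, δ τ)) = γ τ := by
      have h6 : j (γ τ, δ τ) = (γ τ, 𝒢.source (γ τ)) := by simp only [j, h4]
      have h7 : j (γ τ, δ τ) ∈ O := h3
      rw [h6] at h7 ⊢
      exact h2 _ h7
    simp only [Function.comp_apply, ρ, h5]

end Maps

end IsLieGroupoid

/-- The opposite groupoid, with source and target exchanged. -/
def op {G P : Type*} (𝒢 : GroupoidOps G P) : GroupoidOps G P where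
  source := 𝒢.target
  target := 𝒢.source
  unit := 𝒢.unit
  mul g h e := 𝒢.mul h g e.symm

theorem IsLieGroupoid.op (h𝒢 : 𝒢.IsLieGroupoid 𝓘(ℝ, EG) 𝓘(ℝ, EP)) :
    𝒢.op.IsLieGroupoid 𝓘(ℝ, EG) 𝓘(ℝ, EP) where
  source_mul g h e := h𝒢.target_mul h g e.symm
  target_mul g h e := h𝒢.source_mul h g e.symm
  mul_assoc g h l e₁ e₂ e₃ e₄ := (h𝒢.mul_assoc l h g e₂.symm e₁.symm e₄.symm e₃.symm).symm
  source_unit := h𝒢.target_unit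
  target_unit := h𝒢.source_unit
  mul_unit g e := h𝒢.unit_mul g e.symm
  unit_mul g e := h𝒢.mul_unit g e.symm
  exists_inv g := by
    obtain ⟨g', e, e', h1, h2⟩ := h𝒢.exists_inv g
    exact ⟨g', e'.symm, e.symm, h2, h1⟩
  source_submersion := h𝒢.target_submersion
  source_surjective := h𝒢.target_surjective
  target_submersion := h𝒢.source_submersion
  target_surjective := h𝒢.source_surjective
  unit_smooth := h𝒢.unit_smooth
  mul_smooth := by
    refine (h𝒢.mul_smooth.comp (contMDiff_snd.prodMk contMDiff_fst).contMDiffOn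
      fun q hq => Eq.symm hq).congr ?_
    rintro ⟨g, h⟩ hq
    have h1 : 𝒢.op.source g = 𝒢.op.target h := hq
    have h2 : 𝒢.source h = 𝒢.target g := h1.symm
    change 𝒢.op.mulExt (g, h) = 𝒢.mulExt (h, g)
    rw [𝒢.op.mulExt_apply h1, 𝒢.mulExt_apply h2]
    rfl

variable [IsManifold 𝓘(ℝ, EG) ∞ G]

theorem IsLieGroupoid.op_tangent_mul (h𝒢 : 𝒢.IsLieGroupoid 𝓘(ℝ, EG) 𝓘(ℝ, EP))
    (v w : TangentBundle 𝓘(ℝ, EG) G)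
    (e : (𝒢.tangent 𝓘(ℝ, EG) 𝓘(ℝ, EP)).source v = (𝒢.tangent 𝓘(ℝ, EG) 𝓘(ℝ, EP)).target w)
    (e' : (𝒢.op.tangent 𝓘(ℝ, EG) 𝓘(ℝ, EP)).source w = (𝒢.op.tangent 𝓘(ℝ, EG) 𝓘(ℝ, EP)).target v) :
    (𝒢.op.tangent 𝓘(ℝ, EG) 𝓘(ℝ, EP)).mul w v e' = (𝒢.tangent 𝓘(ℝ, EG) 𝓘(ℝ, EP)).mul v w e := by
  obtain ⟨γ, δ, hγ, hδ, hγδ⟩ := h𝒢.exists_curves_composable e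
  refine (h𝒢.op.hasVelocity_mul hδ hγ (hγδ.mono fun τ h => h.symm) e').unique_of_eventuallyEq
    (h𝒢.hasVelocity_mul hγ hδ hγδ e) ?_
  filter_upwards [hγδ] with τ h1
  have h2 : 𝒢.op.source (δ τ) = 𝒢.op.target (γ τ) := h1.symm
  rw [𝒢.op.mulExt_apply h2, 𝒢.mulExt_apply h1]
  rfl

theorem IsLieGroupoid.op_isSubgroupoid (h𝒢 : 𝒢.IsLieGroupoid 𝓘(ℝ, EG) 𝓘(ℝ, EP))
    {A : Set (TangentBundle 𝓘(ℝ, EG) G)} {B : Set (TangentBundle 𝓘(ℝ, EP) P)}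
    (h : (𝒢.tangent 𝓘(ℝ, EG) 𝓘(ℝ, EP)).IsSubgroupoid A B) :
    (𝒢.op.tangent 𝓘(ℝ, EG) 𝓘(ℝ, EP)).IsSubgroupoid A B where
  source_mem := h.target_mem
  target_mem := h.source_mem
  unit_mem := h.unit_mem
  mul_mem v hv w hw e := by
    rw [h𝒢.op_tangent_mul w v e.symm e]
    exact h.mul_mem w hw v hv _
  exists_inv_mem v hv := by
    obtain ⟨w, hw, e, e', h1, h2⟩ := h.exists_inv_mem v hv
    refine ⟨w, hw, e'.symm, e.symm, ?_, ?_⟩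
    · rw [h𝒢.op_tangent_mul w v e' e'.symm]
      exact h2
    · rw [h𝒢.op_tangent_mul v w e e.symm]
      exact h1

/-- The tangent map of the left translation `L_g` is the multiplication by `0_g`. -/
theorem IsLieGroupoid.tangentLeft_eq (h𝒢 : 𝒢.IsLieGroupoid 𝓘(ℝ, EG) 𝓘(ℝ, EP)) (g : G)
    (w : TangentBundle 𝓘(ℝ, EG) G)
    (e : (𝒢.tangent 𝓘(ℝ, EG) 𝓘(ℝ, EP)).source ⟨g, 0⟩ = (𝒢.tangent 𝓘(ℝ, EG) 𝓘(ℝ, EP)).target w) :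
    𝒢.tangentLeft 𝓘(ℝ, EG) g w = (𝒢.tangent 𝓘(ℝ, EG) 𝓘(ℝ, EP)).mul ⟨g, 0⟩ w e := by
  have hc : HasVelocity 𝓘(ℝ, EP) (fun _ => 𝒢.source g)
      ((𝒢.tangent 𝓘(ℝ, EG) 𝓘(ℝ, EP)).target w) := by
    rw [← e]
    exact h𝒢.hasVelocity_source (HasVelocity.const g)
  obtain ⟨γ, hγ, hev⟩ := hc.exists_lift h𝒢.target_submersion w
  have hw : 𝒢.target w.proj = 𝒢.source g := (congrArg Bundle.TotalSpace.proj e).symm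
  have hd : MDifferentiableWithinAt 𝓘(ℝ, EG) 𝓘(ℝ, EG) (fun h => 𝒢.mulExt (g, h))
      {h | 𝒢.target h = 𝒢.source g} w.proj :=
    ((h𝒢.mul_smooth.comp (contMDiff_const.prodMk contMDiff_id).contMDiffOn
      fun h hh => Eq.symm hh) _ hw).mdifferentiableWithinAt (by simp)
  exact (hγ.comp_within hd hev).unique
    (h𝒢.hasVelocity_mul (HasVelocity.const g) hγ (hev.mono fun τ h => h.symm) e)

/-- The tangent map of the right translation `R_g` is the multiplication by `0_g`. -/
theorem IsLieGroupoid.tangentRight_eq (h𝒢 : 𝒢.IsLieGroupoid 𝓘(ℝ, EG) 𝓘(ℝ, EP)) (g : G)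
    (w : TangentBundle 𝓘(ℝ, EG) G)
    (e : (𝒢.tangent 𝓘(ℝ, EG) 𝓘(ℝ, EP)).source w = (𝒢.tangent 𝓘(ℝ, EG) 𝓘(ℝ, EP)).target ⟨g, 0⟩) :
    𝒢.tangentRight 𝓘(ℝ, EG) g w = (𝒢.tangent 𝓘(ℝ, EG) 𝓘(ℝ, EP)).mul w ⟨g, 0⟩ e := by
  obtain ⟨γ, hγ, hev⟩ := h𝒢.exists_curve_composable e (HasVelocity.const g)
  have hw : 𝒢.source w.proj = 𝒢.target g := congrArg Bundle.TotalSpace.proj e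
  have hd : MDifferentiableWithinAt 𝓘(ℝ, EG) 𝓘(ℝ, EG) (fun h => 𝒢.mulExt (h, g))
      {h | 𝒢.source h = 𝒢.target g} w.proj :=
    ((h𝒢.mul_smooth.comp (contMDiff_id.prodMk contMDiff_const).contMDiffOn
      fun h hh => hh) _ hw).mdifferentiableWithinAt (by simp)
  exact (hγ.comp_within hd hev).unique (h𝒢.hasVelocity_mul hγ (HasVelocity.const g) hev e)

end GroupoidOps

/-! ### Linear algebra of multiplicative distributions -/

/-- The rank-nullity theorem for the restriction of a linear map to a subspace. -/
theorem Submodule.finrank_map_add_finrank_inf_ker {V W : Type*} [AddCommGroup V] [Module ℝ V]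
    [AddCommGroup W] [Module ℝ W] [FiniteDimensional ℝ V] (f : V →ₗ[ℝ] W) (S : Submodule ℝ V) :
    Module.finrank ℝ (S.map f) + Module.finrank ℝ (S ⊓ LinearMap.ker f : Submodule ℝ V) =
      Module.finrank ℝ S := by
  have h := LinearMap.finrank_range_add_finrank_ker (f.domRestrict S)
  rw [LinearMap.range_domRestrict] at h
  rw [← h, ← Submodule.map_comap_subtype, Submodule.finrank_map_subtype_eq]
  rfl

theorem TangentBundle.mk_congr {E : Type*} [NormedAddCommGroup E] [NormedSpace ℝ E]
    {M : Type*} [TopologicalSpace M] [ChartedSpace E M] {x y : M} (h : x = y) (v : E) :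
    (⟨x, v⟩ : TangentBundle 𝓘(ℝ, E) M) = ⟨y, v⟩ := by
  subst h; rfl

theorem TangentBundle.snd_congr {E : Type*} [NormedAddCommGroup E] [NormedSpace ℝ E]
    {M : Type*} [TopologicalSpace M] [ChartedSpace E M] {v w : TangentBundle 𝓘(ℝ, E) M}
    (h : v = w) : (v.snd : E) = w.snd := by
  subst h; rfl

namespace GroupoidOps

variable {EG : Type*} [NormedAddCommGroup EG] [NormedSpace ℝ EG]
  {EP : Type*} [NormedAddCommGroup EP] [NormedSpace ℝ EP]
  {G : Type*} [TopologicalSpace G] [ChartedSpace EG G] [IsManifold 𝓘(ℝ, EG) ∞ G]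
  {P : Type*} [TopologicalSpace P] [ChartedSpace EP P] [IsManifold 𝓘(ℝ, EP) ∞ P]
  {𝒢 : GroupoidOps G P} {S : TangentDistribution 𝓘(ℝ, EG) G}

namespace IsLieGroupoid

section Algebra

variable (h𝒢 : 𝒢.IsLieGroupoid 𝓘(ℝ, EG) 𝓘(ℝ, EP))
include h𝒢

omit [IsManifold 𝓘(ℝ, EG) ∞ G] in
theorem tangent_source_unit (x : TangentBundle 𝓘(ℝ, EP) P) :
    (𝒢.tangent 𝓘(ℝ, EG) 𝓘(ℝ, EP)).source ((𝒢.tangent 𝓘(ℝ, EG) 𝓘(ℝ, EP)).unit x) = x := by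
  obtain ⟨γ, hγ⟩ := exists_hasVelocity x
  exact ((h𝒢.hasVelocity_source (h𝒢.hasVelocity_unit hγ)).unique_of_eventuallyEq hγ
    (Eventually.of_forall fun τ => (h𝒢.source_unit _).symm))

omit [IsManifold 𝓘(ℝ, EG) ∞ G] in
theorem tangent_target_unit (x : TangentBundle 𝓘(ℝ, EP) P) :
    (𝒢.tangent 𝓘(ℝ, EG) 𝓘(ℝ, EP)).target ((𝒢.tangent 𝓘(ℝ, EG) 𝓘(ℝ, EP)).unit x) = x := by
  obtain ⟨γ, hγ⟩ := exists_hasVelocity x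
  exact ((h𝒢.hasVelocity_target (h𝒢.hasVelocity_unit hγ)).unique_of_eventuallyEq hγ
    (Eventually.of_forall fun τ => (h𝒢.target_unit _).symm))

omit [IsManifold 𝓘(ℝ, EG) ∞ G] [IsManifold 𝓘(ℝ, EP) ∞ P] in
theorem tangent_zero_mul_zero {g h : G} (e' : 𝒢.source g = 𝒢.target h)
    (e : (𝒢.tangent 𝓘(ℝ, EG) 𝓘(ℝ, EP)).source ⟨g, 0⟩ =
      (𝒢.tangent 𝓘(ℝ, EG) 𝓘(ℝ, EP)).target ⟨h, 0⟩) :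
    (𝒢.tangent 𝓘(ℝ, EG) 𝓘(ℝ, EP)).mul ⟨g, 0⟩ ⟨h, 0⟩ e = ⟨𝒢.mul g h e', 0⟩ :=
  (h𝒢.hasVelocity_mul (HasVelocity.const g) (HasVelocity.const h)
    (Eventually.of_forall fun _ => e') e).unique_of_eventuallyEq (HasVelocity.const _)
    (Eventually.of_forall fun _ => (𝒢.mulExt_apply e').symm)

omit [IsManifold 𝓘(ℝ, EG) ∞ G] in
/-- The set of units of a subgroupoid of `TG` is determined by the subgroupoid. -/
theorem isSubgroupoid_total_unique {B : Set (TangentBundle 𝓘(ℝ, EP) P)}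
    (h : (𝒢.tangent 𝓘(ℝ, EG) 𝓘(ℝ, EP)).IsSubgroupoid S.total B) :
    B = (𝒢.interUnits 𝓘(ℝ, EG) 𝓘(ℝ, EP) S).total := by
  ext x
  refine ⟨fun hx => h.unit_mem x hx, fun hx => ?_⟩
  rw [← h𝒢.tangent_source_unit x]
  exact h.source_mem _ hx

omit [IsManifold 𝓘(ℝ, EG) ∞ G] in
theorem isSubgroupoid_interUnits (hmul : 𝒢.IsMultiplicative 𝓘(ℝ, EG) 𝓘(ℝ, EP) S) :
    (𝒢.tangent 𝓘(ℝ, EG) 𝓘(ℝ, EP)).IsSubgroupoid S.total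
      (𝒢.interUnits 𝓘(ℝ, EG) 𝓘(ℝ, EP) S).total := by
  obtain ⟨B, hB⟩ := hmul
  rwa [h𝒢.isSubgroupoid_total_unique hB] at hB

omit [IsManifold 𝓘(ℝ, EG) ∞ G] in
/-- `Tt ∘ Tε` is the identity. -/
theorem mfderiv_target_unit (p : P) (x : EP) :
    (mfderiv 𝓘(ℝ, EG) 𝓘(ℝ, EP) 𝒢.target (𝒢.unit p) (mfderiv 𝓘(ℝ, EP) 𝓘(ℝ, EG) 𝒢.unit p x) : EP) =
      x :=
  TangentBundle.snd_congr (h𝒢.tangent_target_unit ⟨p, x⟩)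

end Algebra

section Multiplicative

variable (h𝒢 : 𝒢.IsLieGroupoid 𝓘(ℝ, EG) 𝓘(ℝ, EP))
  (hmul : 𝒢.IsMultiplicative 𝓘(ℝ, EG) 𝓘(ℝ, EP) S)
include h𝒢 hmul

omit [IsManifold 𝓘(ℝ, EP) ∞ P] in
theorem op_isMultiplicative : 𝒢.op.IsMultiplicative 𝓘(ℝ, EG) 𝓘(ℝ, EP) S := by
  obtain ⟨B, hB⟩ := hmul
  exact ⟨B, h𝒢.op_isSubgroupoid hB⟩

omit [IsManifold 𝓘(ℝ, EG) ∞ G] in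
theorem mfderiv_source_mem (g : G) {v : TangentSpace 𝓘(ℝ, EG) g} (hv : v ∈ S g) :
    mfderiv 𝓘(ℝ, EG) 𝓘(ℝ, EP) 𝒢.source g v ∈
      𝒢.interUnits 𝓘(ℝ, EG) 𝓘(ℝ, EP) S (𝒢.source g) :=
  (h𝒢.isSubgroupoid_interUnits hmul).source_mem ⟨g, v⟩ hv

omit [IsManifold 𝓘(ℝ, EG) ∞ G] in
theorem mfderiv_target_unit_mem (p : P) {v : TangentSpace 𝓘(ℝ, EG) (𝒢.unit p)}
    (hv : v ∈ S (𝒢.unit p)) :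
    (mfderiv 𝓘(ℝ, EG) 𝓘(ℝ, EP) 𝒢.target (𝒢.unit p) v : EP) ∈
      𝒢.interUnits 𝓘(ℝ, EG) 𝓘(ℝ, EP) S p := by
  have h1 := (h𝒢.isSubgroupoid_interUnits hmul).target_mem ⟨𝒢.unit p, v⟩ hv
  have h2 : (𝒢.tangent 𝓘(ℝ, EG) 𝓘(ℝ, EP)).target ⟨𝒢.unit p, v⟩ =
      ⟨p, (mfderiv 𝓘(ℝ, EG) 𝓘(ℝ, EP) 𝒢.target (𝒢.unit p) v : EP)⟩ :=
    TangentBundle.mk_congr (h𝒢.target_unit p) _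
  rw [h2] at h1
  exact h1

omit [IsManifold 𝓘(ℝ, EG) ∞ G] in
/-- `S|_P = (S ∩ TP) ⊕ (S ∩ AG)`: the projection `Tε ∘ Tt` of `TG|_P` onto `TP` preserves `S`. -/
theorem disjoint_and_sup_eq (p : P) :
    Disjoint (S (𝒢.unit p) ⊓ 𝒢.tangentUnits 𝓘(ℝ, EG) 𝓘(ℝ, EP) p)
        (S (𝒢.unit p) ⊓ 𝒢.algebroid 𝓘(ℝ, EG) 𝓘(ℝ, EP) p) ∧
      (S (𝒢.unit p) ⊓ 𝒢.tangentUnits 𝓘(ℝ, EG) 𝓘(ℝ, EP) p) ⊔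
        (S (𝒢.unit p) ⊓ 𝒢.algebroid 𝓘(ℝ, EG) 𝓘(ℝ, EP) p) = S (𝒢.unit p) := by
  constructor
  · rw [Submodule.disjoint_def]
    rintro v ⟨-, ⟨x, rfl⟩⟩ ⟨-, hv⟩
    have h1 := h𝒢.mfderiv_target_unit p x
    have h2 : (mfderiv 𝓘(ℝ, EG) 𝓘(ℝ, EP) 𝒢.target (𝒢.unit p)
      (mfderiv 𝓘(ℝ, EP) 𝓘(ℝ, EG) 𝒢.unit p x) : EP) = 0 := hv
    have h3 : x = 0 := h1.symm.trans h2
    rw [h3]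
    exact map_zero _
  · refine le_antisymm (sup_le inf_le_left inf_le_left) fun v hv => ?_
    have hx := h𝒢.mfderiv_target_unit_mem hmul p hv
    set x : EP := mfderiv 𝓘(ℝ, EG) 𝓘(ℝ, EP) 𝒢.target (𝒢.unit p) v with hxdef
    let w : TangentSpace 𝓘(ℝ, EG) (𝒢.unit p) := mfderiv 𝓘(ℝ, EP) 𝓘(ℝ, EG) 𝒢.unit p x
    have hw : w ∈ S (𝒢.unit p) := hx
    refine Submodule.mem_sup.2 ⟨w, ⟨hw, ⟨x, rfl⟩⟩, v - w,
      ⟨Submodule.sub_mem _ hv hw, ?_⟩, by abel⟩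
    change mfderiv 𝓘(ℝ, EG) 𝓘(ℝ, EP) 𝒢.target (𝒢.unit p) (v - w) = 0
    rw [map_sub, sub_eq_zero]
    exact (h𝒢.mfderiv_target_unit p x).symm

end Multiplicative

end IsLieGroupoid

omit [IsManifold 𝓘(ℝ, EG) ∞ G] [IsManifold 𝓘(ℝ, EP) ∞ P] in
/-- Membership in `S^t(g)`, in terms of the target map of the tangent groupoid. -/
theorem mem_fiber_inf_kerTarget {g : G} {u : TangentBundle 𝓘(ℝ, EG) G} :
    u ∈ (S ⊓ 𝒢.kerTarget 𝓘(ℝ, EG) 𝓘(ℝ, EP)).fiber g ↔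
      u.proj = g ∧ u ∈ S.total ∧ (𝒢.tangent 𝓘(ℝ, EG) 𝓘(ℝ, EP)).target u = ⟨𝒢.target g, 0⟩ := by
  constructor
  · rintro ⟨rfl, h1, h2⟩
    refine ⟨rfl, h1, ?_⟩
    have h3 : mfderiv 𝓘(ℝ, EG) 𝓘(ℝ, EP) 𝒢.target u.proj u.snd = 0 := h2
    change (⟨_, mfderiv 𝓘(ℝ, EG) 𝓘(ℝ, EP) 𝒢.target u.proj u.snd⟩ : TangentBundle 𝓘(ℝ, EP) P) = _
    rw [h3]
  · rintro ⟨rfl, h1, h2⟩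
    exact ⟨rfl, h1, TangentBundle.snd_congr h2⟩

namespace IsLieGroupoid

section Translation

variable (h𝒢 : 𝒢.IsLieGroupoid 𝓘(ℝ, EG) 𝓘(ℝ, EP))
  (hmul : 𝒢.IsMultiplicative 𝓘(ℝ, EG) 𝓘(ℝ, EP) S)
include h𝒢 hmul

/-- `S^t(g ⋆ h) = 0_g ⋆ S^t(h)`. -/
theorem fiber_kerTarget_mul {g h : G} (e' : 𝒢.source g = 𝒢.target h) :
    (S ⊓ 𝒢.kerTarget 𝓘(ℝ, EG) 𝓘(ℝ, EP)).fiber (𝒢.mul g h e') =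
      {u | ∃ w ∈ (S ⊓ 𝒢.kerTarget 𝓘(ℝ, EG) 𝓘(ℝ, EP)).fiber h, ∃ e,
        u = (𝒢.tangent 𝓘(ℝ, EG) 𝓘(ℝ, EP)).mul ⟨g, 0⟩ w e} := by
  have hsub := h𝒢.isSubgroupoid_interUnits hmul
  have h0 : ∀ g : G, (⟨g, 0⟩ : TangentBundle 𝓘(ℝ, EG) G) ∈ S.total := fun g => (S g).zero_mem
  have hs0 : ∀ g : G, (𝒢.tangent 𝓘(ℝ, EG) 𝓘(ℝ, EP)).source ⟨g, 0⟩ = ⟨𝒢.source g, 0⟩ :=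
    tangentMap_zero _
  have ht0 : ∀ g : G, (𝒢.tangent 𝓘(ℝ, EG) 𝓘(ℝ, EP)).target ⟨g, 0⟩ = ⟨𝒢.target g, 0⟩ :=
    tangentMap_zero _
  have hu0 : ∀ p : P, (𝒢.tangent 𝓘(ℝ, EG) 𝓘(ℝ, EP)).unit ⟨p, 0⟩ = ⟨𝒢.unit p, 0⟩ :=
    tangentMap_zero _
  ext u
  simp only [mem_fiber_inf_kerTarget, mem_ofPred_eq]
  constructor
  · rintro ⟨hup, huS, hut⟩
    -- `u = 0_g ⋆ (0_{g⁻¹} ⋆ u)`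
    obtain ⟨g', e₁, e₂, hgg', hg'g⟩ := h𝒢.exists_inv g
    have hut' : (𝒢.tangent 𝓘(ℝ, EG) 𝓘(ℝ, EP)).target u = ⟨𝒢.target g, 0⟩ := by
      rw [hut, h𝒢.target_mul]
    have e₃ : (𝒢.tangent 𝓘(ℝ, EG) 𝓘(ℝ, EP)).source ⟨g', 0⟩ =
        (𝒢.tangent 𝓘(ℝ, EG) 𝓘(ℝ, EP)).target u := by rw [hs0, hut', e₂]
    have e₄ : (𝒢.tangent 𝓘(ℝ, EG) 𝓘(ℝ, EP)).source ⟨g, 0⟩ = (𝒢.tangent 𝓘(ℝ, EG) 𝓘(ℝ, EP)).target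
        ((𝒢.tangent 𝓘(ℝ, EG) 𝓘(ℝ, EP)).mul ⟨g', 0⟩ u e₃) := by
      rw [h𝒢.tangent_target_mul, hs0, ht0, e₁]
    have e₅ : (𝒢.tangent 𝓘(ℝ, EG) 𝓘(ℝ, EP)).source ⟨g, 0⟩ =
        (𝒢.tangent 𝓘(ℝ, EG) 𝓘(ℝ, EP)).target ⟨g', 0⟩ := by rw [hs0, ht0, e₁]
    refine ⟨_, ⟨?_, hsub.mul_mem _ (h0 g') u huS e₃, ?_⟩, e₄, ?_⟩
    · change 𝒢.mulExt (g', u.proj) = h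
      have h1 : 𝒢.source g' = 𝒢.target (𝒢.mul g h e') := by rw [h𝒢.target_mul, e₂]
      rw [hup, 𝒢.mulExt_apply h1, ← h𝒢.mul_assoc g' g h e₂ e' (by rw [h𝒢.source_mul, e'])]
      have h2 : ∀ x (hx : x = 𝒢.unit (𝒢.target h)) (ex : 𝒢.source x = 𝒢.target h),
          𝒢.mul x h ex = h := by
        rintro _ rfl ex
        exact h𝒢.unit_mul h ex
      exact h2 _ (by rw [hg'g, e']) _
    · rw [h𝒢.tangent_target_mul, ht0, ← e₁, e']
    · have e₆ : (𝒢.tangent 𝓘(ℝ, EG) 𝓘(ℝ, EP)).source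
          ((𝒢.tangent 𝓘(ℝ, EG) 𝓘(ℝ, EP)).mul ⟨g, 0⟩ ⟨g', 0⟩ e₅) =
          (𝒢.tangent 𝓘(ℝ, EG) 𝓘(ℝ, EP)).target u := by
        rw [h𝒢.tangent_source_mul, e₃]
      rw [← h𝒢.tangent_mul_assoc _ _ _ e₅ e₃ e₆ e₄]
      have h2 : ∀ x (hx : x = (𝒢.tangent 𝓘(ℝ, EG) 𝓘(ℝ, EP)).unit
          ((𝒢.tangent 𝓘(ℝ, EG) 𝓘(ℝ, EP)).target u))
          (ex : (𝒢.tangent 𝓘(ℝ, EG) 𝓘(ℝ, EP)).source x =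
            (𝒢.tangent 𝓘(ℝ, EG) 𝓘(ℝ, EP)).target u),
          (𝒢.tangent 𝓘(ℝ, EG) 𝓘(ℝ, EP)).mul x u ex = u := by
        rintro _ rfl ex
        exact h𝒢.tangent_unit_mul u ex
      refine (h2 _ ?_ _).symm
      rw [h𝒢.tangent_zero_mul_zero e₁, hut', hu0, hgg']
  · rintro ⟨w, ⟨rfl, hwS, hwt⟩, e, rfl⟩
    refine ⟨?_, hsub.mul_mem _ (h0 g) w hwS e, ?_⟩
    · exact 𝒢.mulExt_apply e'
    · rw [h𝒢.tangent_target_mul, ht0, h𝒢.target_mul]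

/-- `S^t(g) = 0_g ⋆ S^t(1_{s(g)})`. -/
theorem fiber_kerTarget_eq (g : G) :
    (S ⊓ 𝒢.kerTarget 𝓘(ℝ, EG) 𝓘(ℝ, EP)).fiber g =
      {u | ∃ w ∈ (S ⊓ 𝒢.kerTarget 𝓘(ℝ, EG) 𝓘(ℝ, EP)).fiber (𝒢.unit (𝒢.source g)), ∃ e,
        u = (𝒢.tangent 𝓘(ℝ, EG) 𝓘(ℝ, EP)).mul ⟨g, 0⟩ w e} := by
  have e' := (h𝒢.target_unit (𝒢.source g)).symm
  have h1 := h𝒢.fiber_kerTarget_mul hmul e'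
  rwa [h𝒢.mul_unit g e'] at h1

omit hmul [IsManifold 𝓘(ℝ, EG) ∞ G] [IsManifold 𝓘(ℝ, EP) ∞ P] in
theorem composable_zero_of_mem_fiber (g : G) {w : TangentBundle 𝓘(ℝ, EG) G}
    (hw : w ∈ (S ⊓ 𝒢.kerTarget 𝓘(ℝ, EG) 𝓘(ℝ, EP)).fiber (𝒢.unit (𝒢.source g))) :
    (𝒢.tangent 𝓘(ℝ, EG) 𝓘(ℝ, EP)).source ⟨g, 0⟩ = (𝒢.tangent 𝓘(ℝ, EG) 𝓘(ℝ, EP)).target w := by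
  rw [(mem_fiber_inf_kerTarget.1 hw).2.2, h𝒢.target_unit]
  exact tangentMap_zero _ _

theorem fiber_kerTarget_eq_image_tangentLeft (g : G) :
    (S ⊓ 𝒢.kerTarget 𝓘(ℝ, EG) 𝓘(ℝ, EP)).fiber g = 𝒢.tangentLeft 𝓘(ℝ, EG) g ''
      (S ⊓ 𝒢.kerTarget 𝓘(ℝ, EG) 𝓘(ℝ, EP)).fiber (𝒢.unit (𝒢.source g)) := by
  rw [h𝒢.fiber_kerTarget_eq hmul g]
  ext u
  constructor
  · rintro ⟨w, hw, e, rfl⟩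
    exact ⟨w, hw, h𝒢.tangentLeft_eq g w e⟩
  · rintro ⟨w, hw, rfl⟩
    have e := h𝒢.composable_zero_of_mem_fiber g hw
    exact ⟨w, hw, e, h𝒢.tangentLeft_eq g w e⟩

theorem fiber_kerSource_eq (g : G) :
    (S ⊓ 𝒢.kerSource 𝓘(ℝ, EG) 𝓘(ℝ, EP)).fiber g =
      {u | ∃ w ∈ (S ⊓ 𝒢.kerSource 𝓘(ℝ, EG) 𝓘(ℝ, EP)).fiber (𝒢.unit (𝒢.target g)), ∃ e,
        u = (𝒢.tangent 𝓘(ℝ, EG) 𝓘(ℝ, EP)).mul w ⟨g, 0⟩ e} := by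
  have h1 := h𝒢.op.fiber_kerTarget_eq (h𝒢.op_isMultiplicative hmul) g
  refine Eq.trans h1 ?_
  ext u
  constructor
  · rintro ⟨w, hw, e, rfl⟩
    exact ⟨w, hw, e.symm, h𝒢.op_tangent_mul _ _ e.symm e⟩
  · rintro ⟨w, hw, e, rfl⟩
    exact ⟨w, hw, e.symm, (h𝒢.op_tangent_mul _ _ e e.symm).symm⟩

theorem fiber_kerSource_eq_image_tangentRight (g : G) :
    (S ⊓ 𝒢.kerSource 𝓘(ℝ, EG) 𝓘(ℝ, EP)).fiber g = 𝒢.tangentRight 𝓘(ℝ, EG) g ''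
      (S ⊓ 𝒢.kerSource 𝓘(ℝ, EG) 𝓘(ℝ, EP)).fiber (𝒢.unit (𝒢.target g)) := by
  rw [h𝒢.fiber_kerSource_eq hmul g]
  ext u
  constructor
  · rintro ⟨w, hw, e, rfl⟩
    exact ⟨w, hw, h𝒢.tangentRight_eq g w e⟩
  · rintro ⟨w, hw, rfl⟩
    have e := (h𝒢.op.composable_zero_of_mem_fiber g hw).symm
    exact ⟨w, hw, e, h𝒢.tangentRight_eq g w e⟩

end Translation

end IsLieGroupoid

end GroupoidOps

/-! ### Ranks and smooth sections of multiplicative distributions -/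

section Pullback

variable {E : Type*} [NormedAddCommGroup E] [NormedSpace ℝ E]
  {E₁ : Type*} [NormedAddCommGroup E₁] [NormedSpace ℝ E₁]
  {H₁ : Type*} [TopologicalSpace H₁] {J₁ : ModelWithCorners ℝ E₁ H₁}
  {E₂ : Type*} [NormedAddCommGroup E₂] [NormedSpace ℝ E₂]
  {H₂ : Type*} [TopologicalSpace H₂] {J₂ : ModelWithCorners ℝ E₂ H₂}
  {M : Type*} [TopologicalSpace M] [ChartedSpace E M] [IsManifold 𝓘(ℝ, E) ∞ M]
  {B : Type*} [TopologicalSpace B] [ChartedSpace H₁ B]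
  {C : Type*} [TopologicalSpace C] [ChartedSpace H₂ C]

theorem SmoothAlongAt.comp {f : B → M} {X : (b : B) → TangentSpace 𝓘(ℝ, E) (f b)} {φ : C → B}
    {c : C} (hX : SmoothAlongAt J₁ f X (φ c)) (hφ : ContMDiffAt J₂ J₁ ∞ φ c) :
    SmoothAlongAt J₂ (f ∘ φ) (fun c => X (φ c)) c :=
  ContMDiffAt.comp c hX hφ

theorem HasSmoothSectionsAlong.comp {f : B → M}
    {S : (b : B) → Submodule ℝ (TangentSpace 𝓘(ℝ, E) (f b))} {φ : C → B}
    (hS : HasSmoothSectionsAlong J₁ f S) (hφ : ContMDiff J₂ J₁ ∞ φ) :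
    HasSmoothSectionsAlong J₂ (f ∘ φ) (fun c => S (φ c)) := by
  intro c₀ v hv
  obtain ⟨X, hX0, hX⟩ := hS (φ c₀) v hv
  refine ⟨fun c => X (φ c), hX0, ?_⟩
  filter_upwards [hφ.continuous.continuousAt.eventually hX] with c hc
  exact ⟨hc.1, hc.2.comp (hφ c)⟩

end Pullback

namespace GroupoidOps

variable {EG : Type*} [NormedAddCommGroup EG] [NormedSpace ℝ EG]
  {EP : Type*} [NormedAddCommGroup EP] [NormedSpace ℝ EP]
  {G : Type*} [TopologicalSpace G] [ChartedSpace EG G] [IsManifold 𝓘(ℝ, EG) ∞ G]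
  {P : Type*} [TopologicalSpace P] [ChartedSpace EP P] [IsManifold 𝓘(ℝ, EP) ∞ P]
  {𝒢 : GroupoidOps G P} {S : TangentDistribution 𝓘(ℝ, EG) G}

namespace IsLieGroupoid

section Units

variable (h𝒢 : 𝒢.IsLieGroupoid 𝓘(ℝ, EG) 𝓘(ℝ, EP))
include h𝒢

/-- The image under `Ts` of a vector field along a local section `τ` of `s` is a vector field on
`P`. -/
theorem smoothAlongAt_mfderiv_source {X : (g : G) → TangentSpace 𝓘(ℝ, EG) g} {τ : P → G} {p : P}
    (hX : SmoothAlongAt 𝓘(ℝ, EG) (id : G → G) X (τ p)) (hτ : ContMDiffAt 𝓘(ℝ, EP) 𝓘(ℝ, EG) ∞ τ p)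
    (hs : ∀ᶠ q in 𝓝 p, 𝒢.source (τ q) = q) :
    SmoothAlongAt 𝓘(ℝ, EP) (id : P → P)
      (fun q => (mfderiv 𝓘(ℝ, EG) 𝓘(ℝ, EP) 𝒢.source (τ q) (X (τ q)) : EP)) p := by
  have h1 : ContMDiff 𝓘(ℝ, EG).tangent 𝓘(ℝ, EP).tangent ∞ (tangentMap 𝓘(ℝ, EG) 𝓘(ℝ, EP) 𝒢.source) :=
    h𝒢.source_submersion.contMDiff.contMDiff_tangentMap (by simp)
  have h2 := (h1 _).comp p (hX.comp hτ)
  refine h2.congr_of_eventuallyEq ?_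
  filter_upwards [hs] with q hq
  exact (TangentBundle.mk_congr hq _).symm

theorem smoothAlongAt_mfderiv_target {X : (p : P) → TangentSpace 𝓘(ℝ, EG) (𝒢.unit p)} {p : P}
    (hX : SmoothAlongAt 𝓘(ℝ, EP) 𝒢.unit X p) :
    SmoothAlongAt 𝓘(ℝ, EP) (id : P → P)
      (fun q => (mfderiv 𝓘(ℝ, EG) 𝓘(ℝ, EP) 𝒢.target (𝒢.unit q) (X q) : EP)) p := by
  have h1 : ContMDiff 𝓘(ℝ, EG).tangent 𝓘(ℝ, EP).tangent ∞ (tangentMap 𝓘(ℝ, EG) 𝓘(ℝ, EP) 𝒢.target) :=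
    h𝒢.target_submersion.contMDiff.contMDiff_tangentMap (by simp)
  have h2 := (h1 _).comp p hX
  exact h2.congr_of_eventuallyEq (Eventually.of_forall fun q =>
    (TangentBundle.mk_congr (h𝒢.target_unit q) _).symm)

theorem smoothAlongAt_mfderiv_unit {Z : (p : P) → TangentSpace 𝓘(ℝ, EP) p} {p : P}
    (hZ : SmoothAlongAt 𝓘(ℝ, EP) (id : P → P) Z p) :
    SmoothAlongAt 𝓘(ℝ, EP) 𝒢.unit (fun q => mfderiv 𝓘(ℝ, EP) 𝓘(ℝ, EG) 𝒢.unit q (Z q)) p := by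
  have h1 : ContMDiff 𝓘(ℝ, EP).tangent 𝓘(ℝ, EG).tangent ∞ (tangentMap 𝓘(ℝ, EP) 𝓘(ℝ, EG) 𝒢.unit) :=
    h𝒢.unit_smooth.contMDiff_tangentMap (by simp)
  exact (h1 _).comp p hZ

omit [IsManifold 𝓘(ℝ, EG) ∞ G] in
theorem injective_mfderiv_unit (p : P) : Injective (mfderiv 𝓘(ℝ, EP) 𝓘(ℝ, EG) 𝒢.unit p) :=
  fun x y hxy => (h𝒢.mfderiv_target_unit p x).symm.trans
    ((congrArg (mfderiv 𝓘(ℝ, EG) 𝓘(ℝ, EP) 𝒢.target (𝒢.unit p)) hxy).trans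
      (h𝒢.mfderiv_target_unit p y))

omit [IsManifold 𝓘(ℝ, EG) ∞ G] in
theorem finrank_inf_tangentUnits [FiniteDimensional ℝ EP] (p : P) :
    Module.finrank ℝ
      (S (𝒢.unit p) ⊓ 𝒢.tangentUnits 𝓘(ℝ, EG) 𝓘(ℝ, EP) p :
        Submodule ℝ (TangentSpace _ (𝒢.unit p))) =
    Module.finrank ℝ (𝒢.interUnits 𝓘(ℝ, EG) 𝓘(ℝ, EP) S p) := by
  have h1 := Submodule.map_comap_eq (mfderiv 𝓘(ℝ, EP) 𝓘(ℝ, EG) 𝒢.unit p).toLinearMap (S (𝒢.unit p))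
  rw [inf_comm] at h1
  change Module.finrank ℝ (S (𝒢.unit p) ⊓
    LinearMap.range (mfderiv 𝓘(ℝ, EP) 𝓘(ℝ, EG) 𝒢.unit p).toLinearMap : Submodule ℝ _) = _
  rw [← h1]
  exact (Submodule.equivMapOfInjective _ (h𝒢.injective_mfderiv_unit p) _).finrank_eq.symm

end Units

section Multiplicative

variable (h𝒢 : 𝒢.IsLieGroupoid 𝓘(ℝ, EG) 𝓘(ℝ, EP))
  (hmul : 𝒢.IsMultiplicative 𝓘(ℝ, EG) 𝓘(ℝ, EP) S)
include h𝒢 hmul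

section Sections

variable (hS : IsSmoothSubbundle 𝓘(ℝ, EG) S)
include hS

omit hmul [IsManifold 𝓘(ℝ, EP) ∞ P] in
theorem hasSmoothSectionsAlong_unit :
    HasSmoothSectionsAlong 𝓘(ℝ, EP) 𝒢.unit (fun p => S (𝒢.unit p)) :=
  (IsSmoothSubbundleAlong.hasSmoothSectionsAlong hS contMDiff_id).comp h𝒢.unit_smooth

/-- `Tt` maps sections of `S|_P` to sections of `S ∩ TP`. -/
theorem hasSmoothSectionsAlong_interUnits :
    HasSmoothSectionsAlong 𝓘(ℝ, EP) (id : P → P) (𝒢.interUnits 𝓘(ℝ, EG) 𝓘(ℝ, EP) S) := by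
  intro p₀ v hv
  obtain ⟨X, hX0, hX⟩ := h𝒢.hasSmoothSectionsAlong_unit hS p₀ _ hv
  refine ⟨fun q => (mfderiv 𝓘(ℝ, EG) 𝓘(ℝ, EP) 𝒢.target (𝒢.unit q) (X q) : EP), ?_, ?_⟩
  · simp only [hX0]
    exact h𝒢.mfderiv_target_unit p₀ v
  · filter_upwards [hX] with p hp
    exact ⟨h𝒢.mfderiv_target_unit_mem hmul p hp.1, h𝒢.smoothAlongAt_mfderiv_target hp.2⟩

theorem hasSmoothSectionsAlong_inf_tangentUnits :
    HasSmoothSectionsAlong 𝓘(ℝ, EP) 𝒢.unit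
      (fun p => S (𝒢.unit p) ⊓ 𝒢.tangentUnits 𝓘(ℝ, EG) 𝓘(ℝ, EP) p) := by
  rintro p₀ _ ⟨hv, ⟨x, rfl⟩⟩
  obtain ⟨Z, hZ0, hZ⟩ := h𝒢.hasSmoothSectionsAlong_interUnits hmul hS p₀ x hv
  refine ⟨fun q => mfderiv 𝓘(ℝ, EP) 𝓘(ℝ, EG) 𝒢.unit q (Z q), ?_, ?_⟩
  · simp only [hZ0]
    rfl
  · filter_upwards [hZ] with p hp
    exact ⟨⟨hp.1, ⟨_, rfl⟩⟩, h𝒢.smoothAlongAt_mfderiv_unit hp.2⟩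

/-- Subtracting from a section of `S|_P` its projection to `S ∩ TP` gives a section of `S ∩ AG`. -/
theorem hasSmoothSectionsAlong_inf_algebroid :
    HasSmoothSectionsAlong 𝓘(ℝ, EP) 𝒢.unit
      (fun p => S (𝒢.unit p) ⊓ 𝒢.algebroid 𝓘(ℝ, EG) 𝓘(ℝ, EP) p) := by
  rintro p₀ v ⟨hv, hvt⟩
  have hvt' : mfderiv 𝓘(ℝ, EG) 𝓘(ℝ, EP) 𝒢.target (𝒢.unit p₀) v = 0 := hvt
  obtain ⟨X, hX0, hX⟩ := h𝒢.hasSmoothSectionsAlong_unit hS p₀ v hv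
  let Y : (p : P) → TangentSpace 𝓘(ℝ, EG) (𝒢.unit p) := fun p =>
    mfderiv 𝓘(ℝ, EP) 𝓘(ℝ, EG) 𝒢.unit p
      (mfderiv 𝓘(ℝ, EG) 𝓘(ℝ, EP) 𝒢.target (𝒢.unit p) (X p) : EP)
  refine ⟨fun p => X p - Y p, ?_, ?_⟩
  · simp only [Y, hX0, hvt']
    refine Eq.trans (congrArg (fun w => v - w) (map_zero _)) (sub_zero v)
  · filter_upwards [hX] with p hp
    refine ⟨⟨Submodule.sub_mem _ hp.1 (h𝒢.mfderiv_target_unit_mem hmul p hp.1), ?_⟩,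
      hp.2.sub (h𝒢.smoothAlongAt_mfderiv_unit (h𝒢.smoothAlongAt_mfderiv_target hp.2))⟩
    change mfderiv 𝓘(ℝ, EG) 𝓘(ℝ, EP) 𝒢.target (𝒢.unit p) (X p - Y p) = 0
    rw [map_sub, sub_eq_zero]
    exact (h𝒢.mfderiv_target_unit p _).symm

/-- Left translation by the zero vectors moves smooth sections of `S ∩ AG` to smooth sections of
`S^t`. -/
theorem hasSmoothSectionsAlong_inf_kerTarget :
    HasSmoothSectionsAlong 𝓘(ℝ, EG) (id : G → G) (S ⊓ 𝒢.kerTarget 𝓘(ℝ, EG) 𝓘(ℝ, EP)) := by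
  intro g₀ v hv
  have hv' : (⟨g₀, v⟩ : TangentBundle 𝓘(ℝ, EG) G) ∈
      (S ⊓ 𝒢.kerTarget 𝓘(ℝ, EG) 𝓘(ℝ, EP)).fiber g₀ := ⟨rfl, hv⟩
  rw [h𝒢.fiber_kerTarget_eq hmul g₀] at hv'
  obtain ⟨⟨w₁, w⟩, ⟨hw₁, hw⟩, e₀, hvw⟩ := hv'
  change w₁ = 𝒢.unit (𝒢.source g₀) at hw₁
  subst hw₁
  obtain ⟨W, hW0, hW⟩ := h𝒢.hasSmoothSectionsAlong_inf_algebroid hmul hS (𝒢.source g₀) w hw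
  obtain ⟨K, hK, hKeq⟩ := h𝒢.exists_smooth_extension_tangent_mul _ _ e₀
  let z : G → TangentBundle 𝓘(ℝ, EG) G := fun g => ⟨g, 0⟩
  let u : G → TangentBundle 𝓘(ℝ, EG) G := fun g => ⟨𝒢.unit (𝒢.source g), W (𝒢.source g)⟩
  have hW' := h𝒢.source_submersion.contMDiff.continuous.continuousAt.eventually hW
  have hz : ∀ g, ContMDiffAt 𝓘(ℝ, EG) 𝓘(ℝ, EG).tangent ∞ z g := fun g =>
    smoothAlongAt_zero (f := (id : G → G)) contMDiffAt_id
  have hu : ∀ᶠ g in 𝓝 g₀, ContMDiffAt 𝓘(ℝ, EG) 𝓘(ℝ, EG).tangent ∞ u g := by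
    filter_upwards [hW'] with g hg
    exact hg.2.comp (h𝒢.source_submersion.contMDiff g)
  have hq : ContinuousAt (fun g => (z g, u g)) g₀ :=
    (hz g₀).continuousAt.prodMk hu.self_of_nhds.continuousAt
  have hq0 : (z g₀, u g₀) = (⟨g₀, 0⟩, ⟨𝒢.unit (𝒢.source g₀), w⟩) := by simp only [z, u, hW0]
  rw [ContinuousAt, hq0] at hq
  have hmem : ∀ᶠ g in 𝓝 g₀, u g ∈
      (S ⊓ 𝒢.kerTarget 𝓘(ℝ, EG) 𝓘(ℝ, EP)).fiber (𝒢.unit (𝒢.source g)) := by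
    filter_upwards [hW'] with g hg
    exact ⟨rfl, hg.1⟩
  have hprod : ∀ᶠ g in 𝓝 g₀,
      K (z g, u g) ∈ (S ⊓ 𝒢.kerTarget 𝓘(ℝ, EG) 𝓘(ℝ, EP)).fiber g := by
    filter_upwards [hmem, hq hKeq] with g h1 h2
    have e := h𝒢.composable_zero_of_mem_fiber g h1
    rw [h𝒢.fiber_kerTarget_eq hmul g]
    exact ⟨_, h1, e, (h2 e).symm⟩
  -- near `g₀` the section is `g ↦ 0_g ⋆ W(s(g))`
  refine ⟨fun g => ((K (z g, u g)).snd : EG), ?_, ?_⟩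
  · have h1 := hKeq.self_of_nhds e₀
    have h2 : K (z g₀, u g₀) = ⟨g₀, v⟩ := by rw [hq0, ← h1, ← hvw]
    exact TangentBundle.snd_congr h2
  · filter_upwards [hprod.eventually_nhds, hq.eventually hK, hu] with g h1 h2 h3
    obtain ⟨h4, h5⟩ := h1.self_of_nhds
    have h6 : ∀ᶠ g' in 𝓝 g, (⟨g', ((K (z g', u g')).snd : EG)⟩ : TangentBundle 𝓘(ℝ, EG) G) =
        K (z g', u g') := by
      filter_upwards [h1] with g' hg'
      exact TangentBundle.mk_congr hg'.1.symm _
    refine ⟨?_, ?_⟩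
    · have h7 : (⟨g, ((K (z g, u g)).snd : EG)⟩ : TangentBundle 𝓘(ℝ, EG) G) ∈
          (S ⊓ 𝒢.kerTarget 𝓘(ℝ, EG) 𝓘(ℝ, EP)).total := by
        rw [h6.self_of_nhds]
        exact h5
      exact h7
    · exact ContMDiffAt.congr_of_eventuallyEq (h2.comp g ((hz g).prodMk h3)) h6

end Sections

section Ranks

variable [FiniteDimensional ℝ EG] [FiniteDimensional ℝ EP] {k : ℕ}
  (hk : ∀ g, Module.finrank ℝ (S g) = k)
include hk

omit [IsManifold 𝓘(ℝ, EG) ∞ G] in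
theorem finrank_interUnits_add (p : P) :
    Module.finrank ℝ (𝒢.interUnits 𝓘(ℝ, EG) 𝓘(ℝ, EP) S p) + Module.finrank ℝ
      (S (𝒢.unit p) ⊓ 𝒢.algebroid 𝓘(ℝ, EG) 𝓘(ℝ, EP) p : Submodule ℝ (TangentSpace _ (𝒢.unit p))) =
      k := by
  obtain ⟨h1, h2⟩ := h𝒢.disjoint_and_sup_eq hmul p
  have h3 := Submodule.finrank_sup_add_finrank_inf_eq
    (S (𝒢.unit p) ⊓ 𝒢.tangentUnits 𝓘(ℝ, EG) 𝓘(ℝ, EP) p)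
    (S (𝒢.unit p) ⊓ 𝒢.algebroid 𝓘(ℝ, EG) 𝓘(ℝ, EP) p)
  rw [h2, h1.eq_bot, finrank_bot, hk, h𝒢.finrank_inf_tangentUnits] at h3
  omega

omit hk [FiniteDimensional ℝ EP] in
/-- `S^t(g ⋆ h)` is the image of `S^t(h)` under the multiplication by `0_g`, which is linear. -/
theorem finrank_inf_kerTarget_mul_le {g h : G} (e' : 𝒢.source g = 𝒢.target h) :
    Module.finrank ℝ ((S ⊓ 𝒢.kerTarget 𝓘(ℝ, EG) 𝓘(ℝ, EP)) (𝒢.mul g h e') :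
        Submodule ℝ (TangentSpace 𝓘(ℝ, EG) (𝒢.mul g h e'))) ≤
      Module.finrank ℝ ((S ⊓ 𝒢.kerTarget 𝓘(ℝ, EG) 𝓘(ℝ, EP)) h :
        Submodule ℝ (TangentSpace 𝓘(ℝ, EG) h)) := by
  let D : EG →ₗ[ℝ] EG := (mfderivWithin (𝓘(ℝ, EG).prod 𝓘(ℝ, EG)) 𝓘(ℝ, EG) 𝒢.mulExt 𝒢.composable
    (g, h)).toLinearMap ∘ₗ LinearMap.inr ℝ EG EG
  let A : Submodule ℝ EG := (S ⊓ 𝒢.kerTarget 𝓘(ℝ, EG) 𝓘(ℝ, EP)) (𝒢.mul g h e')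
  let C : Submodule ℝ EG := (S ⊓ 𝒢.kerTarget 𝓘(ℝ, EG) 𝓘(ℝ, EP)) h
  have h1 : A ≤ C.map D := by
    intro v hv
    have h2 : (⟨𝒢.mul g h e', v⟩ : TangentBundle 𝓘(ℝ, EG) G) ∈
      (S ⊓ 𝒢.kerTarget 𝓘(ℝ, EG) 𝓘(ℝ, EP)).fiber (𝒢.mul g h e') := ⟨rfl, hv⟩
    rw [h𝒢.fiber_kerTarget_mul hmul e'] at h2
    obtain ⟨⟨w₁, w⟩, ⟨hw₁, hw⟩, e, hvw⟩ := h2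
    change w₁ = h at hw₁
    subst hw₁
    exact ⟨w, hw, (TangentBundle.snd_congr hvw).symm⟩
  exact (Submodule.finrank_mono h1).trans (Submodule.finrank_map_le D C)

omit hk [FiniteDimensional ℝ EP] in
/-- Multiplication by `0_g` and by `0_{g⁻¹}` shows that the ranks of `S^t` at `g` and `1_{s(g)}`
bound each other. -/
theorem finrank_inf_kerTarget_unit (g : G) :
    Module.finrank ℝ ((S ⊓ 𝒢.kerTarget 𝓘(ℝ, EG) 𝓘(ℝ, EP)) g :
        Submodule ℝ (TangentSpace 𝓘(ℝ, EG) g)) =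
      Module.finrank ℝ ((S ⊓ 𝒢.kerTarget 𝓘(ℝ, EG) 𝓘(ℝ, EP)) (𝒢.unit (𝒢.source g)) :
        Submodule ℝ (TangentSpace 𝓘(ℝ, EG) (𝒢.unit (𝒢.source g)))) := by
  obtain ⟨g', e₁, e₂, -, hg'g⟩ := h𝒢.exists_inv g
  have e := (h𝒢.target_unit (𝒢.source g)).symm
  have h1 := h𝒢.finrank_inf_kerTarget_mul_le hmul e
  have h2 := h𝒢.finrank_inf_kerTarget_mul_le hmul e₂
  rw [h𝒢.mul_unit g e] at h1
  rw [hg'g] at h2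
  exact le_antisymm h1 h2

theorem finrank_interUnits_source_add (g : G) :
    Module.finrank ℝ (𝒢.interUnits 𝓘(ℝ, EG) 𝓘(ℝ, EP) S (𝒢.source g)) + Module.finrank ℝ
      ((S ⊓ 𝒢.kerTarget 𝓘(ℝ, EG) 𝓘(ℝ, EP)) g : Submodule ℝ (TangentSpace 𝓘(ℝ, EG) g)) = k := by
  rw [h𝒢.finrank_inf_kerTarget_unit hmul]
  exact h𝒢.finrank_interUnits_add hmul hk _

theorem finrank_interUnits_target_add (g : G) :
    Module.finrank ℝ (𝒢.interUnits 𝓘(ℝ, EG) 𝓘(ℝ, EP) S (𝒢.target g)) + Module.finrank ℝ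
      ((S ⊓ 𝒢.kerSource 𝓘(ℝ, EG) 𝓘(ℝ, EP)) g : Submodule ℝ (TangentSpace 𝓘(ℝ, EG) g)) = k :=
  h𝒢.op.finrank_interUnits_source_add (h𝒢.op_isMultiplicative hmul) hk g

omit hk [FiniteDimensional ℝ EG] [FiniteDimensional ℝ EP] [IsManifold 𝓘(ℝ, EG) ∞ G] in
theorem map_source_le (g : G) :
    ((S g).map (mfderiv 𝓘(ℝ, EG) 𝓘(ℝ, EP) 𝒢.source g).toLinearMap) ≤
      𝒢.interUnits 𝓘(ℝ, EG) 𝓘(ℝ, EP) S (𝒢.source g) := by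
  rintro _ ⟨v, hv, rfl⟩
  exact h𝒢.mfderiv_source_mem hmul g hv

/-- The kernel of `Ts` on `S(g)` is `S^s(g)`, whose rank depends on that of `S ∩ TP` at `t(g)`. -/
theorem finrank_map_source (g : G) :
    Module.finrank ℝ ((S g).map (mfderiv 𝓘(ℝ, EG) 𝓘(ℝ, EP) 𝒢.source g).toLinearMap) =
      Module.finrank ℝ (𝒢.interUnits 𝓘(ℝ, EG) 𝓘(ℝ, EP) S (𝒢.target g)) := by
  have h1 := Submodule.finrank_map_add_finrank_inf_ker
    (mfderiv 𝓘(ℝ, EG) 𝓘(ℝ, EP) 𝒢.source g).toLinearMap (S g)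
  rw [hk] at h1
  have h2 := h𝒢.finrank_interUnits_target_add hmul hk g
  exact Nat.add_right_cancel (h1.trans h2.symm)

theorem finrank_interUnits_target_le (g : G) :
    Module.finrank ℝ (𝒢.interUnits 𝓘(ℝ, EG) 𝓘(ℝ, EP) S (𝒢.target g)) ≤
      Module.finrank ℝ (𝒢.interUnits 𝓘(ℝ, EG) 𝓘(ℝ, EP) S (𝒢.source g)) := by
  rw [← h𝒢.finrank_map_source hmul hk]
  exact Submodule.finrank_mono (h𝒢.map_source_le hmul g)

theorem finrank_interUnits_source_eq_target (g : G) :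
    Module.finrank ℝ (𝒢.interUnits 𝓘(ℝ, EG) 𝓘(ℝ, EP) S (𝒢.source g)) =
      Module.finrank ℝ (𝒢.interUnits 𝓘(ℝ, EG) 𝓘(ℝ, EP) S (𝒢.target g)) :=
  le_antisymm (h𝒢.op.finrank_interUnits_target_le (h𝒢.op_isMultiplicative hmul) hk g)
    (h𝒢.finrank_interUnits_target_le hmul hk g)

/-- `Ts` maps `S(g)` onto `(S ∩ TP)(s(g))`. -/
theorem map_source_eq (g : G) :
    ((S g).map (mfderiv 𝓘(ℝ, EG) 𝓘(ℝ, EP) 𝒢.source g).toLinearMap) =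
      𝒢.interUnits 𝓘(ℝ, EG) 𝓘(ℝ, EP) S (𝒢.source g) :=
  Submodule.eq_of_le_of_finrank_eq (h𝒢.map_source_le hmul g)
    ((h𝒢.finrank_map_source hmul hk g).trans
      (h𝒢.finrank_interUnits_source_eq_target hmul hk g).symm)

variable (hS : IsSmoothSubbundle 𝓘(ℝ, EG) S)
include hS

theorem isSmoothSubbundleAlong_inf_tangentUnits :
    IsSmoothSubbundleAlong 𝓘(ℝ, EG) 𝓘(ℝ, EP) 𝒢.unit
      (fun p => S (𝒢.unit p) ⊓ 𝒢.tangentUnits 𝓘(ℝ, EG) 𝓘(ℝ, EP) p) :=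
  (h𝒢.hasSmoothSectionsAlong_inf_tangentUnits hmul hS).isSmoothSubbundleAlong_of_finrank_add
    (h𝒢.hasSmoothSectionsAlong_inf_algebroid hmul hS) h𝒢.unit_smooth (k := k) fun p => by
      rw [h𝒢.finrank_inf_tangentUnits]
      exact h𝒢.finrank_interUnits_add hmul hk p

theorem isSmoothSubbundleAlong_inf_algebroid :
    IsSmoothSubbundleAlong 𝓘(ℝ, EG) 𝓘(ℝ, EP) 𝒢.unit
      (fun p => S (𝒢.unit p) ⊓ 𝒢.algebroid 𝓘(ℝ, EG) 𝓘(ℝ, EP) p) :=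
  (h𝒢.hasSmoothSectionsAlong_inf_algebroid hmul hS).isSmoothSubbundleAlong_of_finrank_add
    (h𝒢.hasSmoothSectionsAlong_inf_tangentUnits hmul hS) h𝒢.unit_smooth (k := k) fun p => by
      rw [h𝒢.finrank_inf_tangentUnits, add_comm]
      exact h𝒢.finrank_interUnits_add hmul hk p

theorem eventually_finrank_interUnits_eq (p₀ : P) : ∀ᶠ p in 𝓝 p₀,
    Module.finrank ℝ (𝒢.interUnits 𝓘(ℝ, EG) 𝓘(ℝ, EP) S p) =
      Module.finrank ℝ (𝒢.interUnits 𝓘(ℝ, EG) 𝓘(ℝ, EP) S p₀) := by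
  filter_upwards [(h𝒢.isSmoothSubbundleAlong_inf_tangentUnits hmul hk hS).eventually_finrank_eq p₀]
    with p hp
  rwa [h𝒢.finrank_inf_tangentUnits, h𝒢.finrank_inf_tangentUnits] at hp

theorem isSmoothSubbundle_interUnits :
    IsSmoothSubbundle 𝓘(ℝ, EP) (𝒢.interUnits 𝓘(ℝ, EG) 𝓘(ℝ, EP) S) :=
  (h𝒢.hasSmoothSectionsAlong_interUnits hmul hS).isSmoothSubbundleAlong contMDiff_id fun p₀ =>
    (h𝒢.eventually_finrank_interUnits_eq hmul hk hS p₀).mono fun _ h => h.le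

theorem isSmoothSubbundle_inf_kerTarget :
    IsSmoothSubbundle 𝓘(ℝ, EG) (S ⊓ 𝒢.kerTarget 𝓘(ℝ, EG) 𝓘(ℝ, EP)) := by
  refine (h𝒢.hasSmoothSectionsAlong_inf_kerTarget hmul hS).isSmoothSubbundleAlong contMDiff_id
    fun g₀ => ?_
  filter_upwards [h𝒢.source_submersion.contMDiff.continuous.continuousAt.eventually
    (h𝒢.eventually_finrank_interUnits_eq hmul hk hS (𝒢.source g₀))] with g hg
  have h1 := h𝒢.finrank_interUnits_source_add hmul hk g
  have h2 := h𝒢.finrank_interUnits_source_add hmul hk g₀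
  rw [hg] at h1
  exact (Nat.add_left_cancel (h1.trans h2.symm)).le

theorem isSmoothSubbundle_inf_kerSource :
    IsSmoothSubbundle 𝓘(ℝ, EG) (S ⊓ 𝒢.kerSource 𝓘(ℝ, EG) 𝓘(ℝ, EP)) :=
  h𝒢.op.isSmoothSubbundle_inf_kerTarget (h𝒢.op_isMultiplicative hmul) hk hS

/-- The rank of `S ∩ TP` is a locally constant function which is constant along the orbits. -/
theorem exists_finrank_interUnits_eq (hconn : 𝒢.IsOrbitConnected) :
    ∃ r : ℕ, ∀ p, Module.finrank ℝ (𝒢.interUnits 𝓘(ℝ, EG) 𝓘(ℝ, EP) S p) = r := by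
  by_cases hP : Nonempty P
  · obtain ⟨p₀⟩ := hP
    let d : P → ℕ := fun p => Module.finrank ℝ (𝒢.interUnits 𝓘(ℝ, EG) 𝓘(ℝ, EP) S p)
    have hd : IsLocallyConstant d :=
      (IsLocallyConstant.iff_eventually_eq d).2 (h𝒢.eventually_finrank_interUnits_eq hmul hk hS)
    have hinv : ∀ g, 𝒢.source g ∈ d ⁻¹' {d p₀} ↔ 𝒢.target g ∈ d ⁻¹' {d p₀} := fun g => by
      simp only [mem_preimage, d, h𝒢.finrank_interUnits_source_eq_target hmul hk g]
    rcases hconn _ (hd.isClopen_fiber (d p₀)) hinv with h | h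
    · exact absurd (h.subset rfl : p₀ ∈ (∅ : Set P)) (notMem_empty p₀)
    · exact ⟨d p₀, fun p => h.superset (mem_univ p)⟩
  · exact ⟨0, fun p => absurd ⟨p⟩ hP⟩

theorem exists_finrank_inf_kerTarget_eq (hconn : 𝒢.IsOrbitConnected) :
    ∃ a : ℕ, ∀ g, Module.finrank ℝ ((S ⊓ 𝒢.kerTarget 𝓘(ℝ, EG) 𝓘(ℝ, EP)) g :
      Submodule ℝ (TangentSpace 𝓘(ℝ, EG) g)) = a := by
  obtain ⟨r, hr⟩ := h𝒢.exists_finrank_interUnits_eq hmul hk hS hconn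
  refine ⟨k - r, fun g => ?_⟩
  have h1 := h𝒢.finrank_interUnits_source_add hmul hk g
  rw [hr] at h1
  omega

theorem exists_finrank_inf_kerSource_eq (hconn : 𝒢.IsOrbitConnected) :
    ∃ a : ℕ, ∀ g, Module.finrank ℝ ((S ⊓ 𝒢.kerSource 𝓘(ℝ, EG) 𝓘(ℝ, EP)) g :
      Submodule ℝ (TangentSpace 𝓘(ℝ, EG) g)) = a := by
  obtain ⟨r, hr⟩ := h𝒢.exists_finrank_interUnits_eq hmul hk hS hconn
  refine ⟨k - r, fun g => ?_⟩
  have h1 := h𝒢.finrank_interUnits_target_add hmul hk g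
  rw [hr] at h1
  omega

end Ranks

end Multiplicative

end IsLieGroupoid

end GroupoidOps

/-! ### The Lie groupoid structure of a multiplicative distribution -/

namespace GroupoidOps.IsLieGroupoid

variable {EG : Type*} [NormedAddCommGroup EG] [NormedSpace ℝ EG]
  {EP : Type*} [NormedAddCommGroup EP] [NormedSpace ℝ EP]
  {G : Type*} [TopologicalSpace G] [ChartedSpace EG G] [IsManifold 𝓘(ℝ, EG) ∞ G]
  {P : Type*} [TopologicalSpace P] [ChartedSpace EP P] [IsManifold 𝓘(ℝ, EP) ∞ P]
  {𝒢 : GroupoidOps G P} {S : TangentDistribution 𝓘(ℝ, EG) G}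
  (h𝒢 : 𝒢.IsLieGroupoid 𝓘(ℝ, EG) 𝓘(ℝ, EP))
include h𝒢

/-- Through every vector of `S` there is a local smooth section of `Ts : S → S ∩ TP`. It is built
along a local section `τ` of `s` from sections `V j` of `S` whose images `Y j = Ts ∘ V j ∘ τ` form a
frame of `S ∩ TP`, and a section `W` of `S^s` which corrects its value at the given vector. -/
theorem exists_local_section_tangent_source [FiniteDimensional ℝ EG] [FiniteDimensional ℝ EP]
    (hmul : 𝒢.IsMultiplicative 𝓘(ℝ, EG) 𝓘(ℝ, EP) S)
    {k : ℕ} (hk : ∀ g, Module.finrank ℝ (S g) = k) (hS : IsSmoothSubbundle 𝓘(ℝ, EG) S) {r : ℕ}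
    (hr : ∀ p, Module.finrank ℝ (𝒢.interUnits 𝓘(ℝ, EG) 𝓘(ℝ, EP) S p) = r)
    {v₀ : TangentBundle 𝓘(ℝ, EG) G} (hv₀ : v₀ ∈ S.total) :
    ∃ σ : TangentBundle 𝓘(ℝ, EP) P → TangentBundle 𝓘(ℝ, EG) G,
      σ ((𝒢.tangent 𝓘(ℝ, EG) 𝓘(ℝ, EP)).source v₀) = v₀ ∧
      ContMDiffAt 𝓘(ℝ, EP).tangent 𝓘(ℝ, EG).tangent ∞ σ
        ((𝒢.tangent 𝓘(ℝ, EG) 𝓘(ℝ, EP)).source v₀) ∧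
      ∀ᶠ b in 𝓝 ((𝒢.tangent 𝓘(ℝ, EG) 𝓘(ℝ, EP)).source v₀),
        b ∈ (𝒢.interUnits 𝓘(ℝ, EG) 𝓘(ℝ, EP) S).total →
          σ b ∈ S.total ∧ (𝒢.tangent 𝓘(ℝ, EG) 𝓘(ℝ, EP)).source (σ b) = b := by
  obtain ⟨g₀, v⟩ := v₀
  have hv : v ∈ S g₀ := hv₀
  set p₀ := 𝒢.source g₀ with hp₀
  -- a local section of the source map of `G`
  obtain ⟨σ, O, hO, hxO, hσ, hσ1, hσ2⟩ :=
    (h𝒢.source_submersion.isSubmersionAt g₀).exists_slide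
  let τ : P → G := fun p => σ (g₀, p)
  have hτ0 : τ p₀ = g₀ := hσ2 g₀ hxO
  have hO' : ∀ᶠ p in 𝓝 p₀, (g₀, p) ∈ O :=
    (hO.preimage (Continuous.prodMk_right g₀)).mem_nhds hxO
  have hτ : ∀ᶠ p in 𝓝 p₀, ContMDiffAt 𝓘(ℝ, EP) 𝓘(ℝ, EG) ∞ τ p := by
    filter_upwards [hO'] with p hp
    exact (hσ.contMDiffAt (hO.mem_nhds hp)).comp p (contMDiffAt_const.prodMk contMDiffAt_id)
  have hτs : ∀ᶠ p in 𝓝 p₀, 𝒢.source (τ p) = p := by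
    filter_upwards [hO'] with p hp
    exact hσ1 _ hp
  have hτc : Tendsto τ (𝓝 p₀) (𝓝 g₀) := by
    have := hτ.self_of_nhds.continuousAt
    rwa [ContinuousAt, hτ0] at this
  -- smooth sections of `S` over a basis of `(S ∩ TP)(p₀)`
  let bs := Module.finBasisOfFinrankEq ℝ (𝒢.interUnits 𝓘(ℝ, EG) 𝓘(ℝ, EP) S p₀) (hr p₀)
  let y : Fin r → TangentSpace 𝓘(ℝ, EP) p₀ := fun j => bs j
  have hpre : ∀ j, ∃ w ∈ S g₀, mfderiv 𝓘(ℝ, EG) 𝓘(ℝ, EP) 𝒢.source g₀ w = y j := by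
    intro j
    have h1 : y j ∈ 𝒢.interUnits 𝓘(ℝ, EG) 𝓘(ℝ, EP) S (𝒢.source g₀) := (bs j).2
    rw [← h𝒢.map_source_eq hmul hk g₀] at h1
    exact h1
  choose w hwS hwbs using hpre
  choose V hV0 hV using fun j =>
    IsSmoothSubbundleAlong.hasSmoothSectionsAlong hS contMDiff_id g₀ (w j) (hwS j)
  have hVτ : ∀ᶠ p in 𝓝 p₀, ∀ j, V j (τ p) ∈ S (τ p) ∧
      SmoothAlongAt 𝓘(ℝ, EG) (id : G → G) (V j) (τ p) := hτc.eventually (eventually_all.2 hV)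
  let Y : Fin r → (p : P) → TangentSpace 𝓘(ℝ, EP) p := fun j p =>
    (mfderiv 𝓘(ℝ, EG) 𝓘(ℝ, EP) 𝒢.source (τ p) (V j (τ p)) : EP)
  have hY0 : ∀ j, Y j p₀ = y j := by
    intro j
    have h1 : ∀ g, g = g₀ →
        (mfderiv 𝓘(ℝ, EG) 𝓘(ℝ, EP) 𝒢.source g (V j g) : EP) = y j := by
      rintro _ rfl
      rw [hV0]
      exact hwbs j
    exact h1 _ hτ0
  have hYs : ∀ j, ∀ᶠ p in 𝓝 p₀, SmoothAlongAt 𝓘(ℝ, EP) (id : P → P) (Y j) p := by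
    intro j
    filter_upwards [hVτ, hτ, hτs.eventually_nhds] with p h1 h2 h3
    exact h𝒢.smoothAlongAt_mfderiv_source (h1 j).2 h2 h3
  have hYm : ∀ᶠ p in 𝓝 p₀, ∀ j, Y j p ∈ 𝒢.interUnits 𝓘(ℝ, EG) 𝓘(ℝ, EP) S p := by
    filter_upwards [hVτ, hτs] with p h1 h2 j
    have h3 : (⟨𝒢.source (τ p), Y j p⟩ : TangentBundle 𝓘(ℝ, EP) P) ∈
      (𝒢.interUnits 𝓘(ℝ, EG) 𝓘(ℝ, EP) S).total := h𝒢.mfderiv_source_mem hmul (τ p) (h1 j).1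
    change (⟨p, Y j p⟩ : TangentBundle 𝓘(ℝ, EP) P) ∈ (𝒢.interUnits 𝓘(ℝ, EG) 𝓘(ℝ, EP) S).total
    exact mem_of_eq_of_mem (TangentBundle.mk_congr h2 _).symm h3
  have hli0 : LinearIndependent ℝ (fun j => Y j p₀) := by
    simp_rw [hY0]
    exact bs.linearIndependent.map' (Submodule.subtype _) (Submodule.ker_subtype _)
  have hli := eventually_linearIndependent (f := (id : P → P)) contMDiffAt_id
    (fun j => (hYs j).self_of_nhds) hli0
  -- the coordinates of the vectors of `S ∩ TP` in the frame `Y`, as smooth functions on `TP`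
  obtain ⟨U, Ψ, z, hU, hpU, hΨs, -, hΨ, -, -, hz, hΨl⟩ := exists_adapted_trivialization hYs hli0
  obtain ⟨L, hL⟩ := (Fintype.linearCombination ℝ z).exists_leftInverse_of_injective
    (LinearMap.ker_eq_bot.2 hz.fintypeLinearCombination_injective)
  let β : Fin r → TangentBundle 𝓘(ℝ, EP) P → ℝ := fun j b => L (Ψ b).2 j
  let b₀ : TangentBundle 𝓘(ℝ, EP) P := (𝒢.tangent 𝓘(ℝ, EG) 𝓘(ℝ, EP)).source ⟨g₀, v⟩
  have hb₀ : b₀ ∈ Ψ.source := by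
    rw [hΨs]
    exact hpU
  have hβ : ∀ j, ContMDiffAt 𝓘(ℝ, EP).tangent 𝓘(ℝ, ℝ) ∞ (β j) b₀ := by
    intro j
    let Lj : EP →L[ℝ] ℝ := (LinearMap.proj j ∘ₗ L).toContinuousLinearMap
    have h1 := hΨ.contMDiffAt (Ψ.open_source.mem_nhds hb₀)
    exact (Lj.contDiff.contMDiff (n := ∞) _).comp b₀ h1.snd
  have hβY : ∀ᶠ p in 𝓝 p₀, ∀ x ∈ 𝒢.interUnits 𝓘(ℝ, EG) 𝓘(ℝ, EP) S p,
      ∑ j, β j ⟨p, x⟩ • Y j p = x := by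
    filter_upwards [hU.mem_nhds hpU, hli, hYm] with p h1 h2 h3 x hx
    have hspan : Submodule.span ℝ (range fun j => Y j p) =
        𝒢.interUnits 𝓘(ℝ, EG) 𝓘(ℝ, EP) S p := by
      refine Submodule.eq_of_le_of_finrank_eq ?_ ?_
      · rw [Submodule.span_le]
        rintro _ ⟨j, rfl⟩
        exact h3 j
      · refine (finrank_span_eq_card h2).trans ?_
        rw [hr, Fintype.card_fin]
    rw [← hspan, Submodule.mem_span_range_iff_exists_fun] at hx
    obtain ⟨c, rfl⟩ := hx
    obtain ⟨hlin, hz'⟩ := hΨl p h1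
    have h4 : (Ψ ⟨p, ∑ j, c j • Y j p⟩).2 = Fintype.linearCombination ℝ z c := by
      have h5 := map_sum (hlin.mk' _) (fun j => c j • Y j p) Finset.univ
      simp only [map_smul, IsLinearMap.mk'_apply, hz'] at h5
      rw [h5, Fintype.linearCombination_apply]
    have h6 : ∀ j, β j ⟨p, ∑ j, c j • Y j p⟩ = c j := fun j => by
      simp only [β, h4]
      exact congrFun (LinearMap.congr_fun hL c) j
    simp only [h6]
  -- the combination of the `V j` with these coordinates differs from `v` by an element of `S^s`
  have hker : v - ∑ j, β j b₀ • w j ∈ (S ⊓ 𝒢.kerSource 𝓘(ℝ, EG) 𝓘(ℝ, EP)) g₀ := by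
    refine ⟨Submodule.sub_mem _ hv
      (Submodule.sum_mem _ fun j _ => Submodule.smul_mem _ _ (hwS j)), ?_⟩
    change mfderiv 𝓘(ℝ, EG) 𝓘(ℝ, EP) 𝒢.source g₀ (v - ∑ j, β j b₀ • w j) = 0
    rw [map_sub, map_sum, sub_eq_zero]
    have h1 := hβY.self_of_nhds _ (h𝒢.mfderiv_source_mem hmul g₀ hv)
    refine h1.symm.trans (Finset.sum_congr rfl fun j _ => ?_)
    rw [map_smul, hY0]
    exact congrArg (fun y : EP => β j b₀ • y) (hwbs j).symm
  obtain ⟨W, hW0, hW⟩ := h𝒢.op.hasSmoothSectionsAlong_inf_kerTarget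
    (h𝒢.op_isMultiplicative hmul) hS g₀ _ hker
  have hWτ := hτc.eventually hW
  let X : (b : TangentBundle 𝓘(ℝ, EP) P) → TangentSpace 𝓘(ℝ, EG) (τ b.proj) := fun b =>
    (∑ j, β j b • V j (τ b.proj)) + W (τ b.proj)
  have hπ : ContMDiff 𝓘(ℝ, EP).tangent 𝓘(ℝ, EP) ∞
      (Bundle.TotalSpace.proj : TangentBundle 𝓘(ℝ, EP) P → P) :=
    Bundle.contMDiff_proj (TangentSpace 𝓘(ℝ, EP))
  have hπ0 : Tendsto (Bundle.TotalSpace.proj : TangentBundle 𝓘(ℝ, EP) P → P) (𝓝 b₀) (𝓝 p₀) :=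
    hπ.continuous.continuousAt
  have hτπ : ContMDiffAt 𝓘(ℝ, EP).tangent 𝓘(ℝ, EG) ∞
      (fun b : TangentBundle 𝓘(ℝ, EP) P => τ b.proj) b₀ :=
    ContMDiffAt.comp (g := τ) b₀ hτ.self_of_nhds (hπ b₀)
  refine ⟨fun b => ⟨τ b.proj, X b⟩, ?_, ?_, ?_⟩
  · have h1 : ∀ g, g = g₀ → (⟨g, (∑ j, β j b₀ • V j g) + W g⟩ : TangentBundle 𝓘(ℝ, EG) G) =
        ⟨g₀, v⟩ := by
      rintro _ rfl
      simp only [hV0, hW0, add_sub_cancel]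
    exact h1 _ hτ0
  · have h1 : SmoothAlongAt 𝓘(ℝ, EP).tangent (fun b : TangentBundle 𝓘(ℝ, EP) P => τ b.proj)
        (fun b => ∑ j, β j b • V j (τ b.proj)) b₀ :=
      SmoothAlongAt.sum Finset.univ hτπ (fun j _ => hβ j) fun j _ =>
        SmoothAlongAt.comp (f := (id : G → G)) (X := V j)
          (φ := fun b : TangentBundle 𝓘(ℝ, EP) P => τ b.proj) (hVτ.self_of_nhds j).2 hτπ
    exact h1.add (SmoothAlongAt.comp (f := (id : G → G)) (X := W)
      (φ := fun b : TangentBundle 𝓘(ℝ, EP) P => τ b.proj) hWτ.self_of_nhds.2 hτπ)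
  · filter_upwards [hπ0.eventually hVτ, hπ0.eventually hWτ, hπ0.eventually hτs,
      hπ0.eventually hβY] with b h1 h2 h3 h4 hb
    refine ⟨Submodule.add_mem _ (Submodule.sum_mem _ fun j _ =>
      Submodule.smul_mem _ _ (h1 j).1) h2.1.1, ?_⟩
    have h5 : mfderiv 𝓘(ℝ, EG) 𝓘(ℝ, EP) 𝒢.source (τ b.proj) (W (τ b.proj)) = 0 := h2.1.2
    have h6 : (mfderiv 𝓘(ℝ, EG) 𝓘(ℝ, EP) 𝒢.source (τ b.proj) (X b) : EP) = b.snd := by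
      refine Eq.trans ?_ (h4 b.snd hb)
      simp only [X]
      rw [map_add, map_sum, h5, add_zero]
      exact Finset.sum_congr rfl fun j _ => map_smul _ _ _
    change (⟨𝒢.source (τ b.proj), (mfderiv 𝓘(ℝ, EG) 𝓘(ℝ, EP) 𝒢.source (τ b.proj) (X b) : EP)⟩ :
      TangentBundle 𝓘(ℝ, EP) P) = b
    rw [h6]
    exact TangentBundle.mk_congr h3 _

section Restrict

variable {k r : ℕ} {B : Set (TangentBundle 𝓘(ℝ, EP) P)}
  [ChartedSpace (EG × EuclideanSpace ℝ (Fin k)) S.total]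
  [ChartedSpace (EP × EuclideanSpace ℝ (Fin r)) B]
  (hιS : Manifold.IsSmoothEmbedding 𝓘(ℝ, EG × EuclideanSpace ℝ (Fin k)) 𝓘(ℝ, EG).tangent ∞
    (Subtype.val : S.total → TangentBundle 𝓘(ℝ, EG) G))
  (hιB : Manifold.IsSmoothEmbedding 𝓘(ℝ, EP × EuclideanSpace ℝ (Fin r)) 𝓘(ℝ, EP).tangent ∞
    (Subtype.val : B → TangentBundle 𝓘(ℝ, EP) P))
  (h : (𝒢.tangent 𝓘(ℝ, EG) 𝓘(ℝ, EP)).IsSubgroupoid S.total B)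
include hιS hιB

theorem contMDiff_restrict_source : ContMDiff 𝓘(ℝ, EG × EuclideanSpace ℝ (Fin k))
    𝓘(ℝ, EP × EuclideanSpace ℝ (Fin r)) ∞ h.restrict.source := by
  have h1 : ContMDiff 𝓘(ℝ, EG).tangent 𝓘(ℝ, EP).tangent ∞ (tangentMap 𝓘(ℝ, EG) 𝓘(ℝ, EP) 𝒢.source) :=
    h𝒢.source_submersion.contMDiff.contMDiff_tangentMap (by simp)
  exact hιB.contMDiff_of_comp (h1.comp hιS.contMDiff)

theorem contMDiff_restrict_unit : ContMDiff 𝓘(ℝ, EP × EuclideanSpace ℝ (Fin r))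
    𝓘(ℝ, EG × EuclideanSpace ℝ (Fin k)) ∞ h.restrict.unit := by
  have h1 : ContMDiff 𝓘(ℝ, EP).tangent 𝓘(ℝ, EG).tangent ∞ (tangentMap 𝓘(ℝ, EP) 𝓘(ℝ, EG) 𝒢.unit) :=
    h𝒢.unit_smooth.contMDiff_tangentMap (by simp)
  exact hιS.contMDiff_of_comp (h1.comp hιB.contMDiff)

theorem isSubmersion_restrict_source [FiniteDimensional ℝ EG] [FiniteDimensional ℝ EP]
    [IsManifold 𝓘(ℝ, EG × EuclideanSpace ℝ (Fin k)) ∞ S.total]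
    [IsManifold 𝓘(ℝ, EP × EuclideanSpace ℝ (Fin r)) ∞ B]
    (hk : ∀ g, Module.finrank ℝ (S g) = k) (hS : IsSmoothSubbundle 𝓘(ℝ, EG) S)
    (hr : ∀ p, Module.finrank ℝ (𝒢.interUnits 𝓘(ℝ, EG) 𝓘(ℝ, EP) S p) = r) :
    Manifold.IsSubmersion 𝓘(ℝ, EG × EuclideanSpace ℝ (Fin k))
      𝓘(ℝ, EP × EuclideanSpace ℝ (Fin r)) ∞ h.restrict.source := by
  classical
  have hB := h𝒢.isSubgroupoid_total_unique h
  refine Manifold.isSubmersion_of_local_sections (h𝒢.contMDiff_restrict_source hιS hιB h)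
    fun v₀ => ?_
  obtain ⟨σ, hσ0, hσ, hev⟩ := h𝒢.exists_local_section_tangent_source ⟨B, h⟩ hk hS hr v₀.2
  -- the value `v₀` outside of a neighbourhood does not matter
  let σ' : B → S.total := fun b => if hb : σ b ∈ S.total then ⟨σ b, hb⟩ else v₀
  have hσ' : ∀ {b : B} (hb : σ b ∈ S.total), σ' b = ⟨σ b, hb⟩ := fun hb => dif_pos hb
  have hval : ContinuousAt (Subtype.val : B → TangentBundle 𝓘(ℝ, EP) P) (h.restrict.source v₀) :=
    continuous_subtype_val.continuousAt
  have hev' : ∀ᶠ b : B in 𝓝 (h.restrict.source v₀),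
      σ b ∈ S.total ∧ (𝒢.tangent 𝓘(ℝ, EG) 𝓘(ℝ, EP)).source (σ b) = b := by
    filter_upwards [hval.eventually hev] with b hb
    exact hb (hB ▸ b.2)
  refine ⟨σ', ?_, ?_, ?_⟩
  · have h1 : σ (h.restrict.source v₀ : TangentBundle 𝓘(ℝ, EP) P) ∈ S.total :=
      hev'.self_of_nhds.1
    rw [hσ' h1]
    exact Subtype.ext hσ0
  · have h1 : ContMDiffAt 𝓘(ℝ, EP × EuclideanSpace ℝ (Fin r)) 𝓘(ℝ, EG).tangent ∞
        (Subtype.val ∘ σ') (h.restrict.source v₀) := by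
      refine ContMDiffAt.congr_of_eventuallyEq
        (ContMDiffAt.comp (h.restrict.source v₀) hσ (hιB.contMDiff _)) ?_
      filter_upwards [hev'] with b hb
      simp only [Function.comp_apply, hσ' hb.1]
    have h2 := hιS.contMDiffWithinAt_of_comp (contMDiffWithinAt_univ.2 h1)
    exact (contMDiffWithinAt_univ.1 h2).mdifferentiableAt (by simp)
  · filter_upwards [hev'] with b hb
    rw [hσ' hb.1]
    exact Subtype.ext hb.2

omit [IsManifold 𝓘(ℝ, EP) ∞ P] [ChartedSpace (EP × EuclideanSpace ℝ (Fin r)) B] hιB in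
theorem contMDiffOn_restrict_mul :
    ContMDiffOn (𝓘(ℝ, EG × EuclideanSpace ℝ (Fin k)).prod 𝓘(ℝ, EG × EuclideanSpace ℝ (Fin k)))
      𝓘(ℝ, EG × EuclideanSpace ℝ (Fin k)) ∞ h.restrict.mulExt h.restrict.composable := by
  rintro ⟨a₀, b₀⟩ h₀
  have e₀ : (𝒢.tangent 𝓘(ℝ, EG) 𝓘(ℝ, EP)).source a₀ = (𝒢.tangent 𝓘(ℝ, EG) 𝓘(ℝ, EP)).target b₀ :=
    congrArg Subtype.val h₀
  obtain ⟨K, hK, hKeq⟩ := h𝒢.exists_smooth_extension_tangent_mul _ _ e₀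
  refine hιS.contMDiffWithinAt_of_comp ?_
  have hval : ContMDiff
      (𝓘(ℝ, EG × EuclideanSpace ℝ (Fin k)).prod 𝓘(ℝ, EG × EuclideanSpace ℝ (Fin k)))
      (𝓘(ℝ, EG).tangent.prod 𝓘(ℝ, EG).tangent) ∞
      (Prod.map Subtype.val Subtype.val : S.total × S.total → _) :=
    hιS.contMDiff.prodMap hιS.contMDiff
  have hK0 : ContMDiffAt (𝓘(ℝ, EG).tangent.prod 𝓘(ℝ, EG).tangent) 𝓘(ℝ, EG).tangent ∞ K
    (Prod.map Subtype.val Subtype.val (a₀, b₀)) := hK.self_of_nhds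
  have h1 := (hK0.comp (a₀, b₀) (hval (a₀, b₀))).contMDiffWithinAt (s := h.restrict.composable)
  have h2 : ∀ q ∈ h.restrict.composable, (∀ e, (𝒢.tangent 𝓘(ℝ, EG) 𝓘(ℝ, EP)).mul q.1 q.2 e =
      K (Prod.map Subtype.val Subtype.val q)) →
      (Subtype.val ∘ h.restrict.mulExt) q = (K ∘ Prod.map Subtype.val Subtype.val) q := by
    rintro ⟨a, b⟩ hq h3
    have hq' : h.restrict.source a = h.restrict.target b := hq
    have e : (𝒢.tangent 𝓘(ℝ, EG) 𝓘(ℝ, EP)).source a = (𝒢.tangent 𝓘(ℝ, EG) 𝓘(ℝ, EP)).target b :=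
      congrArg Subtype.val hq'
    rw [Function.comp_apply, Function.comp_apply, h.restrict.mulExt_apply hq', ← h3 e]
    rfl
  have h4 : ∀ᶠ q in 𝓝 (a₀, b₀), ∀ e, (𝒢.tangent 𝓘(ℝ, EG) 𝓘(ℝ, EP)).mul q.1 q.2 e =
      K (Prod.map Subtype.val Subtype.val q) :=
    (hval.continuous.continuousAt (x := (a₀, b₀))).eventually hKeq
  refine h1.congr_of_eventuallyEq ?_ (h2 _ h₀ h4.self_of_nhds)
  filter_upwards [mem_nhdsWithin_of_mem_nhds h4, self_mem_nhdsWithin] with q h5 h6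
  exact h2 q h6 h5

/-- A multiplicative subbundle `S` of constant rank is a Lie groupoid over its units, if they have
constant rank as well, for any structures of embedded submanifolds. -/
theorem restrict_tangent [FiniteDimensional ℝ EG] [FiniteDimensional ℝ EP]
    [IsManifold 𝓘(ℝ, EG × EuclideanSpace ℝ (Fin k)) ∞ S.total]
    [IsManifold 𝓘(ℝ, EP × EuclideanSpace ℝ (Fin r)) ∞ B]
    (hk : ∀ g, Module.finrank ℝ (S g) = k) (hS : IsSmoothSubbundle 𝓘(ℝ, EG) S)
    (hr : ∀ p, Module.finrank ℝ (𝒢.interUnits 𝓘(ℝ, EG) 𝓘(ℝ, EP) S p) = r) :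
    h.restrict.IsLieGroupoid 𝓘(ℝ, EG × EuclideanSpace ℝ (Fin k))
      𝓘(ℝ, EP × EuclideanSpace ℝ (Fin r)) where
  source_mul a b e := Subtype.ext (h𝒢.tangent_source_mul a b (congrArg Subtype.val e))
  target_mul a b e := Subtype.ext (h𝒢.tangent_target_mul a b (congrArg Subtype.val e))
  mul_assoc a b c e₁ e₂ e₃ e₄ := Subtype.ext (h𝒢.tangent_mul_assoc a b c
    (congrArg Subtype.val e₁) (congrArg Subtype.val e₂) (congrArg Subtype.val e₃)
    (congrArg Subtype.val e₄))
  source_unit b := Subtype.ext (h𝒢.tangent_source_unit b)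
  target_unit b := Subtype.ext (h𝒢.tangent_target_unit b)
  mul_unit a e := Subtype.ext (h𝒢.tangent_mul_unit a (congrArg Subtype.val e))
  unit_mul a e := Subtype.ext (h𝒢.tangent_unit_mul a (congrArg Subtype.val e))
  exists_inv a := by
    obtain ⟨a', ha', e, e', h1, h2⟩ := h.exists_inv_mem a a.2
    exact ⟨⟨a', ha'⟩, Subtype.ext e, Subtype.ext e', Subtype.ext h1, Subtype.ext h2⟩
  source_submersion := h𝒢.isSubmersion_restrict_source hιS hιB h hk hS hr
  source_surjective b := ⟨h.restrict.unit b, Subtype.ext (h𝒢.tangent_source_unit b)⟩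
  -- the target map of `S` is the source map of `S` as a subgroupoid of the opposite groupoid
  target_submersion :=
    h𝒢.op.isSubmersion_restrict_source hιS hιB (h𝒢.op_isSubgroupoid h) hk hS hr
  target_surjective b := ⟨h.restrict.unit b, Subtype.ext (h𝒢.tangent_target_unit b)⟩
  unit_smooth := h𝒢.contMDiff_restrict_unit hιS hιB h
  mul_smooth := h𝒢.contMDiffOn_restrict_mul hιS h

end Restrict

end GroupoidOps.IsLieGroupoid

end

theorem mainTheorem6
    {EG : Type*} [NormedAddCommGroup EG] [NormedSpace ℝ EG] [FiniteDimensional ℝ EG]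
    {EP : Type*} [NormedAddCommGroup EP] [NormedSpace ℝ EP] [FiniteDimensional ℝ EP]
    {G : Type*} [TopologicalSpace G] [ChartedSpace EG G] [IsManifold 𝓘(ℝ, EG) ∞ G]
    {P : Type*} [TopologicalSpace P] [ChartedSpace EP P] [IsManifold 𝓘(ℝ, EP) ∞ P]
    (𝒢 : GroupoidOps G P) (h𝒢 : 𝒢.IsLieGroupoid 𝓘(ℝ, EG) 𝓘(ℝ, EP))
    (S : TangentDistribution 𝓘(ℝ, EG) G) (hS : IsSmoothSubbundle 𝓘(ℝ, EG) S)
    (k : ℕ) (hk : ∀ g, Module.finrank ℝ (S g) = k)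
    (hmul : 𝒢.IsMultiplicative 𝓘(ℝ, EG) 𝓘(ℝ, EP) S) :
    -- `S ∩ TP` is a smooth subbundle of `TP`; its rank is constant
    IsSmoothSubbundle 𝓘(ℝ, EP) (𝒢.interUnits 𝓘(ℝ, EG) 𝓘(ℝ, EP) S) ∧
    (𝒢.IsOrbitConnected →
      ∃ r : ℕ, ∀ p, Module.finrank ℝ (𝒢.interUnits 𝓘(ℝ, EG) 𝓘(ℝ, EP) S p) = r) ∧
    -- `S ∩ TP` is the set of units of the subgroupoid `S` of `TG`
    (∀ B, (𝒢.tangent 𝓘(ℝ, EG) 𝓘(ℝ, EP)).IsSubgroupoid S.total B ↔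
      B = (𝒢.interUnits 𝓘(ℝ, EG) 𝓘(ℝ, EP) S).total) ∧
    -- `S ⇉ S ∩ TP` is a Lie groupoid, embedded in `TG ⇉ TP`
    (∀ r : ℕ, (∀ p, Module.finrank ℝ (𝒢.interUnits 𝓘(ℝ, EG) 𝓘(ℝ, EP) S p) = r) →
      ∃ (h : (𝒢.tangent 𝓘(ℝ, EG) 𝓘(ℝ, EP)).IsSubgroupoid S.total
          (𝒢.interUnits 𝓘(ℝ, EG) 𝓘(ℝ, EP) S).total)
        (_ : ChartedSpace (EG × EuclideanSpace ℝ (Fin k)) S.total)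
        (_ : ChartedSpace (EP × EuclideanSpace ℝ (Fin r))
          (𝒢.interUnits 𝓘(ℝ, EG) 𝓘(ℝ, EP) S).total),
        IsManifold 𝓘(ℝ, EG × EuclideanSpace ℝ (Fin k)) ∞ S.total ∧
        IsManifold 𝓘(ℝ, EP × EuclideanSpace ℝ (Fin r)) ∞
          (𝒢.interUnits 𝓘(ℝ, EG) 𝓘(ℝ, EP) S).total ∧
        Manifold.IsSmoothEmbedding 𝓘(ℝ, EG × EuclideanSpace ℝ (Fin k)) 𝓘(ℝ, EG).tangent ∞
          (Subtype.val : S.total → TangentBundle 𝓘(ℝ, EG) G) ∧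
        Manifold.IsSmoothEmbedding 𝓘(ℝ, EP × EuclideanSpace ℝ (Fin r)) 𝓘(ℝ, EP).tangent ∞
          (Subtype.val : (𝒢.interUnits 𝓘(ℝ, EG) 𝓘(ℝ, EP) S).total →
            TangentBundle 𝓘(ℝ, EP) P) ∧
        h.restrict.IsLieGroupoid 𝓘(ℝ, EG × EuclideanSpace ℝ (Fin k))
          𝓘(ℝ, EP × EuclideanSpace ℝ (Fin r))) ∧
    -- `S|_P = (S ∩ TP) ⊕ (S ∩ AG)` as vector bundles over `P`
    IsSmoothSubbundleAlong 𝓘(ℝ, EG) 𝓘(ℝ, EP) 𝒢.unit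
      (fun p => S (𝒢.unit p) ⊓ 𝒢.tangentUnits 𝓘(ℝ, EG) 𝓘(ℝ, EP) p) ∧
    IsSmoothSubbundleAlong 𝓘(ℝ, EG) 𝓘(ℝ, EP) 𝒢.unit
      (fun p => S (𝒢.unit p) ⊓ 𝒢.algebroid 𝓘(ℝ, EG) 𝓘(ℝ, EP) p) ∧
    (∀ p, Disjoint (S (𝒢.unit p) ⊓ 𝒢.tangentUnits 𝓘(ℝ, EG) 𝓘(ℝ, EP) p)
        (S (𝒢.unit p) ⊓ 𝒢.algebroid 𝓘(ℝ, EG) 𝓘(ℝ, EP) p) ∧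
      (S (𝒢.unit p) ⊓ 𝒢.tangentUnits 𝓘(ℝ, EG) 𝓘(ℝ, EP) p) ⊔
        (S (𝒢.unit p) ⊓ 𝒢.algebroid 𝓘(ℝ, EG) 𝓘(ℝ, EP) p) = S (𝒢.unit p)) ∧
    -- `S^t(g) = 0_g ⋆ S^t(s(g)) = TL_g (S^t(s(g)))`, where `S^t = S ∩ T^t G`
    (∀ g, (S ⊓ 𝒢.kerTarget 𝓘(ℝ, EG) 𝓘(ℝ, EP)).fiber g =
        {u | ∃ w ∈ (S ⊓ 𝒢.kerTarget 𝓘(ℝ, EG) 𝓘(ℝ, EP)).fiber (𝒢.unit (𝒢.source g)), ∃ e,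
          u = (𝒢.tangent 𝓘(ℝ, EG) 𝓘(ℝ, EP)).mul ⟨g, 0⟩ w e} ∧
      (S ⊓ 𝒢.kerTarget 𝓘(ℝ, EG) 𝓘(ℝ, EP)).fiber g =
        𝒢.tangentLeft 𝓘(ℝ, EG) g ''
          (S ⊓ 𝒢.kerTarget 𝓘(ℝ, EG) 𝓘(ℝ, EP)).fiber (𝒢.unit (𝒢.source g))) ∧
    -- `S^s(g) = S^s(t(g)) ⋆ 0_g = TR_g (S^s(t(g)))`, where `S^s = S ∩ T^s G`
    (∀ g, (S ⊓ 𝒢.kerSource 𝓘(ℝ, EG) 𝓘(ℝ, EP)).fiber g =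
        {u | ∃ w ∈ (S ⊓ 𝒢.kerSource 𝓘(ℝ, EG) 𝓘(ℝ, EP)).fiber (𝒢.unit (𝒢.target g)), ∃ e,
          u = (𝒢.tangent 𝓘(ℝ, EG) 𝓘(ℝ, EP)).mul w ⟨g, 0⟩ e} ∧
      (S ⊓ 𝒢.kerSource 𝓘(ℝ, EG) 𝓘(ℝ, EP)).fiber g =
        𝒢.tangentRight 𝓘(ℝ, EG) g ''
          (S ⊓ 𝒢.kerSource 𝓘(ℝ, EG) 𝓘(ℝ, EP)).fiber (𝒢.unit (𝒢.target g))) ∧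
    -- `S^t` and `S^s` are smooth subbundles of `TG`; their ranks are constant
    IsSmoothSubbundle 𝓘(ℝ, EG) (S ⊓ 𝒢.kerTarget 𝓘(ℝ, EG) 𝓘(ℝ, EP)) ∧
    IsSmoothSubbundle 𝓘(ℝ, EG) (S ⊓ 𝒢.kerSource 𝓘(ℝ, EG) 𝓘(ℝ, EP)) ∧
    (𝒢.IsOrbitConnected →
      (∃ a : ℕ, ∀ g, Module.finrank ℝ
        ((S ⊓ 𝒢.kerTarget 𝓘(ℝ, EG) 𝓘(ℝ, EP)) g : Submodule ℝ (TangentSpace 𝓘(ℝ, EG) g)) = a) ∧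
      (∃ b : ℕ, ∀ g, Module.finrank ℝ
        ((S ⊓ 𝒢.kerSource 𝓘(ℝ, EG) 𝓘(ℝ, EP)) g : Submodule ℝ (TangentSpace 𝓘(ℝ, EG) g)) = b)) := by
  have hDP := h𝒢.isSmoothSubbundle_interUnits hmul hk hS
  refine ⟨hDP, h𝒢.exists_finrank_interUnits_eq hmul hk hS, fun B => ⟨fun hB =>
    h𝒢.isSubgroupoid_total_unique hB, ?_⟩, fun r hr => ?_,
    h𝒢.isSmoothSubbundleAlong_inf_tangentUnits hmul hk hS,
    h𝒢.isSmoothSubbundleAlong_inf_algebroid hmul hk hS,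
    fun p => h𝒢.disjoint_and_sup_eq hmul p,
    fun g => ⟨h𝒢.fiber_kerTarget_eq hmul g, h𝒢.fiber_kerTarget_eq_image_tangentLeft hmul g⟩,
    fun g => ⟨h𝒢.fiber_kerSource_eq hmul g, h𝒢.fiber_kerSource_eq_image_tangentRight hmul g⟩,
    h𝒢.isSmoothSubbundle_inf_kerTarget hmul hk hS,
    h𝒢.isSmoothSubbundle_inf_kerSource hmul hk hS,
    fun hconn => ⟨h𝒢.exists_finrank_inf_kerTarget_eq hmul hk hS hconn,
      h𝒢.exists_finrank_inf_kerSource_eq hmul hk hS hconn⟩⟩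
  · rintro rfl
    exact h𝒢.isSubgroupoid_interUnits hmul
  · obtain ⟨csS, hmS, hιS⟩ := hS.exists_chartedSpace_total hk
    obtain ⟨csB, hmB, hιB⟩ := hDP.exists_chartedSpace_total hr
    exact ⟨h𝒢.isSubgroupoid_interUnits hmul, csS, csB, hmS, hmB, hιS, hιB,
      h𝒢.restrict_tangent hιS hιB _ hk hS hr⟩
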